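/- Let $d\ge 1$, let $\Omega\subset\mathbb R^d$ be a nonempty bounded convex open set with polyhedral boundary, $s\in(0,1)$, $\alpha=1-2s$ and $T>0$. Let $\{\lambda_l,\varphi_l\}_{l\in\mathbb N}$ be the eigenpairs of the Dirichlet Laplacian on $\Omega$, with $\{\varphi_l\}$ orthonormal in $L^2(\Omega)$ and smallest eigenvalue $\lambda_1>0$. For $w\in L^2(\Omega)$ put $w_l=(w,\varphi_l)_{L^2(\Omega)}$, $\|w\|_{\mathbb H^r(\Omega)}^2=\sum_l\lambda_l^r w_l^2$, $\mathbb H^r(\Omega)=\{w\in L^2(\Omega):\|w\|_{\mathbb H^r(\Omega)}<\infty\}$ and $(-\Delta)^s w=\sum_l\lambda_l^s w_l\varphi_l$; for $w,z\in\mathbb H^s(\Omega)$, $\langle(-\Delta)^s w,z\rangle=\sum_l\lambda_l^s w_l z_l$. Let $\psi\in\mathbb H^s(\Omega)\cap C(\bar\Omega)$ with $\psi\le 0$ on $\partial\Omega$, let $\mathcal K(\Omega)=\{w\in\mathbb H^s(\Omega): w\ge\psi\text{ a.e. in }\Omega\}$ and let $u_0\in\mathcal K(\Omega)$. For $f\in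 L^2(0,T;L^2(\Omega))$ let $u$ be the strong solution of the parabolic fractional obstacle problem: $u\in C([0,T];L^2(\Omega))$ is locally absolutely continuous in $(0,T)$, $u(0)=u_0$, and for a.e. $t\in(0,T)$ one has $u(t)\in\mathcal K(\Omega)$ and $$(d_t u(t),u(t)-\phi)_{L^2(\Omega)}+\langle(-\Delta)^s u(t),u(t)-\phi\rangle\le(f(t),u(t)-\phi)_{L^2(\Omega)}\qquad\forall\phi\in\mathcal K(\Omega).$$ For $\mathcal Y\ge 1$ let $\mathcal C_{\mathcal Y}=\Omega\times(0,\mathcal Y)$, let $H_{\mathcal Y}$ be the space of the functions in $H^1(y^\alpha,\mathcal C_{\mathcal Y})$ that vanish on $\partial\Omega\times(0,\mathcal Y)\cup\Omega\times\{\mathcal Y\}$, $\operatorname{tr}$ the trace onto $\Omega\times\{0\}$, $\mathcal K(\mathcal C_{\mathcal Y})=\{w\in H_{\mathcal Y}:\operatorname{tr}w\ge\psi\text{ a.e. in }\Omega\}$ and $$a_{\mathcal Y}(w,\phi)=\frac1{d_s}\int_{\mathcal C_{\mathcal Y}}y^\alpha\nabla w\cdot\nabla\phi\,dx'\,dy,\qquad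 d_s=2^\alpha\frac{\Gamma(1-s)}{\Gamma(s)}.$$ Let $N\ge1$, $\tau=T/N$, $t_k=k\tau$. Given $f^1,\dots,f^N\in L^2(\Omega)$, let $V^0,\dots,V^N\in\mathcal K(\mathcal C_{\mathcal Y})$ satisfy $\operatorname{tr}V^0=u_0$ and, for $k=0,\dots,N-1$ and all $\phi\in\mathcal K(\mathcal C_{\mathcal Y})$, $$\Big(\operatorname{tr}\tfrac{V^{k+1}-V^k}{\tau},\operatorname{tr}(V^{k+1}-\phi)\Big)_{L^2(\Omega)}+a_{\mathcal Y}(V^{k+1},V^{k+1}-\phi)\le(f^{k+1},\operatorname{tr}(V^{k+1}-\phi))_{L^2(\Omega)}.$$ Put $U^k=\operatorname{tr}V^k$, let $\bar U^\tau$ be the piecewise constant interpolant ($\bar U^\tau=U^{k+1}$ on $(t_k,t_{k+1}]$) and $\hat U^\tau$ the continuous piecewise linear interpolant of $U^0,\dots,U^N$ at $t_0,\dots,t_N$, and $$\mathcal E(u,U^\tau)=\|u-\hat U^\tau\|_{L^\infty(0,T;L^2(\Omega))}+\|u-\bar U^\tau\|_{L^2(0,T;\mathbb H^s(\Omega))},$$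 $$\mathfrak D=\big(\|u_0\|_{L^2(\Omega)}^2+\|f\|_{L^2(0,T;L^2(\Omega))}^2+\|\psi\|_{\mathbb H^s(\Omega)}^2\big)^{1/2}.$$ Then there is a constant $C$, depending only on $\Omega$, $s$ and $T$ (not on $\psi,u_0,f,\mathcal Y,\tau$), such that: 1. If $f\in L^2(0,T;L^2(\Omega))$ and $f^{k}=\tau^{-1}\int_{t_{k-1}}^{t_{k}}f\,dt$, then $$\mathcal E(u,U^\tau)\le C\Big(\tau^{1/2}\big(\|u_0\|_{\mathbb H^s(\Omega)}+\|f\|_{L^2(0,T;L^2(\Omega))}\big)+e^{-\sqrt{\lambda_1}\,\mathcal Y/8}\,\mathfrak D\Big).$$ 2. If $u_0\in\mathcal K(\Omega)\cap\mathbb H^{2s}(\Omega)$, $f:[0,T]\to L^2(\Omega)$ is of bounded variation and $f^k=f_+(t_k)$, where $f_+(t)$ is the right limit of $f$ at $t<T$ and $f_+(T)=f(T)$, then $$\mathcal E(u,U^\tau)\le C\Big(\tau\big(\|f_+(0)-(-\Delta)^su_0\|_{L^2(\Omega)}+\operatorname{Var}_{L^2(\Omega)}f\big)+e^{-\sqrt{\lambda_1}\,\mathcal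 Y/8}\,\mathfrak D\Big).$$ -/

import Mathlib

open MeasureTheory Set Filter Topology
open scoped ENNReal NNReal

noncomputable section

namespace FracObstacle

/-! ## Domains and Lebesgue spaces -/

/-- The Euclidean space `ℝ^d`. -/
abbrev E (d : ℕ) := EuclideanSpace ℝ (Fin d)

/-- A nonempty, bounded, convex, open set with polyhedral boundary: a nonempty bounded finite
intersection of open half-spaces. -/
def IsConvexPolyhedralDomain {d : ℕ} (Ω : Set (E d)) : Prop :=
  Ω.Nonempty ∧ Bornology.IsBounded Ω ∧
    ∃ (N : ℕ) (a : Fin N → E d) (b : Fin N → ℝ),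
      (∀ i, a i ≠ 0) ∧ Ω = {x | ∀ i, inner ℝ (a i) x < b i}

/-- `L²(Ω)`. -/
abbrev L2 {d : ℕ} (Ω : Set (E d)) := Lp ℝ 2 (volume.restrict Ω)

/-- `L²(Ω; ℝ^d)`. -/
abbrev L2Vec {d : ℕ} (Ω : Set (E d)) := Lp (E d) 2 (volume.restrict Ω)

/-! ## The Dirichlet Laplacian and its spectrum -/

/-- Pairs `(η, ∇η)` with `η ∈ C_c^∞(Ω)`, as elements of `L²(Ω) × L²(Ω; ℝ^d)`. -/
def testGraph {d : ℕ} (Ω : Set (E d)) : Submodule ℝ (L2 Ω × L2Vec Ω) where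
  carrier := {p | ∃ η : E d → ℝ, ContDiff ℝ (⊤ : ℕ∞) η ∧ HasCompactSupport η ∧ tsupport η ⊆ Ω ∧
    p.1 =ᵐ[volume.restrict Ω] η ∧ p.2 =ᵐ[volume.restrict Ω] gradient η}
  zero_mem' := by
    refine ⟨fun _ => 0, contDiff_const, HasCompactSupport.zero, ?_, ?_, ?_⟩
    · rw [show (fun _ : E d => (0 : ℝ)) = 0 from rfl, tsupport_zero]
      exact empty_subset _
    · exact Lp.coeFn_zero ..
    · refine (Lp.coeFn_zero ..).trans (Eventually.of_forall fun x => ?_)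
      simp
  add_mem' := by
    rintro p q ⟨η, h1, h2, h3, h4, h5⟩ ⟨θ, k1, k2, k3, k4, k5⟩
    refine ⟨η + θ, h1.add k1, h2.add k2, ?_, ?_, ?_⟩
    · exact (tsupport_add η θ).trans (union_subset h3 k3)
    · exact (Lp.coeFn_add p.1 q.1).trans (h4.add k4)
    · refine (Lp.coeFn_add p.2 q.2).trans ((h5.add k5).trans (Eventually.of_forall fun x => ?_))
      have e1 := (h1.differentiable (by simp)) x
      have e2 := (k1.differentiable (by simp)) x
      simp [gradient, fderiv_add e1 e2]
  smul_mem' := by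
    rintro c p ⟨η, h1, h2, h3, h4, h5⟩
    refine ⟨c • η, h1.const_smul c, h2.mono (Function.support_const_smul_subset c η),
      (closure_mono (Function.support_const_smul_subset c η)).trans h3, ?_, ?_⟩
    · exact (Lp.coeFn_smul c p.1).trans (h4.const_smul c)
    · refine (Lp.coeFn_smul c p.2).trans
        ((h5.const_smul c).trans (Eventually.of_forall fun x => ?_))
      have e1 := (h1.differentiable (by simp)) x
      simp [gradient, fderiv_const_smul e1 c]

/-- `H¹₀(Ω)`, the closure of `C_c^∞(Ω)` in the `H¹` norm; a function `w` of this space is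
represented by the pair `(w, ∇w)`. -/
def H10 {d : ℕ} (Ω : Set (E d)) : Submodule ℝ (L2 Ω × L2Vec Ω) :=
  (testGraph Ω).topologicalClosure

/-- The solutions `φ ∈ H¹₀(Ω)` of `-Δφ = mu φ`, in the weak sense
`∫ ∇φ · ∇η = mu ∫ φ η` for all `η ∈ H¹₀(Ω)`. -/
def eigenspace {d : ℕ} (Ω : Set (E d)) (mu : ℝ) : Submodule ℝ (L2 Ω) where
  carrier := {φ | ∃ G : L2Vec Ω, (φ, G) ∈ H10 Ω ∧
    ∀ q ∈ H10 Ω, inner ℝ G q.2 = mu * inner ℝ φ q.1}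
  zero_mem' := ⟨0, (H10 Ω).zero_mem, fun q _ => by simp⟩
  add_mem' := by
    rintro φ χ ⟨G, hG, h⟩ ⟨K, hK, k⟩
    refine ⟨G + K, (H10 Ω).add_mem hG hK, fun q hq => ?_⟩
    rw [inner_add_left, inner_add_left, h q hq, k q hq, mul_add]
  smul_mem' := by
    rintro c φ ⟨G, hG, h⟩
    refine ⟨c • G, (H10 Ω).smul_mem c hG, fun q hq => ?_⟩
    rw [real_inner_smul_left, real_inner_smul_left, h q hq]
    ring

/-- The first (smallest) eigenvalue of the Dirichlet Laplacian. -/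
def firstEigenvalue {d : ℕ} (Ω : Set (E d)) : ℝ :=
  sInf {mu : ℝ | eigenspace Ω mu ≠ ⊥}

/-- The `L²(Ω)`-orthogonal projection onto the eigenspace for `mu`; it is zero unless `mu` is an
eigenvalue. For an orthonormal eigenbasis `φ_l` with eigenvalues `λ_l` it is
`w ↦ ∑_{λ_l = mu} (w, φ_l) φ_l`. (The eigenspaces are already closed; the closure only serves to
have the projection at hand.) -/
def spectralProj {d : ℕ} (Ω : Set (E d)) (mu : ℝ) : L2 Ω →L[ℝ] L2 Ω :=
  (eigenspace Ω mu).topologicalClosure.starProjection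

/-! ## The spaces `ℍ^r(Ω)` and the fractional Laplacian -/

/-- `‖w‖²_{ℍ^r} = ∑_l λ_l^r w_l²`, with the equal eigenvalues grouped together; it is `∞` if `w`
is not in `ℍ^r(Ω)`. -/
def hNormSq {d : ℕ} (Ω : Set (E d)) (r : ℝ) (w : L2 Ω) : ℝ≥0∞ :=
  ∑' mu : ℝ, ENNReal.ofReal (mu ^ r * ‖spectralProj Ω mu w‖ ^ 2)

/-- `‖w‖_{ℍ^r}`. -/
def hNorm {d : ℕ} (Ω : Set (E d)) (r : ℝ) (w : L2 Ω) : ℝ≥0∞ :=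
  hNormSq Ω r w ^ (1 / 2 : ℝ)

/-- The space `ℍ^r(Ω)`, the domain of `(-Δ)^{r/2}`. -/
def hSpace {d : ℕ} (Ω : Set (E d)) (r : ℝ) : Set (L2 Ω) :=
  {w | hNormSq Ω r w < ∞}

/-- `(-Δ)^s w = ∑_l λ_l^s w_l φ_l ∈ L²(Ω)`, for `w ∈ ℍ^{2s}(Ω)`. -/
def fracLaplacian {d : ℕ} (Ω : Set (E d)) (s : ℝ) (w : L2 Ω) : L2 Ω :=
  ∑' mu : ℝ, mu ^ s • spectralProj Ω mu w

/-- The duality pairing `⟨(-Δ)^s w, z⟩ = ∑_l λ_l^s w_l z_l` between `ℍ^{-s}(Ω)` and `ℍ^s(Ω)`, for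
`w, z ∈ ℍ^s(Ω)`. -/
def fracPairing {d : ℕ} (Ω : Set (E d)) (s : ℝ) (w z : L2 Ω) : ℝ :=
  ∑' mu : ℝ, mu ^ s * inner ℝ (spectralProj Ω mu w) (spectralProj Ω mu z)

/-! ## The parabolic fractional obstacle problem -/

/-- `ψ ∈ ℍ^s(Ω) ∩ C(closure Ω)` and `ψ ≤ 0` on `∂Ω`. -/
def IsObstacle {d : ℕ} (Ω : Set (E d)) (s : ℝ) (ψ : L2 Ω) : Prop :=
  ψ ∈ hSpace Ω s ∧ ∃ ψc : E d → ℝ, ContinuousOn ψc (closure Ω) ∧ (∀ x ∈ frontier Ω, ψc x ≤ 0) ∧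
    ψ =ᵐ[volume.restrict Ω] ψc

/-- The admissible set `K(Ω)` of the functions of `ℍ^s(Ω)` above the obstacle. -/
def admissible {d : ℕ} (Ω : Set (E d)) (s : ℝ) (ψ : L2 Ω) : Set (L2 Ω) :=
  {w | w ∈ hSpace Ω s ∧ ∀ᵐ x ∂(volume.restrict Ω), ψ x ≤ w x}

/-- `u` is a strong solution of the parabolic fractional obstacle problem on `[0, T]`: it is
continuous on `[0, T]` with values in `L²(Ω)`, locally absolutely continuous in `(0, T)`, starts
at `u₀`, and satisfies the evolution variational inequality for almost every `t`. -/
def IsStrongSolution {d : ℕ} (Ω : Set (E d)) (s T : ℝ) (ψ u₀ : L2 Ω) (f u : ℝ → L2 Ω) : Prop :=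
  ContinuousOn u (Icc 0 T) ∧
  (∀ a b, 0 < a → a < b → b < T → AbsolutelyContinuousOnInterval u a b) ∧
  u 0 = u₀ ∧
  ∀ᵐ t ∂(volume.restrict (Ioo 0 T)), u t ∈ admissible Ω s ψ ∧
    ∃ u' : L2 Ω, HasDerivAt u u' t ∧ ∀ φ ∈ admissible Ω s ψ,
      inner ℝ u' (u t - φ) + fracPairing Ω s (u t) (u t - φ) ≤ inner ℝ (f t) (u t - φ)

/-- `𝔇 = (‖u₀‖²_{L²} + ‖f‖²_{L²(0,T;L²)} + ‖ψ‖²_{ℍ^s})^{1/2}`. -/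
def dataNorm {d : ℕ} (Ω : Set (E d)) (s T : ℝ) (ψ u₀ : L2 Ω) (f : ℝ → L2 Ω) : ℝ≥0∞ :=
  (‖u₀‖ₑ ^ 2 + eLpNorm f 2 (volume.restrict (Ioo 0 T)) ^ 2 + hNormSq Ω s ψ) ^ (1 / 2 : ℝ)

/-- The right limit `f_+(t) = lim_{r ↓ t} f(r)` of a function on `[0, T]`; at `t = T` the function
is continued by the constant `f(T)`, so that `f_+(T) = f(T)`. -/
def rightLimit {d : ℕ} {Ω : Set (E d)} (T : ℝ) (f : ℝ → L2 Ω) (t : ℝ) : L2 Ω :=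
  Function.rightLim (fun r => f (min r T)) t

/-! ## The truncated cylinder -/

/-- The measure `y^α dx' dy` on the truncated cylinder `Ω × (0, Y)`. -/
def cylMeasure {d : ℕ} (Ω : Set (E d)) (α Y : ℝ) : Measure (E d × ℝ) :=
  (volume.restrict (Ω ×ˢ Ioo 0 Y)).withDensity fun p => ENNReal.ofReal (p.2 ^ α)

/-- Quadruples `(w, ∇_{x'} w, ∂_y w, tr w)` of square integrable functions, the first three on the
truncated cylinder with weight `y^α`, the last one on `Ω`. -/
abbrev CylSpace {d : ℕ} (Ω : Set (E d)) (α Y : ℝ) :=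
  Lp ℝ 2 (cylMeasure Ω α Y) × Lp (E d) 2 (cylMeasure Ω α Y) × Lp ℝ 2 (cylMeasure Ω α Y) × L2 Ω

/-- The gradient with respect to `x'`. -/
def cylGradX {d : ℕ} {Ω : Set (E d)} {α Y : ℝ} (W : CylSpace Ω α Y) :
    Lp (E d) 2 (cylMeasure Ω α Y) := W.2.1

/-- The derivative with respect to `y`. -/
def cylDerivY {d : ℕ} {Ω : Set (E d)} {α Y : ℝ} (W : CylSpace Ω α Y) :
    Lp ℝ 2 (cylMeasure Ω α Y) := W.2.2.1

/-- The trace onto `Ω × {0}`. -/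
def tr {d : ℕ} {Ω : Set (E d)} {α Y : ℝ} (W : CylSpace Ω α Y) : L2 Ω := W.2.2.2

/-- The quadruples `(η, ∇_{x'} η, ∂_y η, η(·, 0))` for the smooth functions `η` that vanish near the
Dirichlet boundary `∂Ω × (0, Y) ∪ Ω × {Y}`. -/
def smoothCyl {d : ℕ} (Ω : Set (E d)) (α Y : ℝ) : Set (CylSpace Ω α Y) :=
  {W | ∃ η : E d × ℝ → ℝ, ContDiff ℝ (⊤ : ℕ∞) η ∧ HasCompactSupport η ∧
    tsupport η ⊆ Ω ×ˢ Iio Y ∧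
    W.1 =ᵐ[cylMeasure Ω α Y] η ∧
    cylGradX W =ᵐ[cylMeasure Ω α Y] (fun p => gradient (fun x => η (x, p.2)) p.1) ∧
    cylDerivY W =ᵐ[cylMeasure Ω α Y] (fun p => deriv (fun y => η (p.1, y)) p.2) ∧
    tr W =ᵐ[volume.restrict Ω] (fun x => η (x, 0))}

/-- The weighted Sobolev space of the functions of `H¹(y^α, Ω × (0, Y))` that vanish on the
Dirichlet boundary, the closure in `H¹(y^α)` of the smooth functions that vanish near it. A
function `w` of this space is represented by `(w, ∇_{x'} w, ∂_y w, tr w)`; the trace is the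
extension by continuity of the restriction to `y = 0`, so that `w` determines all entries. -/
def HL1 {d : ℕ} (Ω : Set (E d)) (α Y : ℝ) : Set (CylSpace Ω α Y) :=
  closure (smoothCyl Ω α Y)

/-- The normalization constant `d_s = 2^α Γ(1-s) / Γ(s)`, `α = 1 - 2s`. -/
def dConst (s : ℝ) : ℝ := 2 ^ (1 - 2 * s) * Real.Gamma (1 - s) / Real.Gamma s

/-- `a_Y(w, φ) = d_s⁻¹ ∫_{Ω × (0, Y)} y^α ∇w · ∇φ`. -/
def aY {d : ℕ} {Ω : Set (E d)} {Y : ℝ} (s : ℝ) (W Φ : CylSpace Ω (1 - 2 * s) Y) : ℝ :=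
  (1 / dConst s) *
    (inner ℝ (cylGradX W) (cylGradX Φ) + inner ℝ (cylDerivY W) (cylDerivY Φ))

/-- The admissible set on the truncated cylinder. -/
def admissibleCyl {d : ℕ} (Ω : Set (E d)) (s Y : ℝ) (ψ : L2 Ω) :
    Set (CylSpace Ω (1 - 2 * s) Y) :=
  {W | W ∈ HL1 Ω (1 - 2 * s) Y ∧ ∀ᵐ x ∂(volume.restrict Ω), ψ x ≤ tr W x}

/-! ## The backward Euler scheme -/

/-- `V⁰, …, V^N` is a solution of the semidiscrete scheme with time step `τ` and discrete forcing
`F¹, …, F^N`. -/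
def IsSemidiscreteSolution {d : ℕ} (Ω : Set (E d)) (s Y : ℝ) (ψ u₀ : L2 Ω) (F : ℕ → L2 Ω)
    (N : ℕ) (τ : ℝ) (V : ℕ → CylSpace Ω (1 - 2 * s) Y) : Prop :=
  (∀ k ≤ N, V k ∈ admissibleCyl Ω s Y ψ) ∧
  tr (V 0) = u₀ ∧
  ∀ k < N, ∀ Φ ∈ admissibleCyl Ω s Y ψ,
    inner ℝ (τ⁻¹ • tr (V (k + 1) - V k)) (tr (V (k + 1) - Φ)) + aY s (V (k + 1)) (V (k + 1) - Φ)
      ≤ inner ℝ (F (k + 1)) (tr (V (k + 1) - Φ))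

/-- `f^k = τ⁻¹ ∫_{t_{k-1}}^{t_k} f dt`, `t_k = k τ`, for `k ≥ 1`. -/
def averageForcing {d : ℕ} {Ω : Set (E d)} (τ : ℝ) (f : ℝ → L2 Ω) (k : ℕ) : L2 Ω :=
  τ⁻¹ • ∫ t in (((k : ℝ) - 1) * τ)..((k : ℝ) * τ), f t

/-- `f^k = f_+(t_k)`, `t_k = k τ`. -/
def nodalForcing {d : ℕ} {Ω : Set (E d)} (T τ : ℝ) (f : ℝ → L2 Ω) (k : ℕ) : L2 Ω :=
  rightLimit T f ((k : ℝ) * τ)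

/-- The index `k` with `t ∈ (k τ, (k+1) τ]`, for `t > 0` (and `0` for `t = 0`). -/
def stepIndex (τ t : ℝ) : ℕ := ⌈t / τ⌉₊ - 1

/-- The piecewise constant interpolant, `U^{k+1}` on `(t_k, t_{k+1}]`. -/
def constInterp {d : ℕ} {Ω : Set (E d)} (τ : ℝ) (U : ℕ → L2 Ω) (t : ℝ) : L2 Ω :=
  U (stepIndex τ t + 1)

/-- The piecewise linear interpolant,
`((t - t_k) / τ) U^{k+1} + ((t_{k+1} - t) / τ) U^k` on `[t_k, t_{k+1}]`. -/
def linInterp {d : ℕ} {Ω : Set (E d)} (τ : ℝ) (U : ℕ → L2 Ω) (t : ℝ) : L2 Ω :=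
  ((t - (stepIndex τ t : ℝ) * τ) / τ) • U (stepIndex τ t + 1) +
    ((((stepIndex τ t : ℝ) + 1) * τ - t) / τ) • U (stepIndex τ t)

/-- The error `‖u - Û‖_{L^∞(0,T;L²)} + ‖u - Ū‖_{L²(0,T;ℍ^s)}`. -/
def timeError {d : ℕ} (Ω : Set (E d)) (s T τ : ℝ) (u : ℝ → L2 Ω) (U : ℕ → L2 Ω) : ℝ≥0∞ :=
  eLpNorm (fun t => u t - linInterp τ U t) ∞ (volume.restrict (Ioo 0 T)) +
    (∫⁻ t in Ioo 0 T, hNormSq Ω s (u t - constInterp τ U t)) ^ (1 / 2 : ℝ)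

end FracObstacle

end

/-!
The scheme on the truncated cylinder is compared with the evolution problem on `Ω`. The argument has
three parts.

*Spectral theory.* The embedding `H¹₀(Ω) → L²(Ω)` is compact, because averaging against a smooth
bump moves `η` by at most `ε ‖∇η‖` (`exists_compact_approx`). The operator `(1 - Δ)⁻¹ = ι ι*` is
therefore compact and symmetric, which gives the expansion `hasSum_spectralProj` in eigenfunctions;
the Poincaré inequality `exists_poincare` bounds the eigenvalues from below.

*Truncation.* An eigenfunction `φ` with eigenvalue `mu` has the harmonic extension
`g_s(√mu y) φ(x')`, where `g_s` is the function `besselProfile`; it decays exponentially, and its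
conormal derivative at `y = 0` is `d_s mu^s φ`. Testing with such functions shows
`⟨(-Δ)^s tr W, tr W⟩ ≤ a_Y(W, W)` for every `W` on the truncated cylinder (`trace_energy_le`).
Conversely, cutting them off at height `Y` extends each `w ∈ ℍ^s(Ω)` with energy at most
`⟨(-Δ)^s w, w⟩ + K e^{-√c Y / 2} ‖w‖²`, where `c` is a lower bound for the eigenvalues
(`exists_extension`). The difference of the two forms is thus nonnegative and exponentially small on
functions that minimize the energy for their trace. The solutions of the scheme do so, because the
obstacle constrains the trace only. Hence their traces solve the backward Euler scheme for the
variational inequality on `Ω` up to a consistency error `κ` of size `e^{-√c Y / 2} max ‖U^k‖`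
(`IsSemidiscreteSolution.inequality`), and `max ‖U^k‖` is bounded by the data
(`IsSemidiscreteSolution.norm_le`).

*Time discretization.* This part works in a Hilbert space `H` with a quadratic energy `q`, convex on
the convex set `K`. Since the linear interpolant `Û` has values in `K`, it is an admissible test
function for the continuous problem, while the continuous solution is one for the scheme. The sum of
the two inequalities bounds `d/dt ‖u - Û‖² + q(u - Ū) / 2` by the error of the forcing and the
*energy excess* of the scheme, `q(U^k) - q(U^{k+1}) - 2 τ (δ - f^{k+1}, δ)` with
`δ = (U^{k+1} - U^k) / τ`, up to a multiple of `κ²` (`IsEnergy.error_inequality`).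

* If `f` is of bounded variation, the inequality of the preceding step, tested with the next iterate,
  bounds the excess by `τ (‖δ^k‖² - ‖δ^{k+1}‖²)` and the variation of `f` on that step. This
  telescopes, with `δ⁰ = f_+(0) - (-Δ)^s u₀`, and gives the order one
  (`IsEVISolution.error_of_variation`).
* If `f` is only square integrable, the excess telescopes to `τ (q(u₀) + ‖f‖²)`. Because the discrete
  forcing is the mean value of `f`, its error is tested only with the oscillation of `u - Û` on a time
  step. This oscillation is controlled by `‖u'‖_{L²}`, which is bounded by the data: test the
  variational inequality at the times `t > r` with `u(r)`, integrate in `r`, and pass to the limit in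
  the difference quotients (`IsEVISolution.translation_le`, `IsEVISolution.error_of_memLp`).
-/

open MeasureTheory Set Filter Topology
open scoped ENNReal NNReal

noncomputable section

namespace FracObstacle

/-! ### Translation estimates and the Poincaré inequality -/

lemma Lp_enorm_sq {α F : Type*} [MeasurableSpace α] {μ : Measure α} [NormedAddCommGroup F]
    (f : Lp F 2 μ) : ‖f‖ₑ ^ 2 = ∫⁻ x, ‖f x‖ₑ ^ 2 ∂μ := by
  rw [Lp.enorm_def]
  have := eLpNorm_nnreal_pow_eq_lintegral (f := f) (μ := μ) (p := 2) (by norm_num)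
  simpa using this

lemma Lp_enorm_sq_congr {α F : Type*} [MeasurableSpace α] {μ : Measure α} [NormedAddCommGroup F]
    (f : Lp F 2 μ) {g : α → F} (h : f =ᵐ[μ] g) : ‖f‖ₑ ^ 2 = ∫⁻ x, ‖g x‖ₑ ^ 2 ∂μ := by
  rw [Lp_enorm_sq]
  refine lintegral_congr_ae ?_
  filter_upwards [h] with x hx
  rw [hx]

lemma norm_le_of_enorm_sq_le {F G : Type*} [NormedAddCommGroup F] [NormedAddCommGroup G]
    {f : F} {g : G} {c : ℝ} (hc : 0 ≤ c) (h : ‖f‖ₑ ^ 2 ≤ ENNReal.ofReal c ^ 2 * ‖g‖ₑ ^ 2) :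
    ‖f‖ ≤ c * ‖g‖ := by
  rw [← mul_pow] at h
  have h' := (ENNReal.pow_le_pow_left_iff (two_ne_zero)).1 h
  rw [← ofReal_norm, ← ofReal_norm, ← ENNReal.ofReal_mul hc] at h'
  exact (ENNReal.ofReal_le_ofReal_iff (by positivity)).1 h'

/-- Jensen's inequality for the square, with respect to a probability measure. -/
lemma sq_lintegral_le {α : Type*} [MeasurableSpace α] {μ : Measure α} [IsProbabilityMeasure μ]
    {f : α → ℝ≥0∞} (hf : AEMeasurable f μ) : (∫⁻ x, f x ∂μ) ^ 2 ≤ ∫⁻ x, f x ^ 2 ∂μ := by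
  have := ENNReal.lintegral_mul_le_Lp_mul_Lq μ (p := 2) (q := 2) Real.HolderConjugate.two_two hf
    (aemeasurable_const (b := (1 : ℝ≥0∞)))
  simp only [Pi.mul_apply, mul_one, ENNReal.one_rpow, lintegral_const, measure_univ] at this
  calc _ ≤ ((∫⁻ x, f x ^ (2 : ℝ) ∂μ) ^ (1 / 2 : ℝ)) ^ 2 := by gcongr
    _ = _ := by
      rw [← ENNReal.rpow_natCast, ← ENNReal.rpow_mul]
      simp

/-- A translation by `h` moves a smooth function in `L²` by at most `|h| ‖∇η‖`. -/
lemma lintegral_sq_translate_sub_le {d : ℕ} {η : E d → ℝ} (hη : ContDiff ℝ 1 η) (h : E d) :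
    ∫⁻ x, ‖η (x + h) - η x‖ₑ ^ 2 ≤ ‖h‖ₑ ^ 2 * ∫⁻ x, ‖gradient η x‖ₑ ^ 2 := by
  have hcd : Continuous (fderiv ℝ η) := hη.continuous_fderiv (by simp)
  have hcg : Continuous (gradient η) := (InnerProductSpace.toDual ℝ (E d)).symm.continuous.comp hcd
  have hdiff : Differentiable ℝ η := hη.differentiable (by simp)
  have : IsProbabilityMeasure (volume.restrict (Ioc (0 : ℝ) 1)) := ⟨by simp⟩
  have key : ∀ x, ‖η (x + h) - η x‖ₑ ^ 2 ≤
      ‖h‖ₑ ^ 2 * ∫⁻ t in Ioc (0 : ℝ) 1, ‖gradient η (x + t • h)‖ₑ ^ 2 := by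
    intro x
    have hderiv : ∀ t ∈ uIcc (0 : ℝ) 1, HasDerivAt (fun t : ℝ => η (x + t • h))
        (inner ℝ (gradient η (x + t • h)) h) t := by
      intro t _
      have h1 : HasDerivAt (fun t : ℝ => x + t • h) h t := by
        simpa using ((hasDerivAt_id t).smul_const h).const_add x
      have h2 := (hdiff (x + t • h)).hasGradientAt.hasFDerivAt.comp_hasDerivAt t h1
      simpa using! h2
    have hcont : Continuous fun t : ℝ => inner ℝ (gradient η (x + t • h)) h := by fun_prop
    have hint := intervalIntegral.integral_eq_sub_of_hasDerivAt hderiv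
      (hcont.intervalIntegrable _ _)
    simp only [one_smul, zero_smul, add_zero] at hint
    rw [← hint, intervalIntegral.integral_of_le zero_le_one]
    calc _ ≤ (∫⁻ t in Ioc (0 : ℝ) 1, ‖inner ℝ (gradient η (x + t • h)) h‖ₑ) ^ 2 := by
          gcongr; exact enorm_integral_le_lintegral_enorm _
      _ ≤ ∫⁻ t in Ioc (0 : ℝ) 1, ‖inner ℝ (gradient η (x + t • h)) h‖ₑ ^ 2 :=
          sq_lintegral_le (by fun_prop)
      _ ≤ ∫⁻ t in Ioc (0 : ℝ) 1, ‖h‖ₑ ^ 2 * ‖gradient η (x + t • h)‖ₑ ^ 2 := by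
          refine lintegral_mono fun t => ?_
          rw [← mul_pow]
          gcongr
          rw [← ofReal_norm, ← ofReal_norm, ← ofReal_norm,
            ← ENNReal.ofReal_mul (norm_nonneg _), mul_comm]
          exact ENNReal.ofReal_le_ofReal (norm_inner_le_norm _ _)
      _ = _ := by rw [lintegral_const_mul _ (by
          exact (by fun_prop : Continuous fun t : ℝ => ‖gradient η (x + t • h)‖ₑ ^ 2).measurable)]
  calc ∫⁻ x, ‖η (x + h) - η x‖ₑ ^ 2
      ≤ ∫⁻ x, ‖h‖ₑ ^ 2 * ∫⁻ t in Ioc (0 : ℝ) 1, ‖gradient η (x + t • h)‖ₑ ^ 2 :=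
        lintegral_mono key
    _ = ‖h‖ₑ ^ 2 * ∫⁻ x, ∫⁻ t in Ioc (0 : ℝ) 1, ‖gradient η (x + t • h)‖ₑ ^ 2 := by
        rw [lintegral_const_mul']
        simp
    _ = ‖h‖ₑ ^ 2 * ∫⁻ t in Ioc (0 : ℝ) 1, ∫⁻ x, ‖gradient η (x + t • h)‖ₑ ^ 2 := by
        rw [lintegral_lintegral_swap]
        exact (by fun_prop : Continuous fun p : E d × ℝ =>
          ‖gradient η (p.1 + p.2 • h)‖ₑ ^ 2).measurable.aemeasurable
    _ = ‖h‖ₑ ^ 2 * ∫⁻ t in Ioc (0 : ℝ) 1, ∫⁻ x, ‖gradient η x‖ₑ ^ 2 := by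
        congr 1
        refine lintegral_congr fun t => ?_
        exact lintegral_add_right_eq_self (fun x => ‖gradient η x‖ₑ ^ 2) (t • h)
    _ = _ := by simp

lemma gradient_eq_zero_of_notMem_tsupport {d : ℕ} {η : E d → ℝ} {x : E d} (hx : x ∉ tsupport η) :
    gradient η x = 0 := by
  have : fderiv ℝ η x = 0 := by
    by_contra hne
    exact hx (support_fderiv_subset ℝ hne)
  simp [gradient, this]

lemma setLIntegral_gradient_eq {d : ℕ} {Ω : Set (E d)} {η : E d → ℝ} (h : tsupport η ⊆ Ω) :
    ∫⁻ x in Ω, ‖gradient η x‖ₑ ^ 2 = ∫⁻ x, ‖gradient η x‖ₑ ^ 2 := by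
  refine setLIntegral_eq_of_support_subset ?_
  intro x hx
  by_contra hxn
  exact hx (by simp [gradient_eq_zero_of_notMem_tsupport fun hc => hxn (h hc)])

/-- A closed inequality between the two components extends from test functions to `H¹₀`. -/
lemma H10_induction {d : ℕ} {Ω : Set (E d)} {P : L2 Ω × L2Vec Ω → Prop}
    (hP : IsClosed {p | P p}) (h : ∀ p ∈ testGraph Ω, P p) : ∀ p ∈ H10 Ω, P p := fun _ hp =>
  closure_minimal (s := (testGraph Ω : Set (L2 Ω × L2Vec Ω))) (fun p hp => h p hp) hP hp

/-- The Poincaré inequality: a translation by more than the diameter moves the support of a test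
function off itself. -/
lemma exists_poincare {d : ℕ} (hd : 1 ≤ d) {Ω : Set (E d)} (hΩo : IsOpen Ω)
    (hΩ : Bornology.IsBounded Ω) : ∃ c : ℝ, 0 < c ∧ ∀ p ∈ H10 Ω, ‖p.1‖ ≤ c * ‖p.2‖ := by
  obtain ⟨R, hR, hsub⟩ := hΩ.subset_ball_lt 0 0
  obtain ⟨h, hh⟩ : ∃ h : E d, ‖h‖ = 2 * R :=
    ⟨EuclideanSpace.single ⟨0, hd⟩ (2 * R), by simp [abs_of_pos hR]⟩
  refine ⟨2 * R, by positivity, H10_induction (isClosed_le (by fun_prop) (by fun_prop)) ?_⟩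
  rintro p ⟨η, h1, h2, h3, h4, h5⟩
  refine norm_le_of_enorm_sq_le (by positivity) ?_
  rw [Lp_enorm_sq_congr _ h4, Lp_enorm_sq_congr _ h5, setLIntegral_gradient_eq h3]
  calc ∫⁻ x in Ω, ‖η x‖ₑ ^ 2 ≤ ∫⁻ x in Ω, ‖η (x + h) - η x‖ₑ ^ 2 := by
        refine setLIntegral_mono' hΩo.measurableSet fun x hx => ?_
        have hxh : η (x + h) = 0 := by
          refine image_eq_zero_of_notMem_tsupport fun hc => ?_
          have e1 := mem_ball_zero_iff.1 (hsub (h3 hc))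
          have e2 := mem_ball_zero_iff.1 (hsub hx)
          have e3 := norm_sub_le (x + h) x
          rw [add_sub_cancel_left, hh] at e3
          linarith
        simp [hxh]
    _ ≤ ∫⁻ x, ‖η (x + h) - η x‖ₑ ^ 2 := setLIntegral_le_lintegral _ _
    _ ≤ _ := by
        have := lintegral_sq_translate_sub_le (h1.of_le (by simp)) h
        rwa [← ofReal_norm, hh] at this

/-! ### Compactness of the embedding `H¹₀(Ω) → L²(Ω)` -/

/-- The integral operator `g ↦ (x ↦ ⟨g, κ x⟩)` with a square integrable Hilbert space valued
kernel. -/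
def kernelOp {α H : Type*} [MeasurableSpace α] (μ : Measure α) [NormedAddCommGroup H]
    [InnerProductSpace ℝ H] (κ : Lp H 2 μ) : H →L[ℝ] Lp ℝ 2 μ :=
  LinearMap.mkContinuous
    { toFun := fun g => (innerSL ℝ g).compLp κ
      map_add' := fun g g' => by rw [map_add, ContinuousLinearMap.add_compLp]
      map_smul' := fun c g => by rw [map_smul, ContinuousLinearMap.smul_compLp]; rfl }
    ‖κ‖ fun g => by
      simpa [mul_comm] using! ContinuousLinearMap.norm_compLp_le (innerSL ℝ g) κ

lemma kernelOp_apply {α H : Type*} [MeasurableSpace α] {μ : Measure α} [NormedAddCommGroup H]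
    [InnerProductSpace ℝ H] (κ : Lp H 2 μ) (g : H) :
    kernelOp μ κ g = (innerSL ℝ g).compLp κ := rfl

lemma norm_kernelOp_le {α H : Type*} [MeasurableSpace α] {μ : Measure α} [NormedAddCommGroup H]
    [InnerProductSpace ℝ H] (κ : Lp H 2 μ) : ‖kernelOp μ κ‖ ≤ ‖κ‖ :=
  LinearMap.mkContinuous_norm_le _ (norm_nonneg _) _

lemma kernelOp_add {α H : Type*} [MeasurableSpace α] {μ : Measure α} [NormedAddCommGroup H]
    [InnerProductSpace ℝ H] (κ κ' : Lp H 2 μ) :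
    kernelOp μ (κ + κ') = kernelOp μ κ + kernelOp μ κ' := by
  ext1 g
  exact map_add ((innerSL ℝ g).compLpL 2 μ) κ κ'

lemma kernelOp_sub {α H : Type*} [MeasurableSpace α] {μ : Measure α} [NormedAddCommGroup H]
    [InnerProductSpace ℝ H] (κ κ' : Lp H 2 μ) :
    kernelOp μ (κ - κ') = kernelOp μ κ - kernelOp μ κ' := by
  ext1 g
  exact map_sub ((innerSL ℝ g).compLpL 2 μ) κ κ'

/-- Simple kernels give operators of finite rank, and they are dense. -/
lemma isCompactOperator_kernelOp {α H : Type*} [MeasurableSpace α] {μ : Measure α}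
    [NormedAddCommGroup H] [InnerProductSpace ℝ H] (κ : Lp H 2 μ) :
    IsCompactOperator (kernelOp μ κ) := by
  refine Lp.induction (p := 2) (by norm_num) (fun κ => IsCompactOperator (kernelOp μ κ))
    ?_ ?_ ?_ κ
  · intro c s hs hμs
    have e : (kernelOp μ (indicatorConstLp 2 hs hμs.ne c) : H → Lp ℝ 2 μ) =
        (fun r : ℝ => r • indicatorConstLp 2 hs hμs.ne (1 : ℝ)) ∘ (innerSL ℝ c) := by
      funext g
      rw [kernelOp_apply]
      refine Lp.ext ?_
      filter_upwards [ContinuousLinearMap.coeFn_compLp (innerSL ℝ g)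
          (indicatorConstLp 2 hs hμs.ne c),
        indicatorConstLp_coeFn (p := 2) (hs := hs) (hμs := hμs.ne) (c := c),
        indicatorConstLp_coeFn (p := 2) (hs := hs) (hμs := hμs.ne) (c := (1 : ℝ)),
        Lp.coeFn_smul (inner ℝ c g) (indicatorConstLp 2 hs hμs.ne (1 : ℝ))] with x h0 h1 h2 h3
      simp only [h0, Function.comp_apply, innerSL_apply_apply, h3, Pi.smul_apply, h2, h1]
      by_cases hx : x ∈ s <;> simp [hx, real_inner_comm]
    simp only [Lp.simpleFunc.coe_indicatorConst]
    rw [e]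
    refine IsCompactOperator.continuous_comp ?_ (by fun_prop)
    exact isCompactOperator_of_locallyCompactSpace_dom (innerSL ℝ c)
  · intro f g hf hg _ h1 h2
    rw [kernelOp_add]
    exact h1.add h2
  · have hc : Continuous fun κ : Lp H 2 μ => kernelOp μ κ := by
      refine Metric.continuous_iff.2 fun κ ε hε => ⟨ε, hε, fun κ' h => ?_⟩
      rw [dist_eq_norm, ← kernelOp_sub]
      refine (norm_kernelOp_le _).trans_lt ?_
      rwa [← dist_eq_norm]
    exact isClosed_setOfPred_isCompactOperator.preimage hc

/-- Averaging against a smooth bump supported in the ball of radius `ε` is a compact operator on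
`L²(Ω)` that moves `η ∈ H¹₀(Ω)` by at most `ε ‖∇η‖`. -/
lemma exists_compact_approx {d : ℕ} {Ω : Set (E d)} (hΩ : Bornology.IsBounded Ω)
    {ε : ℝ} (hε : 0 < ε) :
    ∃ K : L2 Ω →L[ℝ] L2 Ω, IsCompactOperator K ∧
      ∀ p ∈ H10 Ω, ‖p.1 - K p.1‖ ≤ ε * ‖p.2‖ := by
  have : IsFiniteMeasure ((volume : Measure (E d)).restrict Ω) :=
    ⟨by simpa using hΩ.measure_lt_top⟩
  let b : ContDiffBump (0 : E d) := ⟨ε / 2, ε, by positivity, by linarith⟩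
  set ρ : E d → ℝ := b.normed volume with hρ
  have hρc : Continuous ρ := b.continuous_normed
  have hρs : HasCompactSupport ρ := b.hasCompactSupport_normed
  have hρ0 : ∀ x, 0 ≤ ρ x := fun x => b.nonneg_normed x
  have hρ1 : ∫ x, ρ x = 1 := b.integral_normed
  have hρb : ∀ x, ρ x ≠ 0 → ‖x‖ < ε := by
    intro x hx
    have : x ∈ Function.support ρ := hx
    rw [hρ, b.support_normed_eq] at this
    simpa using this
  obtain ⟨M, hM⟩ := hρc.bounded_above_of_compact_support hρs
  have hmem : ∀ x : E d, MemLp (fun y => ρ (y - x)) 2 (volume.restrict Ω) := fun x =>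
    MemLp.of_bound (by fun_prop) M (Eventually.of_forall fun y => hM _)
  let k : E d → L2 Ω := fun x => (hmem x).toLp _
  have hkc : Continuous k := by
    have huc := hρs.uniformContinuous_of_continuous hρc
    set m : ℝ := (measureUnivNNReal ((volume : Measure (E d)).restrict Ω) : ℝ) ^
      (2 : ℝ≥0∞).toReal⁻¹ with hm
    have hm0 : 0 ≤ m := by positivity
    refine Metric.continuous_iff.2 fun x δ hδ => ?_
    obtain ⟨r, hr, hr'⟩ := Metric.uniformContinuous_iff.1 huc (δ / (m + 1)) (by positivity)
    refine ⟨r, hr, fun x' hx' => ?_⟩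
    have : ‖k x' - k x‖ ≤ m * (δ / (m + 1)) := by
      refine Lp.norm_le_of_ae_bound (by positivity) ?_
      filter_upwards [Lp.coeFn_sub (k x') (k x), (hmem x').coeFn_toLp, (hmem x).coeFn_toLp]
        with y e1 e2 e3
      rw [e1, Pi.sub_apply, e2, e3, ← dist_eq_norm]
      refine (hr' ?_).le
      rwa [dist_sub_left]
    rw [dist_eq_norm]
    refine this.trans_lt ?_
    rw [mul_div_assoc', div_lt_iff₀ (by positivity)]
    nlinarith
  have hkm : MemLp k 2 (volume.restrict Ω) := by
    refine MemLp.of_bound hkc.aestronglyMeasurable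
      ((measureUnivNNReal ((volume : Measure (E d)).restrict Ω) : ℝ) ^
      (2 : ℝ≥0∞).toReal⁻¹ * M) (Eventually.of_forall fun x => ?_)
    refine Lp.norm_le_of_ae_bound ((norm_nonneg _).trans (hM 0)) ?_
    filter_upwards [(hmem x).coeFn_toLp] with y e1
    rw [e1]
    exact hM _
  refine ⟨kernelOp _ (hkm.toLp k), isCompactOperator_kernelOp _, ?_⟩
  refine H10_induction (isClosed_le (by fun_prop) (by fun_prop)) ?_
  rintro p ⟨η, h1, h2, h3, h4, h5⟩
  refine norm_le_of_enorm_sq_le hε.le ?_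
  have hηc : Continuous η := h1.continuous
  have hηm : Measurable η := hηc.measurable
  have hK : ⇑(p.1 - kernelOp _ (hkm.toLp k) p.1) =ᵐ[volume.restrict Ω]
      fun x => η x - ∫ h, ρ h * η (x + h) := by
    rw [kernelOp_apply]
    filter_upwards [Lp.coeFn_sub p.1 ((innerSL ℝ p.1).compLp (hkm.toLp k)), h4, hkm.coeFn_toLp,
      ContinuousLinearMap.coeFn_compLp (innerSL ℝ p.1) (hkm.toLp k)] with x e1 e2 e3 e4
    rw [e1, Pi.sub_apply, e2, e4, e3, innerSL_apply_apply, L2.inner_def]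
    congr 1
    have e5 : ∫ y in Ω, inner ℝ (p.1 y) (k x y) = ∫ y in Ω, ρ (y - x) * η y := by
      refine integral_congr_ae ?_
      filter_upwards [h4, (hmem x).coeFn_toLp] with y f1 f2
      rw [f1, f2]
      simp
    rw [e5, setIntegral_eq_integral_of_forall_compl_eq_zero fun y hy => by
      rw [image_eq_zero_of_notMem_tsupport fun hc => hy (h3 hc), mul_zero],
      ← integral_add_right_eq_self _ x]
    simp [add_comm]
  rw [Lp_enorm_sq_congr _ hK, Lp_enorm_sq_congr _ h5, setLIntegral_gradient_eq h3]
  set μρ : Measure (E d) := volume.withDensity fun h => ENNReal.ofReal (ρ h) with hμρ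
  have hρm : Measurable fun h => ENNReal.ofReal (ρ h) := by fun_prop
  have hρi : Integrable ρ := hρc.integrable_of_hasCompactSupport hρs
  have : IsProbabilityMeasure μρ := by
    refine ⟨?_⟩
    rw [hμρ, withDensity_apply _ MeasurableSet.univ, setLIntegral_univ,
      ← ofReal_integral_eq_lintegral_ofReal hρi (Eventually.of_forall hρ0), hρ1,
      ENNReal.ofReal_one]
  have hpt : ∀ x, ‖η x - ∫ h, ρ h * η (x + h)‖ₑ ^ 2 ≤
      ∫⁻ h, ENNReal.ofReal (ρ h) * ‖η (x + h) - η x‖ₑ ^ 2 := by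
    intro x
    have hi : Integrable fun h => ρ h * η (x + h) :=
      (by fun_prop : Continuous fun h => ρ h * η (x + h)).integrable_of_hasCompactSupport
        hρs.mul_right
    have e1 : η x - ∫ h, ρ h * η (x + h) = ∫ h, ρ h * (η x - η (x + h)) := by
      simp_rw [mul_sub]
      rw [integral_sub (hρi.mul_const _) hi, integral_mul_const, hρ1, one_mul]
    rw [e1]
    calc _ ≤ (∫⁻ h, ‖ρ h * (η x - η (x + h))‖ₑ) ^ 2 := by
          gcongr; exact enorm_integral_le_lintegral_enorm _
      _ = (∫⁻ h, ‖η (x + h) - η x‖ₑ ∂μρ) ^ 2 := by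
          rw [hμρ, lintegral_withDensity_eq_lintegral_mul _ hρm (by fun_prop)]
          congr 1
          refine lintegral_congr fun h => ?_
          rw [enorm_mul, Real.enorm_of_nonneg (hρ0 h), Pi.mul_apply, ← enorm_neg (η x - _),
            neg_sub]
      _ ≤ ∫⁻ h, ‖η (x + h) - η x‖ₑ ^ 2 ∂μρ := sq_lintegral_le (by fun_prop)
      _ = _ := by
          rw [hμρ, lintegral_withDensity_eq_lintegral_mul _ hρm (by fun_prop)]
          rfl
  calc _ ≤ ∫⁻ x in Ω, ∫⁻ h, ENNReal.ofReal (ρ h) * ‖η (x + h) - η x‖ₑ ^ 2 :=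
        lintegral_mono hpt
    _ ≤ ∫⁻ x, ∫⁻ h, ENNReal.ofReal (ρ h) * ‖η (x + h) - η x‖ₑ ^ 2 :=
        setLIntegral_le_lintegral _ _
    _ = ∫⁻ h, ∫⁻ x, ENNReal.ofReal (ρ h) * ‖η (x + h) - η x‖ₑ ^ 2 :=
        lintegral_lintegral_swap (by fun_prop)
    _ ≤ ∫⁻ h, ENNReal.ofReal (ρ h) *
          (ENNReal.ofReal ε ^ 2 * ∫⁻ x, ‖gradient η x‖ₑ ^ 2) := by
        refine lintegral_mono fun h => ?_
        rw [lintegral_const_mul _ (by fun_prop)]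
        rcases eq_or_ne (ρ h) 0 with h0 | h0
        · simp [h0]
        gcongr
        refine (lintegral_sq_translate_sub_le (h1.of_le (by simp)) h).trans ?_
        gcongr
        rw [← ofReal_norm]
        exact ENNReal.ofReal_le_ofReal (hρb h h0).le
    _ = _ := by
        rw [lintegral_mul_const _ hρm,
          ← ofReal_integral_eq_lintegral_ofReal hρi (Eventually.of_forall hρ0), hρ1,
          ENNReal.ofReal_one, one_mul]

/-! ### Spectral theory of the Dirichlet Laplacian -/

section FormOperator

variable {X Z : Type*} [NormedAddCommGroup X] [InnerProductSpace ℝ X] [NormedAddCommGroup Z]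
  [InnerProductSpace ℝ Z] {M : Submodule ℝ (X × Z)}

/-- A space `M` of pairs `(w, ∇w)`, as a subspace of the Hilbert space `X ⊕ Z`. -/
def formDomain (M : Submodule ℝ (X × Z)) : Submodule ℝ (WithLp 2 (X × Z)) :=
  M.comap (WithLp.prodContinuousLinearEquiv 2 ℝ X Z).toLinearMap

/-- The embedding `(w, ∇w) ↦ w`. -/
def embed (M : Submodule ℝ (X × Z)) : formDomain M →L[ℝ] X :=
  (ContinuousLinearMap.fst ℝ X Z) ∘L
    (WithLp.prodContinuousLinearEquiv 2 ℝ X Z).toContinuousLinearMap ∘L (formDomain M).subtypeL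

lemma embed_apply (p : formDomain M) : embed M p = p.1.fst := rfl

lemma completeSpace_formDomain [CompleteSpace X] [CompleteSpace Z]
    (hM : IsClosed (M : Set (X × Z))) : CompleteSpace (formDomain M) := by
  refine IsClosed.completeSpace_coe (hs := ?_)
  exact hM.preimage (WithLp.prodContinuousLinearEquiv 2 ℝ X Z).continuous

lemma isCompactOperator_embed [CompleteSpace X]
    (h : ∀ ε > (0 : ℝ), ∃ K : X →L[ℝ] X, IsCompactOperator K ∧
      ∀ p ∈ M, ‖p.1 - K p.1‖ ≤ ε * ‖p.2‖) : IsCompactOperator (embed M) := by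
  have h : embed M ∈ closure {f : formDomain M →L[ℝ] X | IsCompactOperator f} := by
    refine (Metric.mem_closure_iff (α := formDomain M →L[ℝ] X)).2 fun ε hε => ?_
    obtain ⟨K, hK, hK'⟩ := h (ε / 2) (half_pos hε)
    refine ⟨K ∘L embed M, hK.comp_clm (embed M), ?_⟩
    refine lt_of_eq_of_lt (dist_eq_norm (embed M) (K ∘L embed M)) ?_
    refine (ContinuousLinearMap.opNorm_le_bound _ (by positivity) fun p => ?_).trans_lt
      (half_lt_self hε)
    refine (hK' _ p.2).trans ?_
    gcongr
    exact WithLp.norm_snd_le ..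
  rwa [isClosed_setOfPred_isCompactOperator.closure_eq] at h

variable [CompleteSpace X] [CompleteSpace (formDomain M)]

/-- The gradient part of the solution `p ∈ M` of `⟨p, q⟩ = ⟨w, q.1⟩` for all `q ∈ M`. -/
lemma inner_adjoint_embed (w : X) (q : X × Z) (hq : q ∈ M) :
    inner ℝ (embed M ((embed M).adjoint w)) q.1 + inner ℝ ((embed M).adjoint w).1.snd q.2 =
      inner ℝ w q.1 := by
  have h := ContinuousLinearMap.adjoint_inner_left (embed M) ⟨WithLp.toLp 2 q, hq⟩ w
  rw [Submodule.coe_inner, WithLp.prod_inner_apply] at h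
  exact h

lemma embed_adjoint_mem (w : X) :
    (embed M ((embed M).adjoint w), ((embed M).adjoint w).1.snd) ∈ M :=
  ((embed M).adjoint w).2

/-- The eigenvectors of the form operator are total: they are the eigenvectors of the compact
symmetric operator `(1 + A)⁻¹`. -/
lemma eq_zero_of_forall_inner_eigenvector (hc : IsCompactOperator (embed M))
    (hd : ∀ w : X, (∀ q ∈ M, inner ℝ w q.1 = 0) → w = 0) {w : X}
    (h : ∀ (mu : ℝ) (φ : X), (∃ G : Z, (φ, G) ∈ M ∧ ∀ q ∈ M, inner ℝ G q.2 = mu * inner ℝ φ q.1) →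
      inner ℝ φ w = 0) : w = 0 := by
  set S : X →L[ℝ] X := embed M ∘L (embed M).adjoint with hS
  have hsymm : (S : X →ₗ[ℝ] X).IsSymmetric := by
    intro v w
    simp only [hS, ContinuousLinearMap.coe_coe, ContinuousLinearMap.comp_apply]
    exact (ContinuousLinearMap.adjoint_inner_right (embed M) _ _).symm.trans
      (ContinuousLinearMap.adjoint_inner_left (embed M) _ _)
  have hbot := ContinuousLinearMap.orthogonalComplement_iSup_eigenspaces_eq_bot
    (hc.comp_clm (embed M).adjoint) hsymm
  suffices w ∈ (⨆ μ, Module.End.eigenspace (S : X →ₗ[ℝ] X) μ)ᗮ by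
    rw [hbot] at this
    exact this
  rw [← Submodule.iInf_orthogonal, Submodule.mem_iInf]
  intro κ φ hφ
  have hφ' : embed M ((embed M).adjoint φ) = κ • φ := Module.End.mem_eigenspace_iff.1 hφ
  -- An eigenvalue `κ` of `S = (1 + A)⁻¹` corresponds to the eigenvalue `κ⁻¹ - 1` of `A`.
  by_cases hκ : κ = 0
  · have h0 : φ = 0 := by
      refine hd φ fun q hq => ?_
      have h1 : ‖(embed M).adjoint φ‖ ^ 2 = 0 := by
        rw [← real_inner_self_eq_norm_sq, ContinuousLinearMap.adjoint_inner_right, hφ', hκ,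
          zero_smul, inner_zero_left]
      have h2 : (embed M).adjoint φ = 0 := by simpa using h1
      have h3 := inner_adjoint_embed φ q hq
      rw [h2] at h3
      simpa using h3.symm
    rw [h0, inner_zero_left]
  · refine h (κ⁻¹ - 1) φ ⟨κ⁻¹ • ((embed M).adjoint φ).1.snd, ?_, ?_⟩
    · have := M.smul_mem κ⁻¹ (embed_adjoint_mem φ)
      rw [hφ'] at this
      simpa [hκ] using this
    · intro q hq
      have h3 := inner_adjoint_embed φ q hq
      rw [hφ', real_inner_smul_left] at h3
      rw [real_inner_smul_left]
      field_simp
      linarith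

/-- The eigenvectors for `mu` are the fixed points of `(1 + mu) ι ι*`, where `ι` is the embedding.
In particular their set is closed. -/
lemma eigenvector_iff {mu : ℝ} (φ : X) :
    (∃ G : Z, (φ, G) ∈ M ∧ ∀ q ∈ M, inner ℝ G q.2 = mu * inner ℝ φ q.1) ↔
      (1 + mu) • embed M ((embed M).adjoint φ) = φ := by
  constructor
  · rintro ⟨G, hG, h⟩
    have hp : (embed M).adjoint ((1 + mu) • φ) = ⟨WithLp.toLp 2 (φ, G), hG⟩ := by
      refine ext_inner_right ℝ fun q => ?_
      rw [ContinuousLinearMap.adjoint_inner_left, embed_apply, real_inner_smul_left,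
        Submodule.coe_inner, WithLp.prod_inner_apply]
      have : inner ℝ G q.1.snd = mu * inner ℝ φ q.1.fst := h _ q.2
      change _ = inner ℝ φ q.1.fst + inner ℝ G q.1.snd
      linarith
    rw [← map_smul, ← map_smul, hp]
    rfl
  · intro hφ
    refine ⟨(1 + mu) • ((embed M).adjoint φ).1.snd, ?_, fun q hq => ?_⟩
    · have := M.smul_mem (1 + mu) (embed_adjoint_mem φ)
      rw [Prod.smul_mk, hφ] at this
      exact this
    · have h3 := inner_adjoint_embed φ q hq
      have h4 : inner ℝ φ q.1 = (1 + mu) * inner ℝ (embed M ((embed M).adjoint φ)) q.1 := by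
        rw [← real_inner_smul_left, hφ]
      rw [real_inner_smul_left]
      linear_combination (1 + mu) * h3 + h4

end FormOperator

lemma isClosed_H10 {d : ℕ} (Ω : Set (E d)) : IsClosed (H10 Ω : Set (L2 Ω × L2Vec Ω)) :=
  Submodule.isClosed_topologicalClosure _

instance {d : ℕ} (Ω : Set (E d)) : CompleteSpace (formDomain (H10 Ω)) :=
  completeSpace_formDomain (isClosed_H10 Ω)

/-- Test functions are dense in `L²(Ω)`. -/
lemma eq_zero_of_forall_inner_H10 {d : ℕ} {Ω : Set (E d)} (hΩo : IsOpen Ω)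
    (hΩ : Bornology.IsBounded Ω) {w : L2 Ω} (h : ∀ q ∈ H10 Ω, inner ℝ w q.1 = 0) : w = 0 := by
  have : IsFiniteMeasure ((volume : Measure (E d)).restrict Ω) :=
    ⟨by simpa using hΩ.measure_lt_top⟩
  have key : ∀ᵐ x, x ∈ Ω → w x = 0 := by
    refine hΩo.ae_eq_zero_of_integral_contDiff_smul_eq_zero
      (IntegrableOn.locallyIntegrableOn ((Lp.memLp w).integrable (by norm_num))) ?_
    intro η h1 h2 h3
    have hgc : Continuous (gradient η) :=
      (InnerProductSpace.toDual ℝ (E d)).symm.continuous.comp (h1.continuous_fderiv (by simp))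
    have hgs : HasCompactSupport (gradient η) := by
      refine h2.mono' fun x hx => ?_
      by_contra hc
      exact hx (gradient_eq_zero_of_notMem_tsupport hc)
    have m1 : MemLp η 2 (volume.restrict Ω) := (h1.continuous.memLp_of_hasCompactSupport h2)
    have m2 : MemLp (gradient η) 2 (volume.restrict Ω) := hgc.memLp_of_hasCompactSupport hgs
    have hmem : (m1.toLp η, m2.toLp (gradient η)) ∈ H10 Ω := by
      refine Submodule.le_topologicalClosure _ ?_
      exact ⟨η, h1, h2, h3, m1.coeFn_toLp, m2.coeFn_toLp⟩
    have := h _ hmem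
    rw [L2.inner_def] at this
    rw [← this, ← setIntegral_eq_integral_of_forall_compl_eq_zero (s := Ω) fun y hy => by
      rw [image_eq_zero_of_notMem_tsupport fun hc => hy (h3 hc), zero_smul]]
    refine integral_congr_ae ?_
    filter_upwards [m1.coeFn_toLp] with x hx
    rw [hx]
    simp
  refine Lp.eq_zero_iff_ae_eq_zero.2 ?_
  exact (ae_restrict_iff' hΩo.measurableSet).2 key

/-- The eigenfunctions of the Dirichlet Laplacian are total in `L²(Ω)`. -/
lemma eq_zero_of_forall_inner_eigenspace {d : ℕ} {Ω : Set (E d)} (hΩo : IsOpen Ω)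
    (hΩ : Bornology.IsBounded Ω) {w : L2 Ω}
    (h : ∀ mu : ℝ, ∀ φ ∈ eigenspace Ω mu, inner ℝ φ w = 0) : w = 0 :=
  eq_zero_of_forall_inner_eigenvector (M := H10 Ω)
    (isCompactOperator_embed fun _ hε => exists_compact_approx hΩ hε)
    (fun _ => eq_zero_of_forall_inner_H10 hΩo hΩ) h

/-- An eigenfunction together with its gradient. -/
lemma exists_gradient {d : ℕ} {Ω : Set (E d)} {mu : ℝ} {φ : L2 Ω} (h : φ ∈ eigenspace Ω mu) :
    ∃ G : L2Vec Ω, (φ, G) ∈ H10 Ω ∧ ∀ q ∈ H10 Ω, inner ℝ G q.2 = mu * inner ℝ φ q.1 := h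

lemma inner_eigenspace_eq_zero {d : ℕ} {Ω : Set (E d)} {mu nu : ℝ} (hne : mu ≠ nu) {φ χ : L2 Ω}
    (hφ : φ ∈ eigenspace Ω mu) (hχ : χ ∈ eigenspace Ω nu) : inner ℝ φ χ = 0 := by
  obtain ⟨G, hG, h⟩ := hφ
  obtain ⟨K, hK, k⟩ := hχ
  have h1 := h _ hK
  have h2 := k _ hG
  rw [real_inner_comm] at h1
  simp only at h1 h2
  rw [h1] at h2
  rw [real_inner_comm φ χ] at h2
  have h3 : (mu - nu) * inner ℝ φ χ = 0 := by linarith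
  exact (mul_eq_zero.1 h3).resolve_left (sub_ne_zero.2 hne)

/-- There is a positive lower bound for the eigenvalues. -/
lemma exists_eigenvalue_lower_bound {d : ℕ} (hd : 1 ≤ d) {Ω : Set (E d)} (hΩo : IsOpen Ω)
    (hΩ : Bornology.IsBounded Ω) :
    ∃ c : ℝ, 0 < c ∧ ∀ mu, eigenspace Ω mu ≠ ⊥ → c ≤ mu := by
  obtain ⟨c, hc, hP⟩ := exists_poincare hd hΩo hΩ
  refine ⟨(c ^ 2)⁻¹, by positivity, fun mu hmu => ?_⟩
  obtain ⟨φ, hφ, hne⟩ := Submodule.exists_mem_ne_zero_of_ne_bot hmu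
  obtain ⟨G, hG, h⟩ := hφ
  have h1 := hP _ hG
  have h2 := h _ hG
  simp only [real_inner_self_eq_norm_sq] at h1 h2
  have h3 : 0 < ‖φ‖ := norm_pos_iff.2 hne
  have h4 : ‖φ‖ ^ 2 ≤ c ^ 2 * (mu * ‖φ‖ ^ 2) := by
    rw [← h2, ← mul_pow]
    gcongr
  rw [inv_le_iff_one_le_mul₀ (by positivity)]
  have : 0 < ‖φ‖ ^ 2 := by positivity
  nlinarith

lemma isClosed_eigenspace {d : ℕ} (Ω : Set (E d)) (mu : ℝ) :
    IsClosed (eigenspace Ω mu : Set (L2 Ω)) := by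
  have hc : (eigenspace Ω mu : Set (L2 Ω)) =
      {φ | (1 + mu) • embed (H10 Ω) ((embed (H10 Ω)).adjoint φ) = φ} :=
    Set.ext fun φ => eigenvector_iff φ
  rw [hc]
  exact isClosed_eq (by fun_prop) continuous_id

/-! ### Spectral expansions -/

/-- A pairwise orthogonal family with square summable norms is summable. -/
lemma summable_of_pairwise_orthogonal {ι X : Type*} [NormedAddCommGroup X] [InnerProductSpace ℝ X]
    [CompleteSpace X] {x : ι → X} (ho : Pairwise fun i j => inner ℝ (x i) (x j) = 0)
    (hs : Summable fun i => ‖x i‖ ^ 2) : Summable x := by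
  have hV : OrthogonalFamily ℝ (fun i => Submodule.span ℝ {x i})
      fun i => (Submodule.span ℝ {x i}).subtypeₗᵢ := by
    rintro i j hij ⟨v, hv⟩ ⟨w, hw⟩
    obtain ⟨a, rfl⟩ := Submodule.mem_span_singleton.1 hv
    obtain ⟨b, rfl⟩ := Submodule.mem_span_singleton.1 hw
    simp [real_inner_smul_left, real_inner_smul_right, ho hij]
  exact (hV.summable_iff_norm_sq_summable
    (fun i => ⟨x i, Submodule.mem_span_singleton_self _⟩)).2 hs

lemma norm_sq_sum_of_pairwise_orthogonal {ι X : Type*} [NormedAddCommGroup X]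
    [InnerProductSpace ℝ X] {x : ι → X} (ho : Pairwise fun i j => inner ℝ (x i) (x j) = 0)
    (F : Finset ι) : ‖∑ i ∈ F, x i‖ ^ 2 = ∑ i ∈ F, ‖x i‖ ^ 2 := by
  classical
  rw [← real_inner_self_eq_norm_sq, sum_inner]
  refine Finset.sum_congr rfl fun i hi => ?_
  rw [inner_sum, Finset.sum_eq_single i (fun j _ hj => ho hj.symm) (fun h => absurd hi h),
    real_inner_self_eq_norm_sq]

section Spectral

variable {d : ℕ} {Ω : Set (E d)}

lemma spectralProj_mem (Ω : Set (E d)) (mu : ℝ) (w : L2 Ω) :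
    spectralProj Ω mu w ∈ eigenspace Ω mu := by
  have h : spectralProj Ω mu w ∈ (eigenspace Ω mu).topologicalClosure :=
    Submodule.starProjection_apply_mem _ w
  rwa [(isClosed_eigenspace Ω mu).submodule_topologicalClosure_eq] at h

lemma inner_spectralProj_right {mu : ℝ} {φ : L2 Ω} (hφ : φ ∈ eigenspace Ω mu) (w : L2 Ω) :
    inner ℝ φ (spectralProj Ω mu w) = inner ℝ φ w := by
  have h : inner ℝ φ (w - spectralProj Ω mu w) = 0 :=
    Submodule.sub_starProjection_mem_orthogonal (K := (eigenspace Ω mu).topologicalClosure) w φ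
      (Submodule.le_topologicalClosure _ hφ)
  rw [inner_sub_right] at h
  linarith

lemma inner_spectralProj_of_ne {mu nu : ℝ} (h : mu ≠ nu) (v w : L2 Ω) :
    inner ℝ (spectralProj Ω mu v) (spectralProj Ω nu w) = 0 :=
  inner_eigenspace_eq_zero h (spectralProj_mem Ω mu v) (spectralProj_mem Ω nu w)

lemma inner_spectralProj_self (mu : ℝ) (v w : L2 Ω) :
    inner ℝ (spectralProj Ω mu v) w = inner ℝ (spectralProj Ω mu v) (spectralProj Ω mu w) :=
  (inner_spectralProj_right (spectralProj_mem Ω mu v) w).symm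

lemma sum_norm_spectralProj_sq_le (w : L2 Ω) (F : Finset ℝ) :
    ∑ mu ∈ F, ‖spectralProj Ω mu w‖ ^ 2 ≤ ‖w‖ ^ 2 := by
  have h1 := norm_sq_sum_of_pairwise_orthogonal (x := fun mu => spectralProj Ω mu w)
    (fun i j h => inner_spectralProj_of_ne h w w) F
  have h2 : inner ℝ (∑ mu ∈ F, spectralProj Ω mu w) w = ∑ mu ∈ F, ‖spectralProj Ω mu w‖ ^ 2 := by
    rw [sum_inner]
    refine Finset.sum_congr rfl fun mu _ => ?_
    rw [inner_spectralProj_self, real_inner_self_eq_norm_sq]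
  have h3 := real_inner_le_norm (∑ mu ∈ F, spectralProj Ω mu w) w
  rw [h2, ← h1] at h3
  rw [← h1]
  have h4 := norm_nonneg (∑ mu ∈ F, spectralProj Ω mu w)
  have h5 := norm_nonneg w
  rcases h4.eq_or_lt with h | h
  · rw [← h, zero_pow two_ne_zero]
    positivity
  · have : ‖∑ mu ∈ F, spectralProj Ω mu w‖ ≤ ‖w‖ := by
      rw [sq] at h3
      exact le_of_mul_le_mul_left h3 h
    gcongr

lemma summable_norm_spectralProj_sq (w : L2 Ω) :
    Summable fun mu => ‖spectralProj Ω mu w‖ ^ 2 :=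
  summable_of_sum_le (fun _ => by positivity) (sum_norm_spectralProj_sq_le w)

/-- The expansion of `w` in eigenfunctions. -/
lemma hasSum_spectralProj (hΩo : IsOpen Ω) (hΩ : Bornology.IsBounded Ω) (w : L2 Ω) :
    HasSum (fun mu => spectralProj Ω mu w) w := by
  have hs : Summable fun mu => spectralProj Ω mu w :=
    summable_of_pairwise_orthogonal (fun i j h => inner_spectralProj_of_ne h w w)
      (summable_norm_spectralProj_sq w)
  suffices w - ∑' mu, spectralProj Ω mu w = 0 by
    rw [sub_eq_zero] at this
    nth_rw 2 [this]
    exact hs.hasSum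
  refine eq_zero_of_forall_inner_eigenspace hΩo hΩ fun mu φ hφ => ?_
  have h1 : inner ℝ φ (∑' mu, spectralProj Ω mu w) = ∑' nu, inner ℝ φ (spectralProj Ω nu w) :=
    (innerSL ℝ φ).map_tsum hs
  rw [inner_sub_right, h1, tsum_eq_single mu fun nu hnu =>
    inner_eigenspace_eq_zero hnu.symm hφ (spectralProj_mem Ω nu w), inner_spectralProj_right hφ,
    sub_self]

/-- Parseval's identity. -/
lemma hasSum_norm_spectralProj_sq (hΩo : IsOpen Ω) (hΩ : Bornology.IsBounded Ω) (w : L2 Ω) :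
    HasSum (fun mu => ‖spectralProj Ω mu w‖ ^ 2) (‖w‖ ^ 2) := by
  have h := (innerSL ℝ w).hasSum (hasSum_spectralProj hΩo hΩ w)
  have e : ∀ mu, innerSL ℝ w (spectralProj Ω mu w) = ‖spectralProj Ω mu w‖ ^ 2 := fun mu => by
    rw [innerSL_apply_apply, real_inner_comm, inner_spectralProj_self, real_inner_self_eq_norm_sq]
  simpa only [e, innerSL_apply_apply, real_inner_self_eq_norm_sq] using h

/-- `c` is a positive lower bound for the eigenvalues. -/
def IsEigenvalueBound (Ω : Set (E d)) (c : ℝ) : Prop :=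
  0 < c ∧ ∀ mu, eigenspace Ω mu ≠ ⊥ → c ≤ mu

lemma IsEigenvalueBound.spectralProj_eq_zero_or_le {c : ℝ} (hc : IsEigenvalueBound Ω c) (mu : ℝ)
    (w : L2 Ω) : spectralProj Ω mu w = 0 ∨ c ≤ mu := by
  by_cases h : eigenspace Ω mu = ⊥
  · left
    have := spectralProj_mem Ω mu w
    rwa [h] at this
  · exact Or.inr (hc.2 mu h)

variable {c : ℝ}

/-- The terms of the spectral sums are nonnegative, although `mu ^ r` need not be for `mu < 0`:
the projection vanishes there. -/
lemma energy_term_nonneg (hc : IsEigenvalueBound Ω c) (r mu : ℝ) (w : L2 Ω) :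
    0 ≤ mu ^ r * ‖spectralProj Ω mu w‖ ^ 2 := by
  rcases hc.spectralProj_eq_zero_or_le mu w with h | h
  · simp [h]
  · have := hc.1.trans_le h
    positivity

lemma mem_hSpace_iff (hc : IsEigenvalueBound Ω c) {r : ℝ} {w : L2 Ω} :
    w ∈ hSpace Ω r ↔ Summable fun mu => mu ^ r * ‖spectralProj Ω mu w‖ ^ 2 := by
  have e : hNormSq Ω r w =
      ∑' mu : ℝ, ENNReal.ofReal (mu ^ r * ‖spectralProj Ω mu w‖ ^ 2) := rfl
  constructor
  · intro h
    have h' : hNormSq Ω r w ≠ ∞ := ne_of_lt h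
    rw [e] at h'
    refine (ENNReal.summable_toReal h').congr fun mu => ?_
    exact ENNReal.toReal_ofReal (energy_term_nonneg hc r mu w)
  · intro h
    change hNormSq Ω r w < ∞
    rw [e, ← ENNReal.ofReal_tsum_of_nonneg (fun mu => energy_term_nonneg hc r mu w) h]
    exact ENNReal.ofReal_lt_top

lemma fracPairing_self (s : ℝ) (w : L2 Ω) :
    fracPairing Ω s w w = ∑' mu : ℝ, mu ^ s * ‖spectralProj Ω mu w‖ ^ 2 := by
  simp [fracPairing]

lemma fracPairing_self_nonneg (hc : IsEigenvalueBound Ω c) (s : ℝ) (w : L2 Ω) :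
    0 ≤ fracPairing Ω s w w := by
  rw [fracPairing_self]
  exact tsum_nonneg fun mu => energy_term_nonneg hc s mu w

lemma hNormSq_eq (hc : IsEigenvalueBound Ω c) {s : ℝ} {w : L2 Ω} (hw : w ∈ hSpace Ω s) :
    hNormSq Ω s w = ENNReal.ofReal (fracPairing Ω s w w) := by
  rw [fracPairing_self, ENNReal.ofReal_tsum_of_nonneg (fun mu => energy_term_nonneg hc s mu w)
    ((mem_hSpace_iff hc).1 hw)]
  rfl

lemma mem_hSpace_of_sum_le (hc : IsEigenvalueBound Ω c) {s B : ℝ} {w : L2 Ω}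
    (h : ∀ F : Finset ℝ, ∑ mu ∈ F, mu ^ s * ‖spectralProj Ω mu w‖ ^ 2 ≤ B) :
    w ∈ hSpace Ω s ∧ fracPairing Ω s w w ≤ B := by
  have hs := summable_of_sum_le (fun mu => energy_term_nonneg hc s mu w) h
  refine ⟨(mem_hSpace_iff hc).2 hs, ?_⟩
  rw [fracPairing_self]
  exact hs.tsum_le_of_sum_le h

lemma abs_inner_term_le (hc : IsEigenvalueBound Ω c) (s mu : ℝ) (w z : L2 Ω) :
    |mu ^ s * inner ℝ (spectralProj Ω mu w) (spectralProj Ω mu z)| ≤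
      mu ^ s * ‖spectralProj Ω mu w‖ ^ 2 + mu ^ s * ‖spectralProj Ω mu z‖ ^ 2 := by
  rcases hc.spectralProj_eq_zero_or_le mu w with h | h
  · simpa [h] using energy_term_nonneg hc s mu z
  · have hmu := hc.1.trans_le h
    rw [abs_mul, abs_of_pos (by positivity : 0 < mu ^ s), ← mul_add]
    have h1 := abs_real_inner_le_norm (spectralProj Ω mu w) (spectralProj Ω mu z)
    gcongr
    nlinarith [sq_nonneg (‖spectralProj Ω mu w‖ - ‖spectralProj Ω mu z‖),
      sq_nonneg (‖spectralProj Ω mu w‖), sq_nonneg (‖spectralProj Ω mu z‖)]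

lemma summable_fracPairing (hc : IsEigenvalueBound Ω c) {s : ℝ} {w z : L2 Ω}
    (hw : w ∈ hSpace Ω s) (hz : z ∈ hSpace Ω s) :
    Summable fun mu : ℝ => mu ^ s * inner ℝ (spectralProj Ω mu w) (spectralProj Ω mu z) :=
  Summable.of_norm_bounded (((mem_hSpace_iff hc).1 hw).add ((mem_hSpace_iff hc).1 hz))
    fun mu => abs_inner_term_le hc s mu w z

lemma hSpace_add (hc : IsEigenvalueBound Ω c) {s : ℝ} {w z : L2 Ω}
    (hw : w ∈ hSpace Ω s) (hz : z ∈ hSpace Ω s) : w + z ∈ hSpace Ω s := by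
  refine (mem_hSpace_iff hc).2 ?_
  refine ((((mem_hSpace_iff hc).1 hw).add ((mem_hSpace_iff hc).1 hz)).add
    ((summable_fracPairing hc hw hz).mul_left 2)).congr fun mu => ?_
  rw [map_add, norm_add_sq_real]
  ring

lemma hSpace_smul (hc : IsEigenvalueBound Ω c) {s : ℝ} {w : L2 Ω} (a : ℝ)
    (hw : w ∈ hSpace Ω s) : a • w ∈ hSpace Ω s := by
  refine (mem_hSpace_iff hc).2 ((((mem_hSpace_iff hc).1 hw).mul_left (a ^ 2)).congr fun mu => ?_)
  rw [map_smul, norm_smul, mul_pow, Real.norm_eq_abs, sq_abs]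
  ring

lemma hSpace_sub (hc : IsEigenvalueBound Ω c) {s : ℝ} {w z : L2 Ω}
    (hw : w ∈ hSpace Ω s) (hz : z ∈ hSpace Ω s) : w - z ∈ hSpace Ω s := by
  rw [sub_eq_add_neg, ← neg_one_smul ℝ z]
  exact hSpace_add hc hw (hSpace_smul hc _ hz)

lemma fracPairing_comm (s : ℝ) (w z : L2 Ω) : fracPairing Ω s w z = fracPairing Ω s z w := by
  simp only [fracPairing, real_inner_comm]

lemma fracPairing_sub_right (hc : IsEigenvalueBound Ω c) {s : ℝ} {v w z : L2 Ω}
    (hv : v ∈ hSpace Ω s) (hw : w ∈ hSpace Ω s) (hz : z ∈ hSpace Ω s) :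
    fracPairing Ω s v (w - z) = fracPairing Ω s v w - fracPairing Ω s v z := by
  unfold fracPairing
  rw [← (summable_fracPairing hc hv hw).tsum_sub (summable_fracPairing hc hv hz)]
  refine tsum_congr fun mu => ?_
  rw [map_sub, inner_sub_right, mul_sub]

lemma fracPairing_smul_right (s a : ℝ) (v w : L2 Ω) :
    fracPairing Ω s v (a • w) = a * fracPairing Ω s v w := by
  unfold fracPairing
  rw [← tsum_mul_left]
  refine tsum_congr fun mu => ?_
  rw [map_smul, real_inner_smul_right]
  ring

lemma fracPairing_sub_self (hc : IsEigenvalueBound Ω c) {s : ℝ} {w z : L2 Ω}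
    (hw : w ∈ hSpace Ω s) (hz : z ∈ hSpace Ω s) :
    fracPairing Ω s (w - z) (w - z) =
      fracPairing Ω s w w - 2 * fracPairing Ω s w z + fracPairing Ω s z z := by
  have hwz := hSpace_sub hc hw hz
  rw [fracPairing_sub_right hc hwz hw hz, fracPairing_comm s _ w, fracPairing_comm s _ z,
    fracPairing_sub_right hc hw hw hz, fracPairing_sub_right hc hz hw hz, fracPairing_comm s z w]
  ring

lemma le_fracPairing_self (hΩo : IsOpen Ω) (hΩ : Bornology.IsBounded Ω)
    (hc : IsEigenvalueBound Ω c) {s : ℝ} (hs : 0 ≤ s) {w : L2 Ω} (hw : w ∈ hSpace Ω s) :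
    c ^ s * ‖w‖ ^ 2 ≤ fracPairing Ω s w w := by
  have hP := hasSum_norm_spectralProj_sq hΩo hΩ w
  rw [fracPairing_self, ← hP.tsum_eq, ← tsum_mul_left]
  refine (hP.summable.mul_left _).tsum_le_tsum (fun mu => ?_) ((mem_hSpace_iff hc).1 hw)
  rcases hc.spectralProj_eq_zero_or_le mu w with h | h
  · simp [h]
  · have := hc.1
    gcongr

lemma hSpace_two_mul_subset (hc : IsEigenvalueBound Ω c) {s : ℝ} (hs : 0 ≤ s) :
    hSpace Ω (2 * s) ⊆ hSpace Ω s := by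
  intro w hw
  refine (mem_hSpace_iff hc).2 (Summable.of_nonneg_of_le (fun mu => energy_term_nonneg hc s mu w)
    (fun mu => ?_) (((mem_hSpace_iff hc).1 hw).mul_left (c ^ s)⁻¹))
  rcases hc.spectralProj_eq_zero_or_le mu w with h | h
  · simp [h]
  · have h0 := hc.1
    have hmu := h0.trans_le h
    rw [← mul_assoc]
    gcongr
    rw [two_mul, Real.rpow_add hmu, ← mul_assoc]
    refine le_mul_of_one_le_left (by positivity) ?_
    rw [one_le_inv_mul₀ (by positivity)]
    gcongr

lemma inner_fracLaplacian (hc : IsEigenvalueBound Ω c) {s : ℝ} {w : L2 Ω}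
    (hw : w ∈ hSpace Ω (2 * s)) (z : L2 Ω) :
    inner ℝ (fracLaplacian Ω s w) z = fracPairing Ω s w z := by
  have hsum : Summable fun mu : ℝ => mu ^ s • spectralProj Ω mu w := by
    refine summable_of_pairwise_orthogonal (fun i j h => ?_) ?_
    · simp [real_inner_smul_left, real_inner_smul_right, inner_spectralProj_of_ne h]
    · refine ((mem_hSpace_iff hc).1 hw).congr fun mu => ?_
      rcases hc.spectralProj_eq_zero_or_le mu w with h | h
      · simp [h]
      · have hmu := hc.1.trans_le h
        rw [norm_smul, mul_pow, two_mul, Real.rpow_add hmu, Real.norm_of_nonneg (by positivity)]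
        ring
  rw [real_inner_comm]
  refine ((innerSL ℝ z).map_tsum hsum).trans ?_
  refine tsum_congr fun mu => ?_
  rw [innerSL_apply_apply, real_inner_smul_right, real_inner_comm, inner_spectralProj_self]

lemma lowerSemicontinuous_hNormSq (Ω : Set (E d)) (s : ℝ) : LowerSemicontinuous (hNormSq Ω s) := by
  refine lowerSemicontinuous_tsum fun mu => Continuous.lowerSemicontinuous ?_
  exact ENNReal.continuous_ofReal.comp (by fun_prop)

end Spectral

/-! ### The profile of the harmonic extension -/

/-- The solution `2^{1-s} Γ(s)⁻¹ z^s K_s(z)` of the Bessel type equation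
`(z^α g')' = z^α g`, `α = 1 - 2 s`, with `g(0) = 1` and decay at infinity, through the integral
representation of the modified Bessel function `K_s`. -/
def besselProfile (s z : ℝ) : ℝ :=
  (Real.Gamma s)⁻¹ * ∫ t in Ioi (0 : ℝ), t ^ (s - 1) * Real.exp (-t - z ^ 2 / (4 * t))

section Bessel

variable {s : ℝ}

lemma integrableOn_rpow_mul_exp (hs : 0 < s) :
    IntegrableOn (fun t : ℝ => t ^ (s - 1) * Real.exp (-t)) (Ioi 0) := by
  refine (Real.GammaIntegral_convergent hs).congr_fun (fun t _ => ?_) measurableSet_Ioi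
  rw [mul_comm]

lemma measurable_bessel_integrand (r z : ℝ) :
    Measurable fun t : ℝ => t ^ r * Real.exp (-t - z ^ 2 / (4 * t)) := by
  fun_prop

lemma bessel_integrand_le (r z : ℝ) {t : ℝ} (ht : 0 < t) :
    ‖t ^ r * Real.exp (-t - z ^ 2 / (4 * t))‖ ≤ t ^ r * Real.exp (-t) := by
  rw [Real.norm_of_nonneg (by positivity)]
  gcongr
  have : 0 ≤ z ^ 2 / (4 * t) := by positivity
  linarith

lemma integrableOn_bessel (hs : 0 < s) (z : ℝ) :
    IntegrableOn (fun t : ℝ => t ^ (s - 1) * Real.exp (-t - z ^ 2 / (4 * t))) (Ioi 0) := by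
  refine Integrable.mono' (integrableOn_rpow_mul_exp hs)
    (measurable_bessel_integrand _ z).aestronglyMeasurable ?_
  filter_upwards [ae_restrict_mem measurableSet_Ioi] with t ht
  exact bessel_integrand_le _ z ht

lemma continuous_besselProfile (hs : 0 < s) : Continuous (besselProfile s) := by
  refine continuous_const.mul ?_
  refine continuous_of_dominated (bound := fun t => t ^ (s - 1) * Real.exp (-t))
    (fun z => (measurable_bessel_integrand _ z).aestronglyMeasurable) (fun z => ?_)
    (integrableOn_rpow_mul_exp hs) (Eventually.of_forall fun t => by fun_prop)
  filter_upwards [ae_restrict_mem measurableSet_Ioi] with t ht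
  exact bessel_integrand_le _ z ht

lemma besselProfile_zero (hs : 0 < s) : besselProfile s 0 = 1 := by
  have h := Real.Gamma_eq_integral hs
  have e : ∫ t in Ioi (0 : ℝ), t ^ (s - 1) * Real.exp (-t - 0 ^ 2 / (4 * t)) = Real.Gamma s := by
    rw [h]
    refine setIntegral_congr_fun measurableSet_Ioi fun t _ => ?_
    simp [mul_comm]
  rw [besselProfile, e, inv_mul_cancel₀ (Real.Gamma_pos_of_pos hs).ne']

lemma besselProfile_pos (hs : 0 < s) (z : ℝ) : 0 < besselProfile s z := by
  refine mul_pos (inv_pos.2 (Real.Gamma_pos_of_pos hs)) ?_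
  rw [setIntegral_pos_iff_support_of_nonneg_ae]
  · have : Ioi (0 : ℝ) ⊆
        Function.support fun t : ℝ => t ^ (s - 1) * Real.exp (-t - z ^ 2 / (4 * t)) := by
      intro t ht
      have ht' : 0 < t := ht
      exact (by positivity : 0 < t ^ (s - 1) * Real.exp (-t - z ^ 2 / (4 * t))).ne'
    rw [inter_eq_self_of_subset_right this]
    simp
  · filter_upwards [ae_restrict_mem measurableSet_Ioi] with t ht
    have ht' : 0 < t := ht
    change 0 ≤ _
    positivity
  · exact integrableOn_bessel hs z

/-- Exponential decay: `t + z² / (4t) ≥ t / 2 + z / 2`. -/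
lemma besselProfile_le (hs : 0 < s) (z : ℝ) :
    besselProfile s z ≤ 2 ^ s * Real.exp (-(z / 2)) := by
  have hG := Real.Gamma_pos_of_pos hs
  rw [besselProfile, inv_mul_le_iff₀ hG]
  have h1 := Real.integral_rpow_mul_exp_neg_mul_Ioi hs (by norm_num : (0 : ℝ) < 1 / 2)
  have hi : IntegrableOn (fun t : ℝ => t ^ (s - 1) * Real.exp (-(1 / 2 * t))) (Ioi 0) := by
    by_contra hn
    rw [integral_undef hn] at h1
    have : 0 < (1 / (1 / 2 : ℝ)) ^ s * Real.Gamma s := by positivity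
    linarith
  calc _ ≤ ∫ t in Ioi (0 : ℝ), t ^ (s - 1) * Real.exp (-(1 / 2 * t)) * Real.exp (-(z / 2)) := by
        refine setIntegral_mono_on (integrableOn_bessel hs z) (hi.mul_const _)
          measurableSet_Ioi fun t ht => ?_
        have ht' : 0 < t := ht
        rw [mul_assoc, ← Real.exp_add]
        gcongr
        have h2 : z ^ 2 / (4 * t) = (z / (2 * t)) ^ 2 * t := by field_simp; ring
        have h3 : z = (z / (2 * t)) * (2 * t) := by field_simp
        set x := z / (2 * t)
        rw [h2, h3]
        nlinarith [mul_nonneg ht'.le (sq_nonneg (x - 1 / 2))]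
    _ = _ := by
        rw [integral_mul_const, h1]
        norm_num
        ring

/-- The substitution `t ↦ a / t`. -/
lemma integral_inversion {a : ℝ} (ha : 0 < a) (s : ℝ) :
    ∫ t in Ioi (0 : ℝ), t ^ (s - 2) * Real.exp (-t - a / t) =
      a ^ (s - 1) * ∫ t in Ioi (0 : ℝ), t ^ (-s) * Real.exp (-t - a / t) := by
  have h1 := integral_comp_rpow_Ioi (fun t : ℝ => t ^ (s - 2) * Real.exp (-t - a / t))
    (by norm_num : (-1 : ℝ) ≠ 0)
  have h2 := integral_comp_mul_left_Ioi
    (fun x : ℝ => (|(-1 : ℝ)| * x ^ ((-1 : ℝ) - 1)) •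
      ((x ^ (-1 : ℝ)) ^ (s - 2) * Real.exp (-(x ^ (-1 : ℝ)) - a / x ^ (-1 : ℝ)))) 0
    (inv_pos.2 ha)
  rw [mul_zero, h1] at h2
  rw [inv_inv, smul_eq_mul] at h2
  rw [← mul_right_inj' ha.ne', ← h2, ← mul_assoc, ← integral_const_mul]
  refine setIntegral_congr_fun measurableSet_Ioi fun t ht => ?_
  have ht' : 0 < t := ht
  have e1 : ((a⁻¹ * t) ^ (-1 : ℝ)) = a / t := by
    rw [Real.rpow_neg_one]; field_simp
  have e2 : (a⁻¹ * t) ^ ((-1 : ℝ) - 1) = a ^ 2 / t ^ 2 := by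
    rw [show ((-1 : ℝ) - 1) = -(2 : ℕ) by norm_num, Real.rpow_neg (by positivity),
      Real.rpow_natCast]
    field_simp
  simp only [e1, e2, smul_eq_mul]
  have e3 : a / (a / t) = t := by field_simp
  rw [e3, Real.div_rpow ha.le ht'.le, abs_neg, abs_one, one_mul]
  have e4 : a ^ (s - 1) = a ^ (s - 2) * a := by
    rw [show s - 1 = s - 2 + 1 by ring, Real.rpow_add_one ha.ne']
  have e5 : t ^ (-s) = (t ^ (s - 2))⁻¹ / t ^ 2 := by
    rw [← Real.rpow_neg ht'.le, ← Real.rpow_natCast t 2, ← Real.rpow_sub ht']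
    congr 1
    push_cast
    ring
  rw [e4, e5]
  have e6 : -(a / t) - t = -t - a / t := by ring
  rw [e6]
  field_simp

/-- `g_s' = - d_s z^{-α} g_{1-s}`. -/
lemma hasDerivAt_besselProfile (hs : s ∈ Ioo (0 : ℝ) 1) {z : ℝ} (hz : 0 < z) :
    HasDerivAt (besselProfile s)
      (-(dConst s * z ^ (-(1 - 2 * s)) * besselProfile (1 - s) z)) z := by
  have hG := Real.Gamma_pos_of_pos hs.1
  have hG' := Real.Gamma_pos_of_pos (sub_pos.2 hs.2)
  have key := hasDerivAt_integral_of_dominated_loc_of_deriv_le (μ := volume.restrict (Ioi (0 : ℝ)))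
    (F := fun z t => t ^ (s - 1) * Real.exp (-t - z ^ 2 / (4 * t)))
    (F' := fun z t => t ^ (s - 1) * (Real.exp (-t - z ^ 2 / (4 * t)) * (-(2 * z / (4 * t)))))
    (bound := fun t => 16 / z * (t ^ (s - 1) * Real.exp (-t))) (x₀ := z)
    (s := Metric.ball z (z / 2)) (Metric.ball_mem_nhds _ (by positivity))
    (Eventually.of_forall fun x => (measurable_bessel_integrand _ x).aestronglyMeasurable)
    (integrableOn_bessel hs.1 z)
    (by exact (by fun_prop : Measurable fun t : ℝ =>
      t ^ (s - 1) * (Real.exp (-t - z ^ 2 / (4 * t)) * (-(2 * z / (4 * t))))).aestronglyMeasurable)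
    ?_ ((integrableOn_rpow_mul_exp hs.1).const_mul _) ?_
  · have e : (Real.Gamma s)⁻¹ *
        ∫ t in Ioi (0 : ℝ), t ^ (s - 1) * (Real.exp (-t - z ^ 2 / (4 * t)) * (-(2 * z / (4 * t)))) =
        -(dConst s * z ^ (-(1 - 2 * s)) * besselProfile (1 - s) z) := by
      have e1 : ∫ t in Ioi (0 : ℝ), t ^ (s - 1) *
          (Real.exp (-t - z ^ 2 / (4 * t)) * (-(2 * z / (4 * t)))) =
          -(z / 2) * ∫ t in Ioi (0 : ℝ), t ^ (s - 2) * Real.exp (-t - z ^ 2 / 4 / t) := by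
        rw [← integral_const_mul]
        refine setIntegral_congr_fun measurableSet_Ioi fun t ht => ?_
        have ht' : 0 < t := ht
        have : t ^ (s - 1) = t ^ (s - 2) * t := by
          rw [show s - 1 = s - 2 + 1 by ring, Real.rpow_add_one ht'.ne']
        simp only [this]
        rw [div_div]
        field_simp
        ring
      rw [e1, integral_inversion (by positivity), besselProfile, dConst]
      simp only [div_div]
      rw [show (1 - s - 1 : ℝ) = -s by ring]
      have e2 : (z ^ 2 / 4) ^ (s - 1) = z ^ (-(1 - 2 * s)) / z * (2 * 2 ^ (1 - 2 * s)) := by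
        rw [Real.div_rpow (by positivity) (by norm_num), ← Real.rpow_natCast z 2,
          ← Real.rpow_mul hz.le, show (4 : ℝ) = 2 ^ (2 : ℝ) by norm_num,
          ← Real.rpow_mul (by norm_num), div_eq_mul_inv, ← Real.rpow_neg (by norm_num),
          ← Real.rpow_sub_one hz.ne', mul_comm (2 : ℝ) (2 ^ (1 - 2 * s)),
          ← Real.rpow_add_one (by norm_num)]
        congr 2
        · push_cast; ring
        · ring
      rw [e2]
      generalize (∫ t in Ioi (0 : ℝ), t ^ (-s) * Real.exp (-t - z ^ 2 / (4 * t))) = I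
      field_simp
    have := (key.2.const_mul (Real.Gamma s)⁻¹)
    rw [e] at this
    exact this
  · filter_upwards [ae_restrict_mem measurableSet_Ioi] with t ht x hx
    have ht' : 0 < t := ht
    rw [Metric.mem_ball, Real.dist_eq, abs_lt] at hx
    have hx1 : z / 2 < x := by linarith
    have hx2 : x < 3 * z / 2 := by linarith
    have hx0 : 0 < x := by linarith
    rw [norm_mul, norm_mul, norm_neg, Real.norm_of_nonneg (by positivity : 0 ≤ t ^ (s - 1)),
      Real.norm_of_nonneg (Real.exp_pos _).le, Real.norm_of_nonneg (by positivity),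
      sub_eq_add_neg (-t),
      Real.exp_add]
    have h1 : Real.exp (-(x ^ 2 / (4 * t))) ≤ 4 * t / x ^ 2 := by
      have h3 : 0 < x ^ 2 / (4 * t) := by positivity
      have h2 := Real.add_one_le_exp (x ^ 2 / (4 * t))
      rw [Real.exp_neg, inv_le_comm₀ (Real.exp_pos _) (by positivity), inv_div]
      linarith
    have h4 : 2 / x ≤ 16 / z := by
      rw [div_le_div_iff₀ hx0 hz]
      linarith
    calc t ^ (s - 1) * (Real.exp (-t) * Real.exp (-(x ^ 2 / (4 * t))) * (2 * x / (4 * t)))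
        ≤ t ^ (s - 1) * (Real.exp (-t) * (4 * t / x ^ 2) * (2 * x / (4 * t))) := by gcongr
      _ = 2 / x * (t ^ (s - 1) * Real.exp (-t)) := by field_simp
      _ ≤ _ := by gcongr
  · filter_upwards [ae_restrict_mem measurableSet_Ioi] with t ht x hx
    have ht' : 0 < t := ht
    refine HasDerivAt.const_mul _ (HasDerivAt.exp ?_)
    have := ((hasDerivAt_pow 2 x).div_const (4 * t)).const_sub (-t)
    simpa using this

lemma dConst_pos (hs : s ∈ Ioo (0 : ℝ) 1) : 0 < dConst s := by
  have hG := Real.Gamma_pos_of_pos hs.1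
  have hG' := Real.Gamma_pos_of_pos (sub_pos.2 hs.2)
  unfold dConst
  positivity

lemma dConst_mul_dConst (hs : s ∈ Ioo (0 : ℝ) 1) : dConst s * dConst (1 - s) = 1 := by
  have hG := (Real.Gamma_pos_of_pos hs.1).ne'
  have hG' := (Real.Gamma_pos_of_pos (sub_pos.2 hs.2)).ne'
  unfold dConst
  rw [sub_sub_cancel]
  have : (2 : ℝ) ^ (1 - 2 * s) * 2 ^ (1 - 2 * (1 - s)) = 1 := by
    rw [← Real.rpow_add (by norm_num)]
    ring_nf
    norm_num
  field_simp
  linarith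

end Bessel

/-- The extension profile `Q(y) = g_s(√mu y)` of an eigenfunction for the eigenvalue `mu`. -/
def profile (s mu y : ℝ) : ℝ := besselProfile s (√mu * y)

/-- The flux `P = - y^α Q'` of the extension profile. -/
def flux (s mu y : ℝ) : ℝ := dConst s * mu ^ s * besselProfile (1 - s) (√mu * y)

section Profile

variable {s mu : ℝ}

lemma continuous_profile (hs : 0 < s) : Continuous (profile s mu) :=
  (continuous_besselProfile hs).comp (by fun_prop)

lemma continuous_flux (hs : s < 1) : Continuous (flux s mu) :=
  continuous_const.mul ((continuous_besselProfile (sub_pos.2 hs)).comp (by fun_prop))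

lemma profile_zero (hs : 0 < s) : profile s mu 0 = 1 := by
  rw [profile, mul_zero, besselProfile_zero hs]

lemma flux_zero (hs : s < 1) : flux s mu 0 = dConst s * mu ^ s := by
  rw [flux, mul_zero, besselProfile_zero (sub_pos.2 hs), mul_one]

lemma profile_pos (hs : 0 < s) (y : ℝ) : 0 < profile s mu y := besselProfile_pos hs _

lemma flux_pos (hs : s ∈ Ioo (0 : ℝ) 1) (hmu : 0 < mu) (y : ℝ) : 0 < flux s mu y :=
  mul_pos (mul_pos (dConst_pos hs) (by positivity)) (besselProfile_pos (sub_pos.2 hs.2) _)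

lemma profile_le (hs : 0 < s) (y : ℝ) :
    profile s mu y ≤ 2 ^ s * Real.exp (-(√mu * y / 2)) :=
  besselProfile_le hs _

lemma hasDerivAt_profile (hs : s ∈ Ioo (0 : ℝ) 1) (hmu : 0 < mu) {y : ℝ} (hy : 0 < y) :
    HasDerivAt (profile s mu) (-(y ^ (-(1 - 2 * s)) * flux s mu y)) y := by
  have h1 : HasDerivAt (fun y => √mu * y) √mu y := by
    simpa using (hasDerivAt_id y).const_mul √mu
  have h := (hasDerivAt_besselProfile hs (z := √mu * y) (by positivity)).comp y h1
  refine h.congr_deriv ?_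
  rw [flux, Real.mul_rpow (by positivity) hy.le]
  have e : √mu ^ (-(1 - 2 * s)) * √mu = mu ^ s := by
    rw [← Real.rpow_add_one (by positivity), Real.sqrt_eq_rpow, ← Real.rpow_mul hmu.le]
    congr 1
    ring
  rw [← e]
  ring

lemma hasDerivAt_flux (hs : s ∈ Ioo (0 : ℝ) 1) (hmu : 0 < mu) {y : ℝ} (hy : 0 < y) :
    HasDerivAt (flux s mu) (-(mu * y ^ (1 - 2 * s) * profile s mu y)) y := by
  have h1 : HasDerivAt (fun y => √mu * y) √mu y := by
    simpa using (hasDerivAt_id y).const_mul √mu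
  have hs' : 1 - s ∈ Ioo (0 : ℝ) 1 := ⟨by linarith [hs.2], by linarith [hs.1]⟩
  have h := ((hasDerivAt_besselProfile hs' (z := √mu * y) (by positivity)).comp y h1).const_mul
    (dConst s * mu ^ s)
  refine h.congr_deriv ?_
  rw [profile, Real.mul_rpow (by positivity) hy.le, sub_sub_cancel,
    show -(1 - 2 * (1 - s)) = 1 - 2 * s by ring]
  have e : mu ^ s * (√mu ^ (1 - 2 * s) * √mu) = mu := by
    rw [← Real.rpow_add_one (by positivity), Real.sqrt_eq_rpow, ← Real.rpow_mul hmu.le,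
      ← Real.rpow_add hmu]
    ring_nf
    simp
  have e' := dConst_mul_dConst hs
  generalize √mu ^ (1 - 2 * s) = A at *
  generalize √mu = B at *
  linear_combination (-(mu * y ^ (1 - 2 * s) * besselProfile s (B * y))) * e'
    - dConst s * dConst (1 - s) * y ^ (1 - 2 * s) * besselProfile s (B * y) * e

end Profile

/-! ### Tensor products of square integrable functions -/

section Tensor

variable {α β F : Type*} [MeasurableSpace α] [MeasurableSpace β] [NormedAddCommGroup F]
  {μ : Measure α} {ν : Measure β} [SFinite ν] {π : Measure (α × β)}

lemma memLp_tensor [NormedSpace ℝ F] (q : Lp ℝ 2 ν) (φ : Lp F 2 μ) :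
    MemLp (fun p : α × β => q p.2 • φ p.1) 2 (μ.prod ν) := by
  have h1 : AEStronglyMeasurable (fun p : α × β => q p.2 • φ p.1) (μ.prod ν) :=
    (Lp.aestronglyMeasurable q).comp_snd.smul (Lp.aestronglyMeasurable φ).comp_fst
  refine ⟨h1, ?_⟩
  rw [eLpNorm_lt_top_iff_lintegral_rpow_enorm_lt_top two_ne_zero ENNReal.ofNat_ne_top]
  have hq : ∫⁻ y, ‖q y‖ₑ ^ 2 ∂ν < ∞ := by
    rw [← Lp_enorm_sq]; exact ENNReal.pow_lt_top enorm_lt_top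
  have hφ : ∫⁻ x, ‖φ x‖ₑ ^ 2 ∂μ < ∞ := by
    rw [← Lp_enorm_sq]; exact ENNReal.pow_lt_top enorm_lt_top
  simp only [ENNReal.toReal_ofNat, ENNReal.rpow_ofNat, enorm_smul, mul_pow]
  have e := lintegral_prod_mul (μ := μ) (ν := ν) (f := fun x => ‖φ x‖ₑ ^ 2)
    (g := fun y => ‖q y‖ₑ ^ 2) ((Lp.aestronglyMeasurable φ).enorm.pow_const 2)
    ((Lp.aestronglyMeasurable q).enorm.pow_const 2)
  simp_rw [mul_comm (‖q _‖ₑ ^ 2)]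
  rw [e]
  exact ENNReal.mul_lt_top hφ hq

/-- The function `(x, y) ↦ q(y) φ(x)`, square integrable for a measure `π` that is equal to a
product measure. -/
def tensor [NormedSpace ℝ F] (hπ : π = μ.prod ν) (q : Lp ℝ 2 ν) (φ : Lp F 2 μ) : Lp F 2 π :=
  (hπ ▸ memLp_tensor q φ : MemLp (fun p : α × β => q p.2 • φ p.1) 2 π).toLp _

lemma coeFn_tensor [NormedSpace ℝ F] (hπ : π = μ.prod ν) (q : Lp ℝ 2 ν) (φ : Lp F 2 μ) :
    tensor hπ q φ =ᵐ[π] fun p => q p.2 • φ p.1 := MemLp.coeFn_toLp _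

lemma coeFn_tensor_toLp [NormedSpace ℝ F] (hπ : π = μ.prod ν) {q : β → ℝ} (hq : MemLp q 2 ν)
    {φ : Lp F 2 μ} {g : α → F} (hφ : φ =ᵐ[μ] g) :
    tensor hπ (hq.toLp q) φ =ᵐ[π] fun p => q p.2 • g p.1 := by
  subst hπ
  filter_upwards [coeFn_tensor rfl (hq.toLp q) φ,
    Measure.quasiMeasurePreserving_snd.ae_eq_comp (μ := μ.prod ν) hq.coeFn_toLp,
    Measure.quasiMeasurePreserving_fst.ae_eq_comp (μ := μ.prod ν) hφ] with p h1 h2 h3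
  simp only [Function.comp_apply] at h2 h3
  rw [h1, h2, h3]

lemma tensor_add_right [NormedSpace ℝ F] (hπ : π = μ.prod ν) (q : Lp ℝ 2 ν) (φ χ : Lp F 2 μ) :
    tensor hπ q (φ + χ) = tensor hπ q φ + tensor hπ q χ := by
  subst hπ
  refine Lp.ext ?_
  filter_upwards [coeFn_tensor rfl q φ, coeFn_tensor rfl q χ, coeFn_tensor rfl q (φ + χ),
    Lp.coeFn_add (tensor rfl q φ) (tensor rfl q χ),
    Measure.quasiMeasurePreserving_fst.ae_eq_comp (μ := μ.prod ν) (Lp.coeFn_add φ χ)]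
    with p h1 h2 h3 h4 h5
  simp only [Function.comp_apply, Pi.add_apply] at h5
  rw [h4, Pi.add_apply, h1, h2, h3, h5, smul_add]

lemma tensor_smul_right [NormedSpace ℝ F] (hπ : π = μ.prod ν) (q : Lp ℝ 2 ν) (a : ℝ)
    (φ : Lp F 2 μ) : tensor hπ q (a • φ) = a • tensor hπ q φ := by
  subst hπ
  refine Lp.ext ?_
  filter_upwards [coeFn_tensor rfl q φ, coeFn_tensor rfl q (a • φ),
    Lp.coeFn_smul a (tensor rfl q φ),
    Measure.quasiMeasurePreserving_fst.ae_eq_comp (μ := μ.prod ν) (Lp.coeFn_smul a φ)]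
    with p h1 h2 h3 h4
  simp only [Function.comp_apply, Pi.smul_apply] at h4
  rw [h3, Pi.smul_apply, h1, h2, h4, smul_comm]

lemma tensor_sub_left [NormedSpace ℝ F] (hπ : π = μ.prod ν) (q r : Lp ℝ 2 ν) (φ : Lp F 2 μ) :
    tensor hπ (q - r) φ = tensor hπ q φ - tensor hπ r φ := by
  subst hπ
  refine Lp.ext ?_
  filter_upwards [coeFn_tensor rfl q φ, coeFn_tensor rfl r φ, coeFn_tensor rfl (q - r) φ,
    Lp.coeFn_sub (tensor rfl q φ) (tensor rfl r φ),
    Measure.quasiMeasurePreserving_snd.ae_eq_comp (μ := μ.prod ν) (Lp.coeFn_sub q r)]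
    with p h1 h2 h3 h4 h5
  simp only [Function.comp_apply, Pi.sub_apply] at h5
  rw [h4, Pi.sub_apply, h1, h2, h3, h5, sub_smul]

variable [SFinite μ] [InnerProductSpace ℝ F]

lemma inner_tensor_tensor (hπ : π = μ.prod ν) (q r : Lp ℝ 2 ν) (φ χ : Lp F 2 μ) :
    inner ℝ (tensor hπ q φ) (tensor hπ r χ) = inner ℝ q r * inner ℝ φ χ := by
  subst hπ
  rw [L2.inner_def, L2.inner_def, L2.inner_def, mul_comm, ← integral_prod_mul]
  refine integral_congr_ae ?_
  filter_upwards [coeFn_tensor rfl q φ, coeFn_tensor rfl r χ] with p h1 h2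
  rw [h1, h2, real_inner_smul_left, real_inner_smul_right]
  simp
  ring

lemma norm_tensor (hπ : π = μ.prod ν) (q : Lp ℝ 2 ν) (φ : Lp F 2 μ) :
    ‖tensor hπ q φ‖ = ‖q‖ * ‖φ‖ := by
  have h := inner_tensor_tensor hπ q q φ φ
  simp only [real_inner_self_eq_norm_sq, ← mul_pow] at h
  exact (sq_eq_sq₀ (norm_nonneg _) (by positivity)).1 h

lemma continuous_tensor_right (hπ : π = μ.prod ν) (q : Lp ℝ 2 ν) :
    Continuous fun φ : Lp F 2 μ => tensor hπ q φ :=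
  (LinearMap.mkContinuous
    ({ toFun := fun φ : Lp F 2 μ => tensor hπ q φ
       map_add' := tensor_add_right hπ q
       map_smul' := tensor_smul_right hπ q } : Lp F 2 μ →ₗ[ℝ] Lp F 2 π) ‖q‖
    fun φ => (norm_tensor hπ q φ).le).continuous

lemma tendsto_tensor_left (hπ : π = μ.prod ν) {q : ℕ → Lp ℝ 2 ν} {r : Lp ℝ 2 ν}
    (h : Tendsto q atTop (𝓝 r)) (φ : Lp F 2 μ) :
    Tendsto (fun n => tensor hπ (q n) φ) atTop (𝓝 (tensor hπ r φ)) := by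
  rw [tendsto_iff_norm_sub_tendsto_zero] at h ⊢
  simp_rw [← tensor_sub_left, norm_tensor]
  simpa using h.mul_const ‖φ‖

/-- Integration in `x` first. -/
lemma inner_tensor_eq_integral_left (hπ : π = μ.prod ν) {q : β → ℝ} (hq : MemLp q 2 ν)
    (φ : Lp F 2 μ) {W : Lp F 2 π} {w : α × β → F} (hW : W =ᵐ[π] w) :
    inner ℝ (tensor hπ (hq.toLp q) φ) W =
      ∫ y, q y * ∫ x, inner ℝ (φ x) (w (x, y)) ∂μ ∂ν := by
  subst hπ
  have h1 : (fun p : α × β => inner ℝ (tensor rfl (hq.toLp q) φ p) (W p)) =ᵐ[μ.prod ν]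
      fun p => q p.2 * inner ℝ (φ p.1) (w p) := by
    filter_upwards [coeFn_tensor_toLp rfl hq (ae_eq_refl φ), hW] with p h1 h2
    rw [h1, h2, real_inner_smul_left]
  rw [L2.inner_def, integral_congr_ae h1,
    integral_prod_symm _ ((L2.integrable_inner (𝕜 := ℝ) _ _).congr h1)]
  refine integral_congr_ae (Eventually.of_forall fun y => ?_)
  simp only
  rw [integral_const_mul]

/-- Integration in `y` first. -/
lemma inner_tensor_eq_integral_right (hπ : π = μ.prod ν) {q : β → ℝ} (hq : MemLp q 2 ν)
    (φ : Lp ℝ 2 μ) {W : Lp ℝ 2 π} {w : α × β → ℝ} (hW : W =ᵐ[π] w) :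
    Integrable (fun x => φ x * ∫ y, q y * w (x, y) ∂ν) μ ∧
    inner ℝ (tensor hπ (hq.toLp q) φ) W = ∫ x, φ x * ∫ y, q y * w (x, y) ∂ν ∂μ := by
  subst hπ
  have h1 : (fun p : α × β => inner ℝ (tensor rfl (hq.toLp q) φ p) (W p)) =ᵐ[μ.prod ν]
      fun p => φ p.1 * (q p.2 * w p) := by
    filter_upwards [coeFn_tensor_toLp rfl hq (ae_eq_refl φ), hW] with p h1 h2
    rw [h1, h2, real_inner_smul_left]
    simp
    ring
  have h2 := (L2.integrable_inner (𝕜 := ℝ) (tensor rfl (hq.toLp q) φ) W).congr h1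
  have h3 := h2.integral_prod_left
  simp only [integral_const_mul] at h3
  refine ⟨h3, ?_⟩
  rw [L2.inner_def, integral_congr_ae h1, integral_prod _ h2]
  refine integral_congr_ae (Eventually.of_forall fun x => ?_)
  simp only
  rw [integral_const_mul]

end Tensor

/-! ### The weighted measure and the extension profiles -/

/-- The measure `y^α dy` on `(0, Y)`. -/
def weightMeasure (a Y : ℝ) : Measure ℝ :=
  (volume.restrict (Ioo 0 Y)).withDensity fun y => ENNReal.ofReal (y ^ a)

instance (a Y : ℝ) : SFinite (weightMeasure a Y) := by
  unfold weightMeasure; infer_instance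

lemma cylMeasure_eq_prod {d : ℕ} (Ω : Set (E d)) (a Y : ℝ) :
    cylMeasure Ω a Y = (volume.restrict Ω).prod (weightMeasure a Y) := by
  rw [weightMeasure, prod_withDensity_right (by fun_prop), Measure.prod_restrict,
    ← Measure.volume_eq_prod]
  rfl

lemma integral_weightMeasure {a Y : ℝ} (hY : 0 ≤ Y) (f : ℝ → ℝ) :
    ∫ y, f y ∂(weightMeasure a Y) = ∫ y in (0)..Y, y ^ a * f y := by
  rw [weightMeasure, integral_withDensity_eq_integral_toReal_smul (by fun_prop)
    (Eventually.of_forall fun y => ENNReal.ofReal_lt_top), intervalIntegral.integral_of_le hY,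
    ← integral_Ioc_eq_integral_Ioo]
  refine setIntegral_congr_fun measurableSet_Ioc fun y hy => ?_
  have := hy.1
  simp only [smul_eq_mul]
  rw [ENNReal.toReal_ofReal (by positivity)]

lemma integrable_weightMeasure_iff {a Y : ℝ} (hY : 0 ≤ Y) {f : ℝ → ℝ} :
    Integrable f (weightMeasure a Y) ↔
      IntervalIntegrable (fun y => y ^ a * f y) volume 0 Y := by
  rw [weightMeasure, integrable_withDensity_iff_integrable_smul' (by fun_prop)
    (Eventually.of_forall fun y => ENNReal.ofReal_lt_top),
    intervalIntegrable_iff_integrableOn_Ioo_of_le hY]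
  refine integrableOn_congr_fun (fun y hy => ?_) measurableSet_Ioo
  have := hy.1
  simp only [smul_eq_mul]
  rw [ENNReal.toReal_ofReal (by positivity)]

lemma ae_weightMeasure {a Y : ℝ} {p : ℝ → Prop} (h : ∀ y ∈ Ioo 0 Y, p y) :
    ∀ᵐ y ∂(weightMeasure a Y), p y :=
  (withDensity_absolutelyContinuous _ _).ae_le
    ((ae_restrict_iff' measurableSet_Ioo).2 (Eventually.of_forall h))

lemma integrable_one_weightMeasure {a Y : ℝ} (ha : -1 < a) (hY : 0 ≤ Y) :
    Integrable (fun _ : ℝ => (1 : ℝ)) (weightMeasure a Y) := by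
  rw [integrable_weightMeasure_iff hY]
  simpa using intervalIntegral.intervalIntegrable_rpow' ha

lemma memLp_rpow_weightMeasure {a Y : ℝ} (ha : a < 1) (hY : 0 ≤ Y) :
    MemLp (fun y : ℝ => y ^ (-a)) 2 (weightMeasure a Y) := by
  have hm : AEStronglyMeasurable (fun y : ℝ => y ^ (-a)) (weightMeasure a Y) :=
    (Measurable.pow_const measurable_id _).aestronglyMeasurable
  rw [memLp_two_iff_integrable_sq hm, integrable_weightMeasure_iff hY]
  have h1 : IntervalIntegrable (fun y : ℝ => y ^ (-a)) volume 0 Y :=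
    intervalIntegral.intervalIntegrable_rpow' (by linarith)
  refine h1.congr fun y hy => ?_
  rw [uIoc_of_le hY] at hy
  have hy' : 0 < y := hy.1
  rw [← Real.rpow_natCast, ← Real.rpow_mul hy'.le, ← Real.rpow_add hy']
  congr 1
  push_cast
  ring

lemma memLp_one_weightMeasure {a Y : ℝ} (ha : -1 < a) (hY : 0 ≤ Y) :
    MemLp (fun _ : ℝ => (1 : ℝ)) 2 (weightMeasure a Y) := by
  rw [memLp_two_iff_integrable_sq aestronglyMeasurable_const]
  simpa using integrable_one_weightMeasure ha hY

/-- Functions bounded by `M (1 + y^{-α})` are square integrable for the weight `y^α`,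
`|α| < 1`. -/
lemma memLp_weightMeasure {a Y : ℝ} (ha : a ∈ Ioo (-1 : ℝ) 1) (hY : 0 ≤ Y) {f : ℝ → ℝ}
    (hf : AEStronglyMeasurable f (weightMeasure a Y)) {M : ℝ}
    (hM : ∀ y ∈ Ioo 0 Y, |f y| ≤ M * (1 + y ^ (-a))) : MemLp f 2 (weightMeasure a Y) := by
  refine (((memLp_one_weightMeasure ha.1 hY).add (memLp_rpow_weightMeasure ha.2 hY)).const_mul
    M).mono hf (ae_weightMeasure fun y hy => ?_)
  rw [Real.norm_eq_abs, Real.norm_eq_abs]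
  exact (hM y hy).trans (le_abs_self _)

/-! ### The one-dimensional extension energy -/

/-- The profile of an eigenfunction times a function `χ` of `y`. -/
def cutProfile (s mu : ℝ) (χ : ℝ → ℝ) (y : ℝ) : ℝ := profile s mu y * χ y

/-- The derivative of `cutProfile` for `y > 0`. -/
def cutProfileDeriv (s mu : ℝ) (χ : ℝ → ℝ) (y : ℝ) : ℝ :=
  -(y ^ (-(1 - 2 * s)) * flux s mu y) * χ y + profile s mu y * deriv χ y

section OneDim

variable {s mu Y : ℝ} {χ : ℝ → ℝ}

lemma norm_toLp_sq {β : Type*} [MeasurableSpace β] {ν : Measure β} {f : β → ℝ}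
    (hf : MemLp f 2 ν) : ‖hf.toLp f‖ ^ 2 = ∫ y, f y ^ 2 ∂ν := by
  rw [← real_inner_self_eq_norm_sq, L2.inner_def]
  refine integral_congr_ae ?_
  filter_upwards [hf.coeFn_toLp] with y hy
  rw [hy]
  simp [sq]

lemma hasDerivAt_cutProfile (hs : s ∈ Ioo (0 : ℝ) 1) (hmu : 0 < mu) (hχ : ContDiff ℝ 1 χ) {y : ℝ}
    (hy : 0 < y) : HasDerivAt (cutProfile s mu χ) (cutProfileDeriv s mu χ y) y :=
  (hasDerivAt_profile hs hmu hy).mul (hχ.differentiable (by simp) y).hasDerivAt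

lemma alpha_mem (hs : s ∈ Ioo (0 : ℝ) 1) : 1 - 2 * s ∈ Ioo (-1 : ℝ) 1 :=
  ⟨by linarith [hs.2], by linarith [hs.1]⟩

lemma continuous_cutProfile (hs : s ∈ Ioo (0 : ℝ) 1) (hχ : ContDiff ℝ 1 χ) :
    Continuous (cutProfile s mu χ) := (continuous_profile hs.1).mul hχ.continuous

lemma measurable_cutProfileDeriv (hs : s ∈ Ioo (0 : ℝ) 1) (hχ : ContDiff ℝ 1 χ) :
    Measurable (cutProfileDeriv s mu χ) := by
  have h1 : Measurable fun y : ℝ => y ^ (-(1 - 2 * s)) := Measurable.pow_const measurable_id _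
  have h2 : Measurable (flux s mu) := (continuous_flux hs.2).measurable
  have h3 : Measurable (profile s mu) := (continuous_profile hs.1).measurable
  have h4 : Measurable χ := hχ.continuous.measurable
  have h5 : Measurable (deriv χ) := measurable_deriv χ
  exact ((h1.mul h2).neg.mul h4).add (h3.mul h5)

lemma exists_bound_Icc {f : ℝ → ℝ} (hf : Continuous f) (Y : ℝ) :
    ∃ M, 0 ≤ M ∧ ∀ y ∈ Icc 0 Y, |f y| ≤ M := by
  obtain ⟨M, hM⟩ := (isCompact_Icc (a := (0 : ℝ)) (b := Y)).exists_bound_of_continuousOn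
    hf.continuousOn
  exact ⟨max M 0, le_max_right _ _, fun y hy => (hM y hy).trans (le_max_left _ _)⟩

lemma memLp_continuous (hs : s ∈ Ioo (0 : ℝ) 1) (hY : 0 ≤ Y) {f : ℝ → ℝ} (hf : Continuous f) :
    MemLp f 2 (weightMeasure (1 - 2 * s) Y) := by
  obtain ⟨M, hM0, hM⟩ := exists_bound_Icc hf Y
  refine memLp_weightMeasure (alpha_mem hs) hY hf.aestronglyMeasurable (M := M) fun y hy => ?_
  have hy' : 0 < y := hy.1
  have := hM y ⟨hy.1.le, hy.2.le⟩
  have h2 : 0 ≤ M * y ^ (-(1 - 2 * s)) := by positivity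
  linarith

lemma memLp_cutProfile (hs : s ∈ Ioo (0 : ℝ) 1) (hY : 0 ≤ Y) (mu : ℝ) (hχ : ContDiff ℝ 1 χ) :
    MemLp (cutProfile s mu χ) 2 (weightMeasure (1 - 2 * s) Y) :=
  memLp_continuous hs hY (continuous_cutProfile hs hχ)

lemma exists_cutProfileDeriv_bound (hs : s ∈ Ioo (0 : ℝ) 1) (mu : ℝ) (hχ : ContDiff ℝ 1 χ)
    (Y : ℝ) : ∃ M, 0 ≤ M ∧
      ∀ y ∈ Ioc 0 Y, |cutProfileDeriv s mu χ y| ≤ M * (1 + y ^ (-(1 - 2 * s))) := by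
  obtain ⟨M1, hM10, hM1⟩ := exists_bound_Icc ((continuous_flux (mu := mu) hs.2).mul hχ.continuous) Y
  obtain ⟨M2, hM20, hM2⟩ := exists_bound_Icc ((continuous_profile (mu := mu) hs.1).mul
    (hχ.continuous_deriv le_rfl)) Y
  refine ⟨M1 + M2, by positivity, fun y hy => ?_⟩
  have hy' : 0 < y := hy.1
  have h1 : |flux s mu y * χ y| ≤ M1 := hM1 y ⟨hy.1.le, hy.2⟩
  have h2 : |profile s mu y * deriv χ y| ≤ M2 := hM2 y ⟨hy.1.le, hy.2⟩
  have h3 : 0 < y ^ (-(1 - 2 * s)) := by positivity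
  calc |cutProfileDeriv s mu χ y|
      ≤ |-(y ^ (-(1 - 2 * s)) * flux s mu y) * χ y| + |profile s mu y * deriv χ y| :=
        abs_add_le _ _
    _ = y ^ (-(1 - 2 * s)) * |flux s mu y * χ y| + |profile s mu y * deriv χ y| := by
        rw [neg_mul, abs_neg, mul_assoc, abs_mul, abs_of_pos h3]
    _ ≤ y ^ (-(1 - 2 * s)) * M1 + M2 := by gcongr
    _ ≤ _ := by nlinarith

lemma memLp_cutProfileDeriv (hs : s ∈ Ioo (0 : ℝ) 1) (hY : 0 ≤ Y) (mu : ℝ)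
    (hχ : ContDiff ℝ 1 χ) :
    MemLp (cutProfileDeriv s mu χ) 2 (weightMeasure (1 - 2 * s) Y) := by
  obtain ⟨M, -, hM⟩ := exists_cutProfileDeriv_bound hs mu hχ Y
  exact memLp_weightMeasure (alpha_mem hs) hY
    (measurable_cutProfileDeriv hs hχ).aestronglyMeasurable fun y hy => hM y ⟨hy.1, hy.2.le⟩

lemma rpow_mul_neg_rpow {y a : ℝ} (hy : 0 < y) : y ^ a * y ^ (-a) = 1 := by
  rw [← Real.rpow_add hy]; simp

/-- The energy of the truncated extension of an eigenfunction: the boundary terms of an integration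
by parts, and the localization error `∫ y^α Q² χ'²`. -/
lemma cutProfile_energy (hs : s ∈ Ioo (0 : ℝ) 1) (hmu : 0 < mu) (hY : 0 ≤ Y)
    (hχ : ContDiff ℝ 1 χ) :
    mu * ‖(memLp_cutProfile hs hY mu hχ).toLp‖ ^ 2 +
        ‖(memLp_cutProfileDeriv hs hY mu hχ).toLp‖ ^ 2 =
      dConst s * mu ^ s * χ 0 ^ 2 - flux s mu Y * profile s mu Y * χ Y ^ 2 +
        ∫ y in (0)..Y, y ^ (1 - 2 * s) * (profile s mu y * deriv χ y) ^ 2 := by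
  have m1 := memLp_cutProfile hs hY mu hχ
  have m2 := memLp_cutProfileDeriv hs hY mu hχ
  have m3 : MemLp (fun y => profile s mu y * deriv χ y) 2 (weightMeasure (1 - 2 * s) Y) :=
    memLp_continuous hs hY ((continuous_profile hs.1).mul (hχ.continuous_deriv le_rfl))
  have i1 := (integrable_weightMeasure_iff hY).1 m1.integrable_sq
  have i2 := (integrable_weightMeasure_iff hY).1 m2.integrable_sq
  have i3 := (integrable_weightMeasure_iff hY).1 m3.integrable_sq
  rw [norm_toLp_sq, norm_toLp_sq, integral_weightMeasure hY, integral_weightMeasure hY]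
  have hF := intervalIntegral.integral_eq_sub_of_hasDerivAt_of_le hY
    (f := fun y => flux s mu y * profile s mu y * χ y ^ 2)
    (f' := fun y => y ^ (1 - 2 * s) * (profile s mu y * deriv χ y) ^ 2 -
      (mu * (y ^ (1 - 2 * s) * cutProfile s mu χ y ^ 2) +
        y ^ (1 - 2 * s) * cutProfileDeriv s mu χ y ^ 2))
    (((continuous_flux hs.2).mul (continuous_profile hs.1)).mul
      (hχ.continuous.pow 2)).continuousOn ?_ (i3.sub ((i1.const_mul mu).add i2))
  · rw [intervalIntegral.integral_sub i3 ((i1.const_mul mu).add i2),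
      intervalIntegral.integral_add (i1.const_mul mu) i2, intervalIntegral.integral_const_mul,
      flux_zero hs.2, profile_zero hs.1] at hF
    linarith
  · intro y hy
    have hd := ((hasDerivAt_flux hs hmu hy.1).mul (hasDerivAt_profile hs hmu hy.1)).mul
      ((hχ.differentiable (by simp) y).hasDerivAt.pow 2)
    refine hd.congr_deriv ?_
    simp only [cutProfile, cutProfileDeriv, Pi.mul_apply, Pi.pow_apply]
    have e := rpow_mul_neg_rpow (a := 1 - 2 * s) hy.1
    generalize y ^ (1 - 2 * s) = A at *
    generalize y ^ (-(1 - 2 * s)) = B at *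
    push_cast
    linear_combination (B * flux s mu y ^ 2 * χ y ^ 2 -
      2 * flux s mu y * profile s mu y * χ y * deriv χ y) * e

/-- The identity `∫ y^α (mu Q v + Q' v') dy = d_s mu^s v(0)` for `v(Y) = 0`. -/
lemma profile_integral_eq (hs : s ∈ Ioo (0 : ℝ) 1) (hmu : 0 < mu) (hY : 0 ≤ Y) {v : ℝ → ℝ}
    (hv : ContDiff ℝ 1 v) (hvY : v Y = 0) :
    mu * (∫ y, cutProfile s mu (fun _ => 1) y * v y ∂(weightMeasure (1 - 2 * s) Y)) +
      ∫ y, cutProfileDeriv s mu (fun _ => 1) y * deriv v y ∂(weightMeasure (1 - 2 * s) Y) =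
      dConst s * mu ^ s * v 0 := by
  have hχ : ContDiff ℝ 1 fun _ : ℝ => (1 : ℝ) := contDiff_const
  have i1 := (integrable_weightMeasure_iff hY).1
    ((memLp_cutProfile hs hY mu hχ).integrable_mul (memLp_continuous hs hY hv.continuous))
  have i2 := (integrable_weightMeasure_iff hY).1
    ((memLp_cutProfileDeriv hs hY mu hχ).integrable_mul
      (memLp_continuous hs hY (hv.continuous_deriv le_rfl)))
  rw [integral_weightMeasure hY, integral_weightMeasure hY]
  simp only [Pi.mul_apply] at i1 i2
  have hF := intervalIntegral.integral_eq_sub_of_hasDerivAt_of_le hY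
    (f := fun y => flux s mu y * v y)
    (f' := fun y => -(mu * (y ^ (1 - 2 * s) * (cutProfile s mu (fun _ => 1) y * v y)) +
      y ^ (1 - 2 * s) * (cutProfileDeriv s mu (fun _ => 1) y * deriv v y)))
    ((continuous_flux hs.2).mul hv.continuous).continuousOn ?_ ((i1.const_mul mu).add i2).neg
  · rw [intervalIntegral.integral_neg, intervalIntegral.integral_add (i1.const_mul mu) i2,
      intervalIntegral.integral_const_mul, flux_zero hs.2, hvY] at hF
    linarith
  · intro y hy
    have hd := (hasDerivAt_flux hs hmu hy.1).mul (hv.differentiable (by simp) y).hasDerivAt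
    refine hd.congr_deriv ?_
    simp only [cutProfile, cutProfileDeriv, deriv_const]
    have e := rpow_mul_neg_rpow (a := 1 - 2 * s) hy.1
    generalize y ^ (1 - 2 * s) = A at *
    generalize y ^ (-(1 - 2 * s)) = B at *
    linear_combination (-flux s mu y * deriv v y) * e

end OneDim

/-! ### The trace inequality on the truncated cylinder -/

section Trace

variable {d : ℕ} {Ω : Set (E d)} {s Y : ℝ}

lemma HL1_induction {a : ℝ} {P : CylSpace Ω a Y → Prop} (hP : IsClosed {W | P W})
    (h : ∀ W ∈ smoothCyl Ω a Y, P W) : ∀ W ∈ HL1 Ω a Y, P W := fun _ hW =>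
  closure_minimal (s := smoothCyl Ω a Y) (fun W hW => h W hW) hP hW

/-- The section at height `y` of a smooth function on the cylinder is a test function on `Ω`. -/
lemma section_mem_H10 {η : E d × ℝ → ℝ} (h1 : ContDiff ℝ (⊤ : ℕ∞) η) (h2 : HasCompactSupport η)
    (h3 : tsupport η ⊆ Ω ×ˢ Iio Y) (y : ℝ) :
    ∃ q ∈ H10 Ω, q.1 =ᵐ[volume.restrict Ω] (fun x => η (x, y)) ∧
      q.2 =ᵐ[volume.restrict Ω] gradient fun x => η (x, y) := by
  have c1 : ContDiff ℝ (⊤ : ℕ∞) fun x => η (x, y) := h1.comp (by fun_prop)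
  have hsub : tsupport (fun x => η (x, y)) ⊆ (fun x => (x, y)) ⁻¹' tsupport η :=
    tsupport_comp_subset_preimage η (by fun_prop)
  have c2 : HasCompactSupport fun x => η (x, y) := by
    refine HasCompactSupport.of_support_subset_isCompact (h2.isCompact.image continuous_fst) ?_
    intro x hx
    exact ⟨(x, y), hsub (subset_tsupport _ hx), rfl⟩
  have c3 : tsupport (fun x => η (x, y)) ⊆ Ω := fun x hx => (h3 (hsub hx)).1
  have hgc : Continuous (gradient fun x => η (x, y)) :=
    (InnerProductSpace.toDual ℝ (E d)).symm.continuous.comp (c1.continuous_fderiv (by simp))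
  have hgs : HasCompactSupport (gradient fun x => η (x, y)) := by
    refine c2.mono' fun x hx => ?_
    by_contra hc
    exact hx (gradient_eq_zero_of_notMem_tsupport hc)
  have m1 : MemLp (fun x => η (x, y)) 2 (volume.restrict Ω) :=
    c1.continuous.memLp_of_hasCompactSupport c2
  have m2 : MemLp (gradient fun x => η (x, y)) 2 (volume.restrict Ω) :=
    hgc.memLp_of_hasCompactSupport hgs
  exact ⟨(m1.toLp _, m2.toLp _), Submodule.le_topologicalClosure _
    ⟨_, c1, c2, c3, m1.coeFn_toLp, m2.coeFn_toLp⟩, m1.coeFn_toLp, m2.coeFn_toLp⟩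

/-- The weak form of the eigenvalue equation on the cylinder. -/
lemma inner_tensor_gradX {a mu : ℝ} {φ : L2 Ω} {G : L2Vec Ω}
    (hG : ∀ q ∈ H10 Ω, inner ℝ G q.2 = mu * inner ℝ φ q.1) {q : ℝ → ℝ}
    (hq : MemLp q 2 (weightMeasure a Y)) {W : CylSpace Ω a Y} (hW : W ∈ HL1 Ω a Y) :
    inner ℝ (tensor (cylMeasure_eq_prod Ω a Y) (hq.toLp q) G) (cylGradX W) =
      mu * inner ℝ (tensor (cylMeasure_eq_prod Ω a Y) (hq.toLp q) φ) W.1 := by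
  refine HL1_induction (P := fun W => inner ℝ (tensor (cylMeasure_eq_prod Ω a Y) (hq.toLp q) G)
    (cylGradX W) = mu * inner ℝ (tensor (cylMeasure_eq_prod Ω a Y) (hq.toLp q) φ) W.1)
    (isClosed_eq ?_ ?_) ?_ W hW
  · unfold cylGradX; fun_prop
  · fun_prop
  rintro W ⟨η, h1, h2, h3, h4, h5, -, -⟩
  rw [inner_tensor_eq_integral_left _ hq G h5, inner_tensor_eq_integral_left _ hq φ h4,
    ← integral_const_mul]
  refine integral_congr_ae (Eventually.of_forall fun y => ?_)
  obtain ⟨p, hp, e1, e2⟩ := section_mem_H10 h1 h2 h3 y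
  have h := hG p hp
  rw [L2.inner_def, L2.inner_def] at h
  have f1 : ∫ x in Ω, inner ℝ (G x) (gradient (fun x => η (x, y)) x) =
      ∫ x in Ω, inner ℝ (G x) (p.2 x) :=
    integral_congr_ae (e2.mono fun x hx => by simp only [hx])
  have f2 : ∫ x in Ω, inner ℝ (φ x) (η (x, y)) = ∫ x in Ω, inner ℝ (φ x) (p.1 x) :=
    integral_congr_ae (e1.mono fun x hx => by simp only [hx])
  simp only
  rw [f1, f2, h]
  ring

/-- The profile of an eigenvalue, as an element of `L²(y^α)`. -/
def profileLp (hs : s ∈ Ioo (0 : ℝ) 1) (hY : 0 ≤ Y) (mu : ℝ) {χ : ℝ → ℝ} (hχ : ContDiff ℝ 1 χ) :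
    Lp ℝ 2 (weightMeasure (1 - 2 * s) Y) := (memLp_cutProfile hs hY mu hχ).toLp _

/-- The derivative of the profile, as an element of `L²(y^α)`. -/
def profileDerivLp (hs : s ∈ Ioo (0 : ℝ) 1) (hY : 0 ≤ Y) (mu : ℝ) {χ : ℝ → ℝ}
    (hχ : ContDiff ℝ 1 χ) : Lp ℝ 2 (weightMeasure (1 - 2 * s) Y) :=
  (memLp_cutProfileDeriv hs hY mu hχ).toLp _

lemma contDiff_one_const : ContDiff ℝ 1 fun _ : ℝ => (1 : ℝ) := contDiff_const

/-- Fubini and an integration by parts in `y`. -/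
lemma inner_tensor_derivY (hs : s ∈ Ioo (0 : ℝ) 1) (hY : 0 ≤ Y) {mu : ℝ} (hmu : 0 < mu)
    (φ : L2 Ω) {W : CylSpace Ω (1 - 2 * s) Y} (hW : W ∈ HL1 Ω (1 - 2 * s) Y) :
    mu * inner ℝ (tensor (cylMeasure_eq_prod Ω _ Y) (profileLp hs hY mu contDiff_one_const) φ) W.1
      + inner ℝ (tensor (cylMeasure_eq_prod Ω _ Y) (profileDerivLp hs hY mu contDiff_one_const) φ)
        (cylDerivY W) = dConst s * mu ^ s * inner ℝ φ (tr W) := by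
  refine HL1_induction (P := fun W => mu * inner ℝ (tensor (cylMeasure_eq_prod Ω _ Y)
      (profileLp hs hY mu contDiff_one_const) φ) W.1
      + inner ℝ (tensor (cylMeasure_eq_prod Ω _ Y) (profileDerivLp hs hY mu contDiff_one_const) φ)
        (cylDerivY W) = dConst s * mu ^ s * inner ℝ φ (tr W))
    (isClosed_eq ?_ ?_) ?_ W hW
  · unfold cylDerivY; fun_prop
  · unfold tr; fun_prop
  rintro W ⟨η, h1, h2, h3, h4, -, h6, h7⟩
  obtain ⟨i1, e1⟩ := inner_tensor_eq_integral_right (cylMeasure_eq_prod Ω (1 - 2 * s) Y)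
    (memLp_cutProfile hs hY mu contDiff_one_const) φ h4
  obtain ⟨i2, e2⟩ := inner_tensor_eq_integral_right (cylMeasure_eq_prod Ω (1 - 2 * s) Y)
    (memLp_cutProfileDeriv hs hY mu contDiff_one_const) φ h6
  rw [profileLp, profileDerivLp, e1, e2, ← integral_const_mul,
    ← integral_add (i1.const_mul mu) i2, L2.inner_def, ← integral_const_mul]
  refine integral_congr_ae ?_
  filter_upwards [h7] with x hx
  have hv : ContDiff ℝ 1 fun y => η (x, y) := (h1.of_le (by simp)).comp (by fun_prop)
  have hvY : η (x, Y) = 0 := image_eq_zero_of_notMem_tsupport fun hc => lt_irrefl Y (h3 hc).2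
  have := profile_integral_eq hs hmu hY hv hvY
  rw [hx]
  simp only [RCLike.inner_apply, conj_trivial]
  linear_combination φ x * this

/-- Traces of functions on the truncated cylinder belong to `ℍ^s(Ω)`, and
`⟨(-Δ)^s tr W, tr W⟩ ≤ a_Y(W, W)`: test `W` with the harmonic extension of the trace to the infinite
cylinder. -/
lemma trace_energy_le {c : ℝ} (hc : IsEigenvalueBound Ω c) (hs : s ∈ Ioo (0 : ℝ) 1) (hY : 0 ≤ Y)
    {W : CylSpace Ω (1 - 2 * s) Y} (hW : W ∈ HL1 Ω (1 - 2 * s) Y) :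
    tr W ∈ hSpace Ω s ∧ fracPairing Ω s (tr W) (tr W) ≤ aY s W W := by
  refine mem_hSpace_of_sum_le hc fun F => ?_
  have hd := dConst_pos hs
  set w := tr W with hw
  choose G hG using fun mu : ℝ => exists_gradient (spectralProj_mem Ω mu w)
  let q := fun mu => profileLp (s := s) (Y := Y) hs hY mu contDiff_one_const
  let r := fun mu => profileDerivLp (s := s) (Y := Y) hs hY mu contDiff_one_const
  let x1 := fun mu => tensor (cylMeasure_eq_prod Ω (1 - 2 * s) Y) (q mu) (G mu)
  let x2 := fun mu => tensor (cylMeasure_eq_prod Ω (1 - 2 * s) Y) (r mu) (spectralProj Ω mu w)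
  have hGG : ∀ mu nu, inner ℝ (G mu) (G nu) =
      mu * inner ℝ (spectralProj Ω mu w) (spectralProj Ω nu w) := fun mu nu =>
    (hG mu).2 _ (hG nu).1
  have o1 : Pairwise fun i j => inner ℝ (x1 i) (x1 j) = 0 := fun i j hij => by
    simp only [x1]
    rw [inner_tensor_tensor, hGG, inner_spectralProj_of_ne hij]
    ring
  have o2 : Pairwise fun i j => inner ℝ (x2 i) (x2 j) = 0 := fun i j hij => by
    simp only [x2]
    rw [inner_tensor_tensor, inner_spectralProj_of_ne hij, mul_zero]
  set S := ∑ mu ∈ F, mu ^ s * ‖spectralProj Ω mu w‖ ^ 2 with hS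
  have n12 : ‖∑ mu ∈ F, x1 mu‖ ^ 2 + ‖∑ mu ∈ F, x2 mu‖ ^ 2 ≤ dConst s * S := by
    rw [norm_sq_sum_of_pairwise_orthogonal o1, norm_sq_sum_of_pairwise_orthogonal o2,
      ← Finset.sum_add_distrib, hS, Finset.mul_sum]
    refine Finset.sum_le_sum fun mu _ => ?_
    simp only [x1, x2]
    rw [norm_tensor, norm_tensor, mul_pow, mul_pow, ← real_inner_self_eq_norm_sq (G mu), hGG,
      real_inner_self_eq_norm_sq]
    rcases hc.spectralProj_eq_zero_or_le mu w with h | h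
    · simp [h]
    · have hmu := hc.1.trans_le h
      have he : mu * ‖q mu‖ ^ 2 + ‖r mu‖ ^ 2 = _ := cutProfile_energy hs hmu hY contDiff_one_const
      simp only [deriv_const, mul_zero, zero_pow two_ne_zero, intervalIntegral.integral_zero,
        one_pow, mul_one, add_zero] at he
      have hp : 0 < flux s mu Y * profile s mu Y := mul_pos (flux_pos hs hmu Y) (profile_pos hs.1 Y)
      have : mu * ‖q mu‖ ^ 2 + ‖r mu‖ ^ 2 ≤ dConst s * mu ^ s := by linarith
      nlinarith [mul_le_mul_of_nonneg_right this (sq_nonneg ‖spectralProj Ω mu w‖)]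
  have hin : inner ℝ (∑ mu ∈ F, x1 mu) (cylGradX W) + inner ℝ (∑ mu ∈ F, x2 mu) (cylDerivY W) =
      dConst s * S := by
    rw [sum_inner, sum_inner, ← Finset.sum_add_distrib, hS, Finset.mul_sum]
    refine Finset.sum_congr rfl fun mu _ => ?_
    rcases hc.spectralProj_eq_zero_or_le mu w with h | h
    · have h1 : G mu = 0 := by
        have := hGG mu mu
        rw [h, real_inner_self_eq_norm_sq] at this
        simpa using this
      have e1 : x1 mu = 0 := by
        rw [← norm_eq_zero]; simp only [x1]; rw [norm_tensor, h1, norm_zero, mul_zero]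
      have e2 : x2 mu = 0 := by
        rw [← norm_eq_zero]; simp only [x2]; rw [norm_tensor, h, norm_zero, mul_zero]
      rw [e1, e2, h]
      simp
    · have hmu := hc.1.trans_le h
      have e1 : inner ℝ (x1 mu) (cylGradX W) = _ :=
        inner_tensor_gradX (hG mu).2 (memLp_cutProfile hs hY mu contDiff_one_const) hW
      have e2 := inner_tensor_derivY hs hY hmu (spectralProj Ω mu w) hW
      rw [e1]
      refine e2.trans ?_
      rw [← hw, inner_spectralProj_self, real_inner_self_eq_norm_sq, mul_assoc]
  have hsq : 2 * (dConst s * S) ≤ dConst s * S + (‖cylGradX W‖ ^ 2 + ‖cylDerivY W‖ ^ 2) := by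
    have a1 := norm_sub_sq_real (∑ mu ∈ F, x1 mu) (cylGradX W)
    have a2 := norm_sub_sq_real (∑ mu ∈ F, x2 mu) (cylDerivY W)
    nlinarith [sq_nonneg ‖∑ mu ∈ F, x1 mu - cylGradX W‖,
      sq_nonneg ‖∑ mu ∈ F, x2 mu - cylDerivY W‖]
  rw [aY, real_inner_self_eq_norm_sq, real_inner_self_eq_norm_sq, one_div, le_inv_mul_iff₀ hd]
  linarith

end Trace

/-! ### Separated functions on the truncated cylinder -/

section Cylinder

variable {d : ℕ} {Ω : Set (E d)} {a s Y : ℝ}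

lemma gradient_section_add {η θ : E d × ℝ → ℝ} (h1 : ContDiff ℝ (⊤ : ℕ∞) η)
    (k1 : ContDiff ℝ (⊤ : ℕ∞) θ) (p : E d × ℝ) :
    gradient (fun x => (η + θ) (x, p.2)) p.1 =
      gradient (fun x => η (x, p.2)) p.1 + gradient (fun x => θ (x, p.2)) p.1 := by
  have e1 : DifferentiableAt ℝ (fun x => η (x, p.2)) p.1 :=
    ((h1.comp (by fun_prop : ContDiff ℝ (⊤ : ℕ∞) fun x : E d => (x, p.2))).differentiable
      (by simp)) _
  have e2 : DifferentiableAt ℝ (fun x => θ (x, p.2)) p.1 :=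
    ((k1.comp (by fun_prop : ContDiff ℝ (⊤ : ℕ∞) fun x : E d => (x, p.2))).differentiable
      (by simp)) _
  rw [gradient, gradient, gradient, ← map_add, ← fderiv_add e1 e2]
  rfl

lemma deriv_section_add {η θ : E d × ℝ → ℝ} (h1 : ContDiff ℝ (⊤ : ℕ∞) η)
    (k1 : ContDiff ℝ (⊤ : ℕ∞) θ) (p : E d × ℝ) :
    deriv (fun y => (η + θ) (p.1, y)) p.2 =
      deriv (fun y => η (p.1, y)) p.2 + deriv (fun y => θ (p.1, y)) p.2 := by
  have e1 : DifferentiableAt ℝ (fun y => η (p.1, y)) p.2 :=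
    ((h1.comp (by fun_prop : ContDiff ℝ (⊤ : ℕ∞) fun y : ℝ => (p.1, y))).differentiable
      (by simp)) _
  have e2 : DifferentiableAt ℝ (fun y => θ (p.1, y)) p.2 :=
    ((k1.comp (by fun_prop : ContDiff ℝ (⊤ : ℕ∞) fun y : ℝ => (p.1, y))).differentiable
      (by simp)) _
  rw [← deriv_add e1 e2]
  rfl

lemma gradient_section_smul {η : E d × ℝ → ℝ} (h1 : ContDiff ℝ (⊤ : ℕ∞) η) (c : ℝ)
    (p : E d × ℝ) : gradient (fun x => (c • η) (x, p.2)) p.1 =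
      c • gradient (fun x => η (x, p.2)) p.1 := by
  have e1 : DifferentiableAt ℝ (fun x => η (x, p.2)) p.1 :=
    ((h1.comp (by fun_prop : ContDiff ℝ (⊤ : ℕ∞) fun x : E d => (x, p.2))).differentiable
      (by simp)) _
  have := fderiv_const_smul e1 c
  rw [gradient, gradient, ← map_smul, ← this]
  rfl

/-- `smoothCyl` as a subspace. -/
def smoothCylSubmodule (Ω : Set (E d)) (a Y : ℝ) : Submodule ℝ (CylSpace Ω a Y) where
  carrier := smoothCyl Ω a Y
  zero_mem' := by
    refine ⟨fun _ => 0, contDiff_const, HasCompactSupport.zero, ?_, Lp.coeFn_zero .., ?_, ?_,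
      Lp.coeFn_zero ..⟩
    · rw [show (fun _ : E d × ℝ => (0 : ℝ)) = 0 from rfl, tsupport_zero]
      exact empty_subset _
    · refine (Lp.coeFn_zero ..).trans (Eventually.of_forall fun x => ?_)
      simp
    · refine (Lp.coeFn_zero ..).trans (Eventually.of_forall fun x => ?_)
      simp
  add_mem' := by
    rintro V W ⟨η, h1, h2, h3, h4, h5, h6, h7⟩ ⟨θ, k1, k2, k3, k4, k5, k6, k7⟩
    refine ⟨η + θ, h1.add k1, h2.add k2, (tsupport_add η θ).trans (union_subset h3 k3),
      (Lp.coeFn_add V.1 W.1).trans (h4.add k4), ?_, ?_, (Lp.coeFn_add (tr V) (tr W)).trans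
      (h7.add k7)⟩
    · refine (Lp.coeFn_add (cylGradX V) (cylGradX W)).trans ((h5.add k5).trans
        (Eventually.of_forall fun p => ?_))
      exact (gradient_section_add h1 k1 p).symm
    · refine (Lp.coeFn_add (cylDerivY V) (cylDerivY W)).trans ((h6.add k6).trans
        (Eventually.of_forall fun p => ?_))
      exact (deriv_section_add h1 k1 p).symm
  smul_mem' := by
    rintro c W ⟨η, h1, h2, h3, h4, h5, h6, h7⟩
    refine ⟨c • η, h1.const_smul c, h2.mono (Function.support_const_smul_subset c η),
      (closure_mono (Function.support_const_smul_subset c η)).trans h3,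
      (Lp.coeFn_smul c W.1).trans (h4.const_smul c), ?_, ?_,
      (Lp.coeFn_smul c (tr W)).trans (h7.const_smul c)⟩
    · refine (Lp.coeFn_smul c (cylGradX W)).trans ((h5.const_smul c).trans
        (Eventually.of_forall fun p => ?_))
      exact (gradient_section_smul h1 c p).symm
    · refine (Lp.coeFn_smul c (cylDerivY W)).trans ((h6.const_smul c).trans
        (Eventually.of_forall fun p => ?_))
      exact (deriv_const_smul_field c (fun y => η (p.1, y))).symm

/-- `HL1` as a closed subspace. -/
def HL1Submodule (Ω : Set (E d)) (a Y : ℝ) : Submodule ℝ (CylSpace Ω a Y) :=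
  (smoothCylSubmodule Ω a Y).topologicalClosure

lemma mem_HL1_iff {W : CylSpace Ω a Y} : W ∈ HL1 Ω a Y ↔ W ∈ HL1Submodule Ω a Y := Iff.rfl

lemma isClosed_HL1 : IsClosed (HL1 Ω a Y) := isClosed_closure

/-- The quadruple of the function `(x, y) ↦ q(y) φ(x)` with gradient `(q ∇φ, q' φ)`. -/
def separated (Ω : Set (E d)) (q q' : Lp ℝ 2 (weightMeasure a Y)) (t : ℝ)
    (p : L2 Ω × L2Vec Ω) : CylSpace Ω a Y :=
  (tensor (cylMeasure_eq_prod Ω a Y) q p.1, tensor (cylMeasure_eq_prod Ω a Y) q p.2,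
    tensor (cylMeasure_eq_prod Ω a Y) q' p.1, t • p.1)

lemma continuous_separated (q q' : Lp ℝ 2 (weightMeasure a Y)) (t : ℝ) :
    Continuous (separated Ω q q' t) := by
  have h1 := continuous_tensor_right (F := ℝ) (cylMeasure_eq_prod Ω a Y) q
  have h2 := continuous_tensor_right (F := E d) (cylMeasure_eq_prod Ω a Y) q
  have h3 := continuous_tensor_right (F := ℝ) (cylMeasure_eq_prod Ω a Y) q'
  exact (h1.comp continuous_fst).prodMk ((h2.comp continuous_snd).prodMk
    ((h3.comp continuous_fst).prodMk (continuous_fst.const_smul t)))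

lemma separated_mem_of_smooth {θ : ℝ → ℝ} (hθ : ContDiff ℝ (⊤ : ℕ∞) θ)
    (hθs : HasCompactSupport θ) (hθY : tsupport θ ⊆ Iio Y) (m0 : MemLp θ 2 (weightMeasure a Y))
    (m1 : MemLp (deriv θ) 2 (weightMeasure a Y)) {p : L2 Ω × L2Vec Ω} (hp : p ∈ H10 Ω) :
    separated Ω (m0.toLp θ) (m1.toLp (deriv θ)) (θ 0) p ∈ HL1 Ω a Y := by
  refine H10_induction (P := fun p => separated Ω (m0.toLp θ) (m1.toLp (deriv θ)) (θ 0) p ∈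
    HL1 Ω a Y) (isClosed_HL1.preimage (continuous_separated _ _ _)) ?_ p hp
  rintro p ⟨η, h1, h2, h3, h4, h5⟩
  refine subset_closure ⟨fun z => θ z.2 * η z.1, ?_, ?_, ?_, ?_, ?_, ?_, ?_⟩
  · exact (hθ.comp contDiff_snd).mul (h1.comp contDiff_fst)
  · refine HasCompactSupport.of_support_subset_isCompact (h2.isCompact.prod hθs.isCompact) ?_
    intro z hz
    exact ⟨subset_tsupport _ (right_ne_zero_of_mul hz), subset_tsupport _ (left_ne_zero_of_mul hz)⟩
  · refine (closure_minimal ?_ ((isClosed_tsupport η).prod (isClosed_tsupport θ))).trans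
      (prod_mono h3 hθY)
    intro z hz
    exact ⟨subset_tsupport _ (right_ne_zero_of_mul hz), subset_tsupport _ (left_ne_zero_of_mul hz)⟩
  · exact coeFn_tensor_toLp (cylMeasure_eq_prod Ω a Y) m0 h4
  · refine (coeFn_tensor_toLp (cylMeasure_eq_prod Ω a Y) m0 h5).trans
      (Eventually.of_forall fun z => ?_)
    have e1 : DifferentiableAt ℝ η z.1 := (h1.differentiable (by simp)) _
    have := fderiv_const_smul e1 (θ z.2)
    change θ z.2 • gradient η z.1 = gradient (θ z.2 • η) z.1
    rw [gradient, gradient, this, map_smul]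
  · refine (coeFn_tensor_toLp (cylMeasure_eq_prod Ω a Y) m1 h4).trans
      (Eventually.of_forall fun z => ?_)
    exact (deriv_mul_const_field (η z.1)).symm
  · exact (Lp.coeFn_smul (θ 0) p.1).trans (h4.const_smul (θ 0))

lemma tendsto_toLp_of_dominated {β : Type*} [MeasurableSpace β] {ν : Measure β} {f : ℕ → β → ℝ}
    {g b : β → ℝ} (hf : ∀ n, MemLp (f n) 2 ν) (hg : MemLp g 2 ν) (hb : MemLp b 2 ν)
    (hfb : ∀ n, ∀ᵐ y ∂ν, |f n y| ≤ b y) (hgb : ∀ᵐ y ∂ν, |g y| ≤ b y)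
    (hlim : ∀ᵐ y ∂ν, Tendsto (fun n => f n y) atTop (𝓝 (g y))) :
    Tendsto (fun n => (hf n).toLp (f n)) atTop (𝓝 (hg.toLp g)) := by
  rw [tendsto_iff_norm_sub_tendsto_zero]
  have h1 : ∀ n, ‖(hf n).toLp (f n) - hg.toLp g‖ = √(∫ y, (f n y - g y) ^ 2 ∂ν) := fun n => by
    rw [← MemLp.toLp_sub, ← Real.sqrt_sq (norm_nonneg _), norm_toLp_sq]
    rfl
  simp_rw [h1]
  have h2 : Tendsto (fun n => ∫ y, (f n y - g y) ^ 2 ∂ν) atTop (𝓝 (∫ _, (0 : ℝ) ∂ν)) := by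
    refine tendsto_integral_of_dominated_convergence (fun y => 4 * b y ^ 2)
      (fun n => (((hf n).sub hg).aestronglyMeasurable.pow 2)) (hb.integrable_sq.const_mul 4) ?_ ?_
    · intro n
      filter_upwards [hfb n, hgb] with y h3 h4
      rw [Real.norm_of_nonneg (sq_nonneg _)]
      rw [abs_le] at h3 h4
      nlinarith
    · filter_upwards [hlim] with y hy
      simpa using (hy.sub_const (g y)).pow 2
  rw [integral_zero] at h2
  simpa using h2.sqrt

lemma contDiffOn_profile_flux {mu : ℝ} (hs : s ∈ Ioo (0 : ℝ) 1) (hmu : 0 < mu) (n : ℕ) :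
    ContDiffOn ℝ n (profile s mu) (Ioi 0) ∧ ContDiffOn ℝ n (flux s mu) (Ioi 0) := by
  induction n with
  | zero => exact ⟨contDiffOn_zero.2 (continuous_profile hs.1).continuousOn,
      contDiffOn_zero.2 (continuous_flux hs.2).continuousOn⟩
  | succ n ih =>
    have hr : ∀ r : ℝ, ContDiffOn ℝ n (fun y : ℝ => y ^ r) (Ioi 0) := fun r y hy =>
      (Real.contDiffAt_rpow_const_of_ne (ne_of_gt hy)).contDiffWithinAt
    push_cast
    constructor
    · refine (contDiffOn_succ_iff_deriv_of_isOpen isOpen_Ioi).2 ⟨fun y hy =>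
        (hasDerivAt_profile hs hmu hy).differentiableAt.differentiableWithinAt, by simp, ?_⟩
      exact ((hr _).mul ih.2).neg.congr fun y hy => (hasDerivAt_profile hs hmu hy).deriv
    · refine (contDiffOn_succ_iff_deriv_of_isOpen isOpen_Ioi).2 ⟨fun y hy =>
        (hasDerivAt_flux hs hmu hy).differentiableAt.differentiableWithinAt, by simp, ?_⟩
      exact ((contDiffOn_const.mul (hr _)).mul ih.1).neg.congr fun y hy =>
        (hasDerivAt_flux hs hmu hy).deriv

lemma contDiffOn_cutProfile {mu : ℝ} {χ : ℝ → ℝ} (hs : s ∈ Ioo (0 : ℝ) 1) (hmu : 0 < mu)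
    (hχ : ContDiff ℝ (⊤ : ℕ∞) χ) : ContDiffOn ℝ (⊤ : ℕ∞) (cutProfile s mu χ) (Ioi 0) :=
  (contDiffOn_infty.2 fun n => (contDiffOn_profile_flux hs hmu n).1).mul hχ.contDiffOn

/-- A separated function with an eigenprofile belongs to `HL1`: the profile, singular at `y = 0`,
is approximated by its composition with `y ↦ √(y² + δ²)`. -/
lemma separated_profile_mem (hs : s ∈ Ioo (0 : ℝ) 1) (hY : 0 ≤ Y) {mu : ℝ} (hmu : 0 < mu)
    {χ : ℝ → ℝ} (hχ : ContDiff ℝ (⊤ : ℕ∞) χ) (hχ1 : ContDiff ℝ 1 χ) {Y' : ℝ} (hY' : Y' < Y)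
    (hY0 : 0 ≤ Y') (hχY : ∀ y, Y' ≤ y → χ y = 0) {p : L2 Ω × L2Vec Ω} (hp : p ∈ H10 Ω) :
    separated Ω (profileLp hs hY mu hχ1) (profileDerivLp hs hY mu hχ1) (χ 0) p ∈
      HL1 Ω (1 - 2 * s) Y := by
  set h := cutProfile s mu χ with hh
  let δ : ℕ → ℝ := fun n => 1 / ((n : ℝ) + 1)
  have hδ : ∀ n, 0 < δ n := fun n => by positivity
  have hδ1 : ∀ n, δ n ≤ 1 := fun n => by
    have : (0 : ℝ) ≤ n := by positivity
    exact (div_le_one (by positivity)).2 (by linarith)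
  have hδ0 : Tendsto δ atTop (𝓝 0) := tendsto_one_div_add_atTop_nhds_zero_nat
  let ζ : ℕ → ℝ → ℝ := fun n y => √(y ^ 2 + δ n ^ 2)
  have hζ : ∀ n y, 0 < ζ n y := fun n y => Real.sqrt_pos.2 (by have := hδ n; positivity)
  have hζsq : ∀ n y, ζ n y ^ 2 = y ^ 2 + δ n ^ 2 := fun n y => Real.sq_sqrt (by positivity)
  have hζy : ∀ n y, |y| ≤ ζ n y := fun n y =>
    Real.abs_le_sqrt (by have := sq_nonneg (δ n); linarith)
  have hζs : ∀ n, ContDiff ℝ (⊤ : ℕ∞) (ζ n) := fun n =>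
    ContDiff.sqrt (by fun_prop) fun y => by have := hδ n; positivity
  have hζd : ∀ n y, HasDerivAt (ζ n) (y / ζ n y) y := fun n y => by
    have h1 : HasDerivAt (fun y : ℝ => y ^ 2 + δ n ^ 2) (2 * y) y := by
      simpa using (hasDerivAt_pow 2 y).add_const (δ n ^ 2)
    refine (h1.sqrt (by have := hδ n; positivity)).congr_deriv ?_
    have := (hζ n y).ne'
    change 2 * y / (2 * ζ n y) = y / ζ n y
    field_simp
  let θ : ℕ → ℝ → ℝ := fun n y => h (ζ n y)
  have hθ : ∀ n, ContDiff ℝ (⊤ : ℕ∞) (θ n) := fun n =>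
    (contDiffOn_cutProfile hs hmu hχ).comp_contDiff (hζs n) (hζ n)
  have hθd : ∀ n y, deriv (θ n) y = cutProfileDeriv s mu χ (ζ n y) * (y / ζ n y) := fun n y =>
    ((hasDerivAt_cutProfile hs hmu hχ1 (hζ n y)).comp y (hζd n y)).deriv
  have hsub : ∀ n, Function.support (θ n) ⊆ Icc (-Y') Y' := fun n y hy => by
    rw [mem_Icc, ← abs_le]
    by_contra hc
    refine hy ?_
    simp only [θ, hh, cutProfile]
    rw [hχY _ ((not_le.1 hc).le.trans (hζy n y)), mul_zero]
  have hθs : ∀ n, HasCompactSupport (θ n) := fun n =>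
    HasCompactSupport.of_support_subset_isCompact isCompact_Icc (hsub n)
  have hθY : ∀ n, tsupport (θ n) ⊆ Iio Y := fun n =>
    (closure_minimal (hsub n) isClosed_Icc).trans fun y hy => hy.2.trans_lt hY'
  have m0 : ∀ n, MemLp (θ n) 2 (weightMeasure (1 - 2 * s) Y) := fun n =>
    memLp_continuous hs hY (hθ n).continuous
  have m1 : ∀ n, MemLp (deriv (θ n)) 2 (weightMeasure (1 - 2 * s) Y) := fun n =>
    memLp_continuous hs hY ((hθ n).continuous_deriv (by simp))
  have hmem := fun n => separated_mem_of_smooth (hθ n) (hθs n) (hθY n) (m0 n) (m1 n) hp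
  have hhc : Continuous h := continuous_cutProfile hs hχ1
  have hζlim : ∀ y, 0 ≤ y → Tendsto (fun n => ζ n y) atTop (𝓝 y) := fun y hy => by
    have : Tendsto (fun n => √(y ^ 2 + δ n ^ 2)) atTop (𝓝 √(y ^ 2 + 0 ^ 2)) :=
      ((hδ0.pow 2).const_add _).sqrt
    simpa [Real.sqrt_sq hy] using this
  have hζle : ∀ n, ∀ y ∈ Ioo 0 Y, ζ n y ≤ Y + 1 := fun n y hy => by
    refine Real.sqrt_le_iff.2 ⟨by linarith, ?_⟩
    have h1 := hy.1
    have h2 := hy.2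
    have h3 := hδ n
    have h4 := hδ1 n
    nlinarith
  obtain ⟨M0, hM00, hM0⟩ := exists_bound_Icc hhc (Y + 1)
  obtain ⟨M1, hM10, hM1⟩ := exists_cutProfileDeriv_bound hs mu hχ1 (Y + 1)
  have hb1 := ((memLp_one_weightMeasure (alpha_mem hs).1 hY).add
    (memLp_rpow_weightMeasure (alpha_mem hs).2 hY)).const_mul M1
  have t0 : Tendsto (fun n => (m0 n).toLp (θ n)) atTop (𝓝 (profileLp hs hY mu hχ1)) := by
    refine tendsto_toLp_of_dominated m0 (memLp_cutProfile hs hY mu hχ1)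
      ((memLp_one_weightMeasure (alpha_mem hs).1 hY).const_mul M0) ?_ ?_ ?_
    · refine fun n => ae_weightMeasure fun y hy => ?_
      simpa using hM0 _ ⟨(hζ n y).le, hζle n y hy⟩
    · refine ae_weightMeasure fun y hy => ?_
      simpa using hM0 y ⟨hy.1.le, by linarith [hy.2]⟩
    · exact ae_weightMeasure fun y hy => (hhc.tendsto y).comp (hζlim y hy.1.le)
  have t1 : Tendsto (fun n => (m1 n).toLp (deriv (θ n))) atTop
      (𝓝 (profileDerivLp hs hY mu hχ1)) := by
    refine tendsto_toLp_of_dominated m1 (memLp_cutProfileDeriv hs hY mu hχ1) hb1 ?_ ?_ ?_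
    · refine fun n => ae_weightMeasure fun y hy => ?_
      have hz := hζ n y
      have hy0 : 0 < y := hy.1
      have hyz : y ≤ ζ n y := (le_abs_self y).trans (hζy n y)
      have h1 := hM1 _ ⟨hz, hζle n y hy⟩
      rw [hθd, abs_mul, abs_of_pos (by positivity : 0 < y / ζ n y)]
      have h2 : y / ζ n y ≤ 1 := (div_le_one hz).2 hyz
      -- `z^{-α} y / z = y z^{-α-1} ≤ y y^{-α-1}` since `-α - 1 < 0`
      have h3 : ζ n y ^ (-(1 - 2 * s)) * (y / ζ n y) ≤ y ^ (-(1 - 2 * s)) := by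
        have e1 : ζ n y ^ (-(1 - 2 * s)) * (y / ζ n y) = y * ζ n y ^ (-(1 - 2 * s) - 1) := by
          rw [Real.rpow_sub_one hz.ne']; ring
        have e2 : y ^ (-(1 - 2 * s)) = y * y ^ (-(1 - 2 * s) - 1) := by
          rw [Real.rpow_sub_one hy0.ne']; field_simp
        rw [e1, e2]
        gcongr y * ?_
        exact Real.rpow_le_rpow_of_nonpos hy0 hyz (by linarith [hs.2])
      calc |cutProfileDeriv s mu χ (ζ n y)| * (y / ζ n y)
          ≤ M1 * (1 + ζ n y ^ (-(1 - 2 * s))) * (y / ζ n y) := by gcongr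
        _ = M1 * (y / ζ n y + ζ n y ^ (-(1 - 2 * s)) * (y / ζ n y)) := by ring
        _ ≤ M1 * (1 + y ^ (-(1 - 2 * s))) := by gcongr
    · exact ae_weightMeasure fun y hy => hM1 y ⟨hy.1, by linarith [hy.2]⟩
    · refine ae_weightMeasure fun y hy => ?_
      have hy0 : 0 < y := hy.1
      simp_rw [hθd]
      have hc : ContinuousAt (cutProfileDeriv s mu χ) y := by
        unfold cutProfileDeriv
        have c1 := (continuous_flux (mu := mu) hs.2).continuousAt (x := y)
        have c2 := (continuous_profile (mu := mu) hs.1).continuousAt (x := y)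
        have c3 := hχ1.continuous.continuousAt (x := y)
        have c4 := (hχ1.continuous_deriv le_rfl).continuousAt (x := y)
        have c5 : ContinuousAt (fun y : ℝ => y ^ (-(1 - 2 * s))) y :=
          Real.continuousAt_rpow_const y _ (Or.inl hy0.ne')
        exact (((c5.mul c1).neg).mul c3).add (c2.mul c4)
      have := (hc.tendsto.comp (hζlim y hy0.le)).mul
        ((tendsto_const_nhds (x := y)).div (hζlim y hy0.le) hy0.ne')
      simpa [div_self hy0.ne'] using this
  have t2 : Tendsto (fun n => θ n 0) atTop (𝓝 (χ 0)) := by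
    have e : h 0 = χ 0 := by rw [hh, cutProfile, profile_zero hs.1, one_mul]
    rw [← e]
    exact (hhc.tendsto 0).comp (hζlim 0 le_rfl)
  have hlim : Tendsto (fun n => separated Ω ((m0 n).toLp (θ n)) ((m1 n).toLp (deriv (θ n)))
      (θ n 0) p) atTop (𝓝 (separated Ω (profileLp hs hY mu hχ1) (profileDerivLp hs hY mu hχ1)
        (χ 0) p)) :=
    (tendsto_tensor_left _ t0 p.1).prodMk_nhds ((tendsto_tensor_left _ t0 p.2).prodMk_nhds
      ((tendsto_tensor_left _ t1 p.1).prodMk_nhds (t2.smul_const p.1)))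
  exact isClosed_HL1.mem_of_tendsto hlim (Eventually.of_forall hmem)

end Cylinder

/-! ### Extension of functions to the truncated cylinder -/

lemma exists_bound_deriv_smoothTransition :
    ∃ M, 0 ≤ M ∧ ∀ x, |deriv Real.smoothTransition x| ≤ M := by
  have hc : Continuous (deriv Real.smoothTransition) :=
    (Real.smoothTransition.contDiff (n := 1)).continuous_deriv le_rfl
  obtain ⟨M, hM0, hM⟩ := exists_bound_Icc hc 1
  refine ⟨M, hM0, fun x => ?_⟩
  rcases lt_or_ge x 0 with h | h
  · have e : Real.smoothTransition =ᶠ[𝓝 x] fun _ => 0 :=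
      (eventually_lt_nhds h).mono fun y hy => Real.smoothTransition.zero_of_nonpos hy.le
    rw [e.deriv_eq]
    simpa using hM0
  · rcases lt_or_ge 1 x with h1 | h1
    · have e : Real.smoothTransition =ᶠ[𝓝 x] fun _ => 1 :=
        (eventually_gt_nhds h1).mono fun y hy => Real.smoothTransition.one_of_one_le hy.le
      rw [e.deriv_eq]
      simpa using hM0
    · exact hM x ⟨h, h1⟩

/-- A cutoff function in `y` that is constant near `y = 0` and vanishes near `y = Y`. -/
lemma exists_cutoff : ∃ K, 0 ≤ K ∧ ∀ Y : ℝ, 1 ≤ Y → ∃ χ : ℝ → ℝ, ContDiff ℝ (⊤ : ℕ∞) χ ∧ χ 0 = 1 ∧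
    (∀ y, 3 * Y / 4 ≤ y → χ y = 0) ∧ (∀ y, y < Y / 2 → deriv χ y = 0) ∧
    ∀ y, |deriv χ y| ≤ K / Y := by
  obtain ⟨M, hM0, hM⟩ := exists_bound_deriv_smoothTransition
  refine ⟨4 * M, by positivity, fun Y hY => ?_⟩
  have hY0 : 0 < Y := by linarith
  have hl : ContDiff ℝ (⊤ : ℕ∞) fun y : ℝ => 3 - 4 / Y * y := by fun_prop
  have hd : ∀ y : ℝ, HasDerivAt (fun y : ℝ => 3 - 4 / Y * y) (-(4 / Y)) y := fun y => by
    simpa using ((hasDerivAt_id y).const_mul (4 / Y)).const_sub 3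
  refine ⟨fun y => Real.smoothTransition (3 - 4 / Y * y), Real.smoothTransition.contDiff.comp hl,
    ?_, fun y hy => ?_, fun y hy => ?_, fun y => ?_⟩
  · exact Real.smoothTransition.one_of_one_le (by norm_num)
  · refine Real.smoothTransition.zero_of_nonpos ?_
    rw [sub_nonpos, div_mul_eq_mul_div, le_div_iff₀ hY0]
    linarith
  · have e : (fun y => Real.smoothTransition (3 - 4 / Y * y)) =ᶠ[𝓝 y] fun _ => 1 := by
      filter_upwards [eventually_lt_nhds hy] with z hz
      refine Real.smoothTransition.one_of_one_le ?_
      have : 4 / Y * z ≤ 2 := by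
        rw [div_mul_eq_mul_div, div_le_iff₀ hY0]
        linarith
      linarith
    rw [e.deriv_eq]
    simp
  · have h1 := ((Real.smoothTransition.contDiff (n := 1)).differentiable (by simp)
      (3 - 4 / Y * y)).hasDerivAt.comp y (hd y)
    have h2 : deriv (fun y => Real.smoothTransition (3 - 4 / Y * y)) y =
      deriv Real.smoothTransition (3 - 4 / Y * y) * -(4 / Y) := h1.deriv
    rw [h2, abs_mul, abs_neg, abs_of_pos (by positivity : 0 < 4 / Y)]
    have := hM (3 - 4 / Y * y)
    calc _ ≤ M * (4 / Y) := by gcongr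
      _ = 4 * M / Y := by ring

section Extension

variable {d : ℕ} {Ω : Set (E d)} {s c Y : ℝ}

/-- The localization error of the cut off profiles decays exponentially, because the profiles do. -/
lemma cutoff_integral_le (hs : s ∈ Ioo (0 : ℝ) 1) {K mu : ℝ} (hmu : c ≤ mu)
    (hY : 1 ≤ Y) {χ : ℝ → ℝ} (hχ : ContDiff ℝ 1 χ) (h0 : ∀ y, y < Y / 2 → deriv χ y = 0)
    (h1 : ∀ y, |deriv χ y| ≤ K / Y) :
    ∫ y in (0)..Y, y ^ (1 - 2 * s) * (profile s mu y * deriv χ y) ^ 2 ≤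
      4 * K ^ 2 / (2 - 2 * s) * Real.exp (-(√c * Y / 2)) := by
  have hY0 : 0 < Y := by linarith
  have hs2 : 0 < 2 - 2 * s := by linarith [hs.2]
  have m3 : MemLp (fun y => profile s mu y * deriv χ y) 2 (weightMeasure (1 - 2 * s) Y) :=
    memLp_continuous hs hY0.le ((continuous_profile hs.1).mul (hχ.continuous_deriv le_rfl))
  have i3 := (integrable_weightMeasure_iff hY0.le).1 m3.integrable_sq
  have hr : (-1 : ℝ) < 1 - 2 * s := (alpha_mem hs).1
  have i4 : IntervalIntegrable (fun y : ℝ => y ^ (1 - 2 * s)) volume 0 Y :=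
    intervalIntegral.intervalIntegrable_rpow' hr
  set B := 4 * Real.exp (-(√c * Y / 2)) * (K / Y) ^ 2 with hB
  have hpt : ∀ y ∈ Icc 0 Y, y ^ (1 - 2 * s) * (profile s mu y * deriv χ y) ^ 2 ≤
      y ^ (1 - 2 * s) * B := fun y hy => by
    have hy0 : 0 ≤ y ^ (1 - 2 * s) := Real.rpow_nonneg hy.1 _
    gcongr
    rcases lt_or_ge y (Y / 2) with h | h
    · rw [h0 y h]
      simp only [mul_zero, zero_pow two_ne_zero]
      positivity
    · rw [mul_pow]
      have e1 : profile s mu y ^ 2 ≤ 4 * Real.exp (-(√c * Y / 2)) := by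
        have a1 := profile_le (mu := mu) hs.1 y
        have a2 : (2 : ℝ) ^ s ≤ 2 := by
          simpa using Real.rpow_le_rpow_of_exponent_le one_le_two hs.2.le
        have a3 : Real.exp (-(√mu * y / 2)) ≤ Real.exp (-(√c * Y / 4)) := by
          refine Real.exp_le_exp.2 (neg_le_neg ?_)
          have : √c * (Y / 2) ≤ √mu * y := by gcongr
          linarith
        have a4 : profile s mu y ≤ 2 * Real.exp (-(√c * Y / 4)) := a1.trans (by gcongr)
        calc profile s mu y ^ 2 ≤ (2 * Real.exp (-(√c * Y / 4))) ^ 2 :=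
              pow_le_pow_left₀ (profile_pos hs.1 y).le a4 2
          _ = 4 * Real.exp (-(√c * Y / 2)) := by
              rw [mul_pow, ← Real.exp_nat_mul]
              congr 2
              · norm_num
              · push_cast; ring
      have e2 : deriv χ y ^ 2 ≤ (K / Y) ^ 2 := sq_le_sq.2 ((h1 y).trans (le_abs_self _))
      rw [hB]
      gcongr
  calc _ ≤ ∫ y in (0)..Y, y ^ (1 - 2 * s) * B :=
        intervalIntegral.integral_mono_on hY0.le i3 (i4.mul_const B) hpt
    _ = Y ^ (2 - 2 * s) / (2 - 2 * s) * B := by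
        rw [intervalIntegral.integral_mul_const, integral_rpow (Or.inl hr)]
        rw [show 1 - 2 * s + 1 = 2 - 2 * s by ring, Real.zero_rpow hs2.ne', sub_zero]
    _ ≤ Y ^ (2 : ℝ) / (2 - 2 * s) * B := by
        gcongr
        linarith [hs.1]
    _ = _ := by
        rw [hB, Real.rpow_two]
        field_simp

/-- Every function of `ℍ^s(Ω)` has an extension to the truncated cylinder whose energy exceeds that
of the harmonic extension by an exponentially small amount: cut off the harmonic extension. -/
lemma exists_extension (hΩo : IsOpen Ω) (hΩ : Bornology.IsBounded Ω) (hc : IsEigenvalueBound Ω c)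
    (hs : s ∈ Ioo (0 : ℝ) 1) : ∃ K, 0 ≤ K ∧ ∀ Y : ℝ, 1 ≤ Y → ∀ w ∈ hSpace Ω s,
      ∃ W ∈ HL1 Ω (1 - 2 * s) Y, tr W = w ∧
        aY s W W ≤ fracPairing Ω s w w + K * Real.exp (-(√c * Y / 2)) * ‖w‖ ^ 2 := by
  obtain ⟨K0, hK0, hcut⟩ := exists_cutoff
  have hd := dConst_pos hs
  have hs2 : 0 < 2 - 2 * s := by linarith [hs.2]
  refine ⟨4 * K0 ^ 2 / (2 - 2 * s) / dConst s, by positivity, fun Y hY w hw => ?_⟩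
  obtain ⟨χ, hχ, hχ0, hχY, hχd0, hχd⟩ := hcut Y hY
  have hY0 : 0 ≤ Y := by linarith
  have hχ1 : ContDiff ℝ 1 χ := hχ.of_le (by simp)
  choose G hG using fun mu : ℝ => exists_gradient (spectralProj_mem Ω mu w)
  let q := fun mu => profileLp (s := s) (Y := Y) hs hY0 mu hχ1
  let r := fun mu => profileDerivLp (s := s) (Y := Y) hs hY0 mu hχ1
  let x0 := fun mu => tensor (cylMeasure_eq_prod Ω (1 - 2 * s) Y) (q mu) (spectralProj Ω mu w)
  let x1 := fun mu => tensor (cylMeasure_eq_prod Ω (1 - 2 * s) Y) (q mu) (G mu)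
  let x2 := fun mu => tensor (cylMeasure_eq_prod Ω (1 - 2 * s) Y) (r mu) (spectralProj Ω mu w)
  have hGG : ∀ mu nu, inner ℝ (G mu) (G nu) =
      mu * inner ℝ (spectralProj Ω mu w) (spectralProj Ω nu w) := fun mu nu =>
    (hG mu).2 _ (hG nu).1
  have o0 : Pairwise fun i j => inner ℝ (x0 i) (x0 j) = 0 := fun i j hij => by
    simp only [x0]
    rw [inner_tensor_tensor, inner_spectralProj_of_ne hij, mul_zero]
  have o1 : Pairwise fun i j => inner ℝ (x1 i) (x1 j) = 0 := fun i j hij => by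
    simp only [x1]
    rw [inner_tensor_tensor, hGG, inner_spectralProj_of_ne hij]
    ring
  have o2 : Pairwise fun i j => inner ℝ (x2 i) (x2 j) = 0 := fun i j hij => by
    simp only [x2]
    rw [inner_tensor_tensor, inner_spectralProj_of_ne hij, mul_zero]
  set e := 4 * K0 ^ 2 / (2 - 2 * s) * Real.exp (-(√c * Y / 2)) with he
  have he0 : 0 ≤ e := by positivity
  let b := fun mu : ℝ => dConst s * (mu ^ s * ‖spectralProj Ω mu w‖ ^ 2) +
    e * ‖spectralProj Ω mu w‖ ^ 2
  have hb : HasSum b (dConst s * fracPairing Ω s w w + e * ‖w‖ ^ 2) := by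
    refine HasSum.add (HasSum.mul_left _ ?_)
      ((hasSum_norm_spectralProj_sq hΩo hΩ w).mul_left e)
    rw [fracPairing_self]
    exact ((mem_hSpace_iff hc).1 hw).hasSum
  have hG0 : ∀ mu, spectralProj Ω mu w = 0 → G mu = 0 := fun mu h => by
    have := hGG mu mu
    rw [h, real_inner_self_eq_norm_sq] at this
    simpa using this
  -- The energy of each mode; the modes are orthogonal, so these bounds add up.
  have hx12 : ∀ mu, ‖x1 mu‖ ^ 2 + ‖x2 mu‖ ^ 2 ≤ b mu := fun mu => by
    simp only [x1, x2, b]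
    rw [norm_tensor, norm_tensor, mul_pow, mul_pow, ← real_inner_self_eq_norm_sq (G mu), hGG,
      real_inner_self_eq_norm_sq]
    rcases hc.spectralProj_eq_zero_or_le mu w with h | h
    · simp [h]
    · have hmu := hc.1.trans_le h
      have h1 : mu * ‖q mu‖ ^ 2 + ‖r mu‖ ^ 2 = _ := cutProfile_energy hs hmu hY0 hχ1
      rw [hχ0, hχY Y (by linarith)] at h1
      have h2 := cutoff_integral_le hs h hY hχ1 hχd0 hχd
      have h3 : mu * ‖q mu‖ ^ 2 + ‖r mu‖ ^ 2 ≤ dConst s * mu ^ s + e := by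
        rw [h1, he]
        simp only [one_pow, mul_one, ne_eq, OfNat.ofNat_ne_zero, not_false_eq_true, zero_pow,
          mul_zero, sub_zero]
        linarith
      nlinarith [mul_le_mul_of_nonneg_right h3 (sq_nonneg ‖spectralProj Ω mu w‖)]
  have s1 : Summable x1 := summable_of_pairwise_orthogonal o1
    (hb.summable.of_nonneg_of_le (fun _ => by positivity) fun mu => by
      have := hx12 mu; have := sq_nonneg ‖x2 mu‖; linarith)
  have s2 : Summable x2 := summable_of_pairwise_orthogonal o2
    (hb.summable.of_nonneg_of_le (fun _ => by positivity) fun mu => by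
      have := hx12 mu; have := sq_nonneg ‖x1 mu‖; linarith)
  have s0 : Summable x0 := by
    refine summable_of_pairwise_orthogonal o0 ((hb.summable.mul_left c⁻¹).of_nonneg_of_le
      (fun _ => by positivity) fun mu => ?_)
    rw [le_inv_mul_iff₀ hc.1]
    have h1 := hx12 mu
    have h2 := sq_nonneg ‖x2 mu‖
    have h3 : c * ‖x0 mu‖ ^ 2 ≤ ‖x1 mu‖ ^ 2 := by
      simp only [x0, x1]
      rw [norm_tensor, norm_tensor, mul_pow, mul_pow, ← real_inner_self_eq_norm_sq (G mu), hGG,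
        real_inner_self_eq_norm_sq]
      rcases hc.spectralProj_eq_zero_or_le mu w with h | h
      · simp [h]
      · nlinarith [mul_le_mul_of_nonneg_right h
          (by positivity : 0 ≤ ‖q mu‖ ^ 2 * ‖spectralProj Ω mu w‖ ^ 2)]
    linarith
  let x := fun mu => separated Ω (q mu) (r mu) (χ 0) (spectralProj Ω mu w, G mu)
  have hx : ∀ mu, x mu ∈ HL1Submodule Ω (1 - 2 * s) Y := fun mu => by
    rcases hc.spectralProj_eq_zero_or_le mu w with h | h
    · have e0 : x mu = 0 := by
        refine Prod.ext ?_ (Prod.ext ?_ (Prod.ext ?_ ?_))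
        · exact norm_eq_zero.1 (by simp [x, separated, norm_tensor, h])
        · exact norm_eq_zero.1 (by simp [x, separated, norm_tensor, hG0 mu h])
        · exact norm_eq_zero.1 (by simp [x, separated, norm_tensor, h])
        · simp [x, separated, h]
      rw [e0]
      exact Submodule.zero_mem _
    · exact separated_profile_mem hs hY0 (hc.1.trans_le h) hχ hχ1 (Y' := 3 * Y / 4) (by linarith)
        (by linarith) hχY (hG mu).1
  have st : HasSum (fun mu => χ 0 • spectralProj Ω mu w) w := by
    simpa [hχ0] using hasSum_spectralProj hΩo hΩ w
  have hsum : HasSum x (∑' mu, x0 mu, ∑' mu, x1 mu, ∑' mu, x2 mu, w) :=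
    s0.hasSum.prodMk (s1.hasSum.prodMk (s2.hasSum.prodMk st))
  refine ⟨_, (isClosed_HL1 (Ω := Ω) (a := 1 - 2 * s) (Y := Y)).mem_of_tendsto hsum
    (Eventually.of_forall fun F => Submodule.sum_mem (HL1Submodule Ω (1 - 2 * s) Y)
      fun mu _ => hx mu), rfl, ?_⟩
  have hlim : Tendsto (fun F : Finset ℝ => ‖∑ mu ∈ F, x1 mu‖ ^ 2 + ‖∑ mu ∈ F, x2 mu‖ ^ 2) atTop
      (𝓝 (‖∑' mu, x1 mu‖ ^ 2 + ‖∑' mu, x2 mu‖ ^ 2)) :=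
    ((s1.hasSum.norm).pow 2).add ((s2.hasSum.norm).pow 2)
  have hle : ‖∑' mu, x1 mu‖ ^ 2 + ‖∑' mu, x2 mu‖ ^ 2 ≤
      dConst s * fracPairing Ω s w w + e * ‖w‖ ^ 2 := by
    refine le_of_tendsto hlim (Eventually.of_forall fun F => ?_)
    rw [norm_sq_sum_of_pairwise_orthogonal o1, norm_sq_sum_of_pairwise_orthogonal o2,
      ← Finset.sum_add_distrib]
    refine (Finset.sum_le_sum fun mu _ => hx12 mu).trans (sum_le_hasSum F (fun mu _ => ?_) hb)
    have := hx12 mu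
    exact le_trans (by positivity) this
  rw [aY, real_inner_self_eq_norm_sq, real_inner_self_eq_norm_sq, one_div, inv_mul_le_iff₀ hd]
  refine hle.trans (le_of_eq ?_)
  rw [he]
  field_simp

end Extension

/-! ### The energy of discrete harmonic extensions -/

section DiscreteEnergy

variable {d : ℕ} {Ω : Set (E d)} {s c Y : ℝ}

lemma aY_comm (V W : CylSpace Ω (1 - 2 * s) Y) : aY s V W = aY s W V := by
  simp only [aY, real_inner_comm]

lemma aY_add_right (V W Z : CylSpace Ω (1 - 2 * s) Y) :
    aY s V (W + Z) = aY s V W + aY s V Z := by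
  have e1 : cylGradX (W + Z) = cylGradX W + cylGradX Z := rfl
  have e2 : cylDerivY (W + Z) = cylDerivY W + cylDerivY Z := rfl
  simp only [aY, e1, e2, inner_add_right]
  ring

lemma aY_smul_right (t : ℝ) (V W : CylSpace Ω (1 - 2 * s) Y) :
    aY s V (t • W) = t * aY s V W := by
  have e1 : cylGradX (t • W) = t • cylGradX W := rfl
  have e2 : cylDerivY (t • W) = t • cylDerivY W := rfl
  simp only [aY, e1, e2, real_inner_smul_right]
  ring

lemma aY_sub_right (V W Z : CylSpace Ω (1 - 2 * s) Y) :
    aY s V (W - Z) = aY s V W - aY s V Z := by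
  rw [sub_eq_add_neg, ← neg_one_smul ℝ Z, aY_add_right, aY_smul_right]
  ring

lemma aY_self_nonneg (hs : s ∈ Ioo (0 : ℝ) 1) (V : CylSpace Ω (1 - 2 * s) Y) : 0 ≤ aY s V V := by
  have := dConst_pos hs
  rw [aY, real_inner_self_eq_norm_sq, real_inner_self_eq_norm_sq]
  positivity

lemma aY_sub_self (V W : CylSpace Ω (1 - 2 * s) Y) :
    aY s (V - W) (V - W) = aY s V V - 2 * aY s V W + aY s W W := by
  rw [aY_sub_right, aY_comm _ V, aY_comm _ W, aY_sub_right, aY_sub_right, aY_comm W V]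
  ring

/-- The extension property for the truncated cylinders, with an exponentially small error. -/
def HasExtension (Ω : Set (E d)) (s c K : ℝ) : Prop :=
  ∀ Y : ℝ, 1 ≤ Y → ∀ w ∈ hSpace Ω s, ∃ W ∈ HL1 Ω (1 - 2 * s) Y, tr W = w ∧
    aY s W W ≤ fracPairing Ω s w w + K * Real.exp (-(√c * Y / 2)) * ‖w‖ ^ 2

/-- If `V` is discrete harmonic, `a_Y(V, ·)` differs from `⟨(-Δ)^s tr V, tr ·⟩` by an exponentially
small amount: the difference of the two forms is positive semidefinite, so the Cauchy-Schwarz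
inequality reduces the claim to a bound on the diagonal, where `V` minimizes the energy. -/
lemma abs_aY_sub_fracPairing_le (hc : IsEigenvalueBound Ω c) (hs : s ∈ Ioo (0 : ℝ) 1) {K : ℝ}
    (hK : 0 ≤ K) (hext : HasExtension Ω s c K) (hY : 1 ≤ Y) {V Z : CylSpace Ω (1 - 2 * s) Y}
    (hV : V ∈ HL1 Ω (1 - 2 * s) Y) (hZ : Z ∈ HL1 Ω (1 - 2 * s) Y)
    (hharm : ∀ X ∈ HL1 Ω (1 - 2 * s) Y, tr X = 0 → aY s V X = 0) :
    |aY s V Z - fracPairing Ω s (tr V) (tr Z)| ≤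
      K * Real.exp (-(√c * Y / 2)) * ‖tr V‖ * ‖tr Z‖ := by
  have hY0 : 0 ≤ Y := by linarith
  set e := K * Real.exp (-(√c * Y / 2)) with he
  have he0 : 0 ≤ e := by positivity
  obtain ⟨A, hA, hAt, hAe⟩ := hext Y hY _ (trace_energy_le hc hs hY0 hV).1
  obtain ⟨B, hB, hBt, hBe⟩ := hext Y hY _ (trace_energy_le hc hs hY0 hZ).1
  rw [mem_HL1_iff] at hV hZ hA hB
  -- `V` is `a_Y`-orthogonal to functions of trace zero, so only traces matter in `a_Y(V, ·)`.
  have h1 : aY s V V = aY s V A := by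
    have : tr (V - A) = 0 := by
      rw [show tr (V - A) = tr V - tr A from rfl, hAt, sub_self]
    have := hharm _ (mem_HL1_iff.2 (Submodule.sub_mem _ hV hA)) this
    rw [aY_sub_right] at this
    linarith
  have h2 : aY s V Z = aY s V B := by
    have : tr (Z - B) = 0 := by
      rw [show tr (Z - B) = tr Z - tr B from rfl, hBt, sub_self]
    have := hharm _ (mem_HL1_iff.2 (Submodule.sub_mem _ hZ hB)) this
    rw [aY_sub_right] at this
    linarith
  have h3 : aY s V V ≤ aY s A A := by
    have := aY_self_nonneg hs (V - A)
    rw [aY_sub_self] at this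
    linarith
  set v := tr V with hv
  set z := tr Z with hz
  have hvm : v ∈ hSpace Ω s := (trace_energy_le hc hs hY0 (mem_HL1_iff.2 hV)).1
  have hzm : z ∈ hSpace Ω s := (trace_energy_le hc hs hY0 (mem_HL1_iff.2 hZ)).1
  -- The form `a_Y(W, W) - ⟨(-Δ)^s tr W, tr W⟩` is nonnegative at `W = V - t B` for every `t`.
  have hquad : ∀ t : ℝ, 0 ≤ (aY s B B - fracPairing Ω s z z) * (t * t) +
      (-(2 * (aY s V B - fracPairing Ω s v z))) * t + (aY s V V - fracPairing Ω s v v) := by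
    intro t
    have h4 := (trace_energy_le hc hs hY0 (mem_HL1_iff.2
      (Submodule.sub_mem _ hV (Submodule.smul_mem _ t hB)))).2
    rw [show tr (V - t • B) = tr V - t • tr B from rfl, hBt, aY_sub_self, ← hv,
      fracPairing_sub_self hc hvm (hSpace_smul hc t hzm), fracPairing_smul_right,
      fracPairing_smul_right, fracPairing_comm _ (t • z) z, fracPairing_smul_right, aY_smul_right,
      aY_smul_right, aY_comm (t • B) B, aY_smul_right] at h4
    linarith
  have hdis := discrim_le_zero hquad
  rw [discrim] at hdis
  have hBz : aY s B B - fracPairing Ω s z z ≤ e * ‖z‖ ^ 2 := by linarith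
  have hVv : aY s V V - fracPairing Ω s v v ≤ e * ‖v‖ ^ 2 := by linarith
  have hB0 : 0 ≤ aY s B B - fracPairing Ω s z z := by
    have := (trace_energy_le hc hs hY0 (mem_HL1_iff.2 hB)).2
    rw [hBt] at this
    linarith
  have h5 : (aY s V B - fracPairing Ω s v z) ^ 2 ≤ (e * ‖v‖ * ‖z‖) ^ 2 := by
    have := mul_le_mul hVv hBz hB0 (by positivity)
    nlinarith
  rw [h2]
  exact abs_le_of_sq_le_sq h5 (by positivity)

variable {ψ u₀ : L2 Ω} {F : ℕ → L2 Ω} {N : ℕ} {τ : ℝ} {V : ℕ → CylSpace Ω (1 - 2 * s) Y}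

/-- The traces of the semidiscrete solution satisfy the time-discrete variational inequality on `Ω`
up to an exponentially small error. -/
lemma IsSemidiscreteSolution.inequality (hc : IsEigenvalueBound Ω c) (hs : s ∈ Ioo (0 : ℝ) 1)
    {K : ℝ} (hK : 0 ≤ K) (hext : HasExtension Ω s c K) (hY : 1 ≤ Y)
    (hV : IsSemidiscreteSolution Ω s Y ψ u₀ F N τ V) {k : ℕ} (hk : k < N) {φ : L2 Ω}
    (hφ : φ ∈ admissible Ω s ψ) :
    inner ℝ (τ⁻¹ • (tr (V (k + 1)) - tr (V k)) - F (k + 1)) (tr (V (k + 1)) - φ) +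
      fracPairing Ω s (tr (V (k + 1))) (tr (V (k + 1)) - φ) ≤
      K * Real.exp (-(√c * Y / 2)) * ‖tr (V (k + 1))‖ * ‖tr (V (k + 1)) - φ‖ := by
  obtain ⟨Φ, hΦ, hΦt, -⟩ := hext Y hY φ hφ.1
  have hV1 := hV.1 (k + 1) hk
  have hVm := mem_HL1_iff.1 hV1.1
  -- The obstacle acts on the trace only: `V (k + 1) ± X` is admissible if `tr X = 0`.
  have hharm : ∀ X ∈ HL1 Ω (1 - 2 * s) Y, tr X = 0 → aY s (V (k + 1)) X = 0 := fun X hX hX0 => by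
    have key : ∀ Z ∈ HL1 Ω (1 - 2 * s) Y, tr Z = 0 → aY s (V (k + 1)) Z ≤ 0 := fun Z hZ hZ0 => by
      have e : tr (V (k + 1) - Z) = tr (V (k + 1)) := by
        rw [show tr (V (k + 1) - Z) = tr (V (k + 1)) - tr Z from rfl, hZ0, sub_zero]
      have h := hV.2.2 k hk (V (k + 1) - Z)
        ⟨mem_HL1_iff.2 (Submodule.sub_mem _ hVm (mem_HL1_iff.1 hZ)), by rw [e]; exact hV1.2⟩
      rw [sub_sub_cancel, hZ0, inner_zero_right, inner_zero_right] at h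
      linarith
    have h1 := key X hX hX0
    have h2 := key ((-1 : ℝ) • X) (mem_HL1_iff.2 (Submodule.smul_mem _ _ (mem_HL1_iff.1 hX)))
      (by rw [show tr ((-1 : ℝ) • X) = (-1 : ℝ) • tr X from rfl, hX0, smul_zero])
    rw [aY_smul_right] at h2
    linarith
  have h1 := hV.2.2 k hk Φ ⟨hΦ, by rw [hΦt]; exact hφ.2⟩
  have h2 := abs_aY_sub_fracPairing_le hc hs hK hext hY hV1.1
    (mem_HL1_iff.2 (Submodule.sub_mem _ hVm (mem_HL1_iff.1 hΦ))) hharm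
  have e1 : tr (V (k + 1) - Φ) = tr (V (k + 1)) - φ := by rw [← hΦt]; rfl
  have e2 : tr (V (k + 1) - V k) = tr (V (k + 1)) - tr (V k) := rfl
  rw [e1] at h1 h2
  rw [e2] at h1
  rw [inner_sub_left]
  have := (abs_le.1 h2).1
  linarith

/-- The solutions of a quadratic inequality. -/
lemma le_add_sqrt_of_sq_le {M S X : ℝ} (hS : 0 ≤ S) (hX : 0 ≤ X) (h : M ^ 2 ≤ 2 * S * M + X) :
    M ≤ 2 * S + √X := by
  have h1 : (M - S) ^ 2 ≤ (S + √X) ^ 2 := by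
    have := Real.sq_sqrt hX
    nlinarith [mul_nonneg hS (Real.sqrt_nonneg X)]
  have := abs_le_of_sq_le_sq h1 (by positivity)
  linarith [(abs_le.1 this).2]

/-- Stability of the scheme: test with an extension of the obstacle. -/
lemma IsSemidiscreteSolution.norm_le (hΩo : IsOpen Ω) (hΩ : Bornology.IsBounded Ω)
    (hc : IsEigenvalueBound Ω c) (hs : s ∈ Ioo (0 : ℝ) 1)
    {K : ℝ} (hK : 0 ≤ K) (hext : HasExtension Ω s c K) (hY : 1 ≤ Y) (hψ : ψ ∈ hSpace Ω s)
    (hτ : 0 < τ) (hV : IsSemidiscreteSolution Ω s Y ψ u₀ F N τ V) {k : ℕ} (hk : k ≤ N) :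
    ‖tr (V k)‖ ≤ ‖u₀‖ + 2 * ∑ j ∈ Finset.range N, τ * ‖F (j + 1)‖ +
      (2 * √(c ^ s)⁻¹ + √(N * τ * (1 + K / c ^ s))) * √(fracPairing Ω s ψ ψ) := by
  have hcs : 0 < c ^ s := Real.rpow_pos_of_pos hc.1 s
  set A := fracPairing Ω s ψ ψ with hA
  have hA0 : 0 ≤ A := fracPairing_self_nonneg hc s ψ
  obtain ⟨Ψ, hΨ, hΨt, hΨe⟩ := hext Y hY ψ hψ
  have hψn : ‖ψ‖ ^ 2 ≤ (c ^ s)⁻¹ * A := by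
    rw [le_inv_mul_iff₀ hcs]
    exact le_fracPairing_self hΩo hΩ hc hs.1.le hψ
  have hΨA : aY s Ψ Ψ ≤ (1 + K / c ^ s) * A := by
    have h1 : Real.exp (-(√c * Y / 2)) ≤ 1 := Real.exp_le_one_iff.2 (by
      have := Real.sqrt_nonneg c
      have : 0 ≤ √c * Y := by positivity
      linarith)
    have h2 : K * Real.exp (-(√c * Y / 2)) * ‖ψ‖ ^ 2 ≤ K * 1 * ((c ^ s)⁻¹ * A) := by gcongr
    calc _ ≤ A + K * 1 * ((c ^ s)⁻¹ * A) := hΨe.trans (by linarith)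
      _ = _ := by field_simp
  set A' := (1 + K / c ^ s) * A with hA'
  let z := fun k => tr (V k) - ψ
  have hstep : ∀ k < N, ‖z (k + 1)‖ ^ 2 ≤ ‖z k‖ ^ 2 + 2 * (τ * ‖F (k + 1)‖ * ‖z (k + 1)‖) +
      τ * A' := fun k hk => by
    have h1 := hV.2.2 k hk Ψ ⟨hΨ, by rw [hΨt]; exact ae_of_all _ fun _ => le_rfl⟩
    have e1 : tr (V (k + 1) - Ψ) = z (k + 1) := by simp only [z]; rw [← hΨt]; rfl
    have e2 : tr (V (k + 1) - V k) = z (k + 1) - z k := by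
      simp only [z]
      rw [sub_sub_sub_cancel_right]
      rfl
    rw [e1, e2, real_inner_smul_left, inner_sub_left, real_inner_self_eq_norm_sq] at h1
    have h2 : -(A' / 2) ≤ aY s (V (k + 1)) (V (k + 1) - Ψ) := by
      have h3 := aY_self_nonneg hs (V (k + 1) - Ψ)
      rw [aY_sub_self] at h3
      have h4 := aY_self_nonneg hs (V (k + 1))
      rw [aY_sub_right]
      linarith
    have h5 := real_inner_le_norm (F (k + 1)) (z (k + 1))
    have h6 := real_inner_le_norm (z k) (z (k + 1))
    have h7 : ‖z (k + 1)‖ ^ 2 - inner ℝ (z k) (z (k + 1)) ≤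
        τ * (‖F (k + 1)‖ * ‖z (k + 1)‖ + A' / 2) := by
      rw [← inv_mul_le_iff₀ hτ]
      linarith
    nlinarith [sq_nonneg (‖z (k + 1)‖ - ‖z k‖)]
  obtain ⟨m, hm, hmax⟩ := Finset.exists_max_image (Finset.range (N + 1))
    (fun k => ‖z k‖) ⟨0, by simp⟩
  set M := ‖z m‖ with hM
  set S := ∑ j ∈ Finset.range N, τ * ‖F (j + 1)‖ with hS
  have hS0 : 0 ≤ S := Finset.sum_nonneg fun j _ => by positivity
  have hA'0 : 0 ≤ A' := by positivity
  have hsum : ∀ k ≤ N, ‖z k‖ ^ 2 ≤ ‖z 0‖ ^ 2 + 2 * (∑ j ∈ Finset.range k, τ * ‖F (j + 1)‖) * M +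
      k * τ * A' := fun k => by
    induction k with
    | zero => simp
    | succ k ih =>
      intro hk
      have h1 := ih (by omega)
      have h2 := hstep k (by omega)
      have h3 : ‖z (k + 1)‖ ≤ M := hmax _ (by simp; omega)
      have h4 : τ * ‖F (k + 1)‖ * ‖z (k + 1)‖ ≤ τ * ‖F (k + 1)‖ * M := by gcongr
      rw [Finset.sum_range_succ]
      push_cast
      linarith
  have hmN : m ≤ N := by simp at hm; omega
  have hM2 : M ^ 2 ≤ 2 * S * M + (‖z 0‖ ^ 2 + N * τ * A') := by
    have h1 := hsum m hmN
    have h2 : ∑ j ∈ Finset.range m, τ * ‖F (j + 1)‖ ≤ S :=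
      Finset.sum_le_sum_of_subset_of_nonneg (by simpa using hmN) fun j _ _ => by positivity
    have h3 : (m : ℝ) * τ * A' ≤ N * τ * A' := by gcongr
    have h4 : (∑ j ∈ Finset.range m, τ * ‖F (j + 1)‖) * M ≤ S * M := by gcongr
    linarith
  have h1 := le_add_sqrt_of_sq_le hS0 (by positivity) hM2
  have h2 : √(‖z 0‖ ^ 2 + N * τ * A') ≤ ‖z 0‖ + √(N * τ * (1 + K / c ^ s)) * √A := by
    have hr : 0 ≤ N * τ * (1 + K / c ^ s) := by positivity
    refine Real.sqrt_le_iff.2 ⟨by positivity, ?_⟩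
    rw [add_sq, mul_pow, Real.sq_sqrt hr, Real.sq_sqrt hA0, hA', ← mul_assoc]
    have : 0 ≤ 2 * ‖z 0‖ * (√(N * τ * (1 + K / c ^ s)) * √A) := by positivity
    linarith
  have h3 : ‖ψ‖ ≤ √(c ^ s)⁻¹ * √A := by
    rw [← Real.sqrt_mul (by positivity)]
    exact Real.le_sqrt_of_sq_le hψn
  have h4 : ‖z 0‖ ≤ ‖u₀‖ + ‖ψ‖ := by
    simp only [z]; rw [hV.2.1]; exact norm_sub_le _ _
  have h5 : ‖tr (V k)‖ ≤ ‖z k‖ + ‖ψ‖ := by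
    have := norm_add_le (z k) ψ
    simpa [z] using this
  have h6 : ‖z k‖ ≤ M := hmax _ (by simp; omega)
  linarith

end DiscreteEnergy

/-! ### Evolution variational inequalities -/

lemma AbsolutelyContinuousOnInterval.norm_sq {X : Type*} [NormedAddCommGroup X] {w : ℝ → X}
    {a b : ℝ} (hw : AbsolutelyContinuousOnInterval w a b) :
    AbsolutelyContinuousOnInterval (fun t => ‖w t‖ ^ 2) a b := by
  have h : AbsolutelyContinuousOnInterval (fun t => ‖w t‖) a b := by
    refine squeeze_zero (fun t => Finset.sum_nonneg fun i _ => dist_nonneg) (fun t => ?_) hw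
    exact Finset.sum_le_sum fun i _ => (dist_norm_norm_le _ _).trans_eq (dist_eq_norm _ _).symm
  simpa only [sq] using! h.mul h

/-- Integration of a differential inequality. The function `g` is absolutely continuous only away
from the end points; the limit is taken by monotone convergence, so that `P` need not be
measurable. -/
lemma lintegral_le_of_deriv_add_le {g P B : ℝ → ℝ} {a b : ℝ} (hab : a ≤ b)
    (hgc : ContinuousOn g (Icc a b))
    (hac : ∀ a' b', a < a' → a' < b' → b' < b → AbsolutelyContinuousOnInterval g a' b')
    (hB : IntervalIntegrable B volume a b)
    (h : ∀ᵐ t ∂(volume.restrict (Ioo a b)), 0 ≤ P t ∧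
      ∃ g', HasDerivAt g g' t ∧ g' + P t ≤ B t) :
    0 ≤ g a - g b + ∫ t in a..b, B t ∧
      ∫⁻ t in Ioo a b, ENNReal.ofReal (P t) ≤
        ENNReal.ofReal (g a - g b + ∫ t in a..b, B t) := by
  rcases hab.eq_or_lt with rfl | hlt
  · simp
  let ε : ℕ → ℝ := fun n => (b - a) / ((n : ℝ) + 3)
  have hε : ∀ n, 0 < ε n := fun n => div_pos (by linarith) (by positivity)
  have hε2 : ∀ n, a + ε n < b - ε n := fun n => by
    have h1 : ε n ≤ (b - a) / 3 := by
      have : (0 : ℝ) ≤ n := by positivity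
      exact div_le_div_of_nonneg_left (by linarith) (by norm_num) (by linarith)
    linarith
  have hεa : Antitone ε := fun m n hmn => by
    have : (m : ℝ) ≤ n := by exact_mod_cast hmn
    exact div_le_div_of_nonneg_left (by linarith) (by positivity) (by linarith)
  have hε0 : Tendsto ε atTop (𝓝 0) := by
    refine Tendsto.div_atTop tendsto_const_nhds ?_
    exact tendsto_atTop_add_const_right _ _ tendsto_natCast_atTop_atTop
  let S : ℕ → Set ℝ := fun n => Ioc (a + ε n) (b - ε n)
  have hSmono : Monotone S := fun m n hmn => by
    have := hεa hmn
    exact Ioc_subset_Ioc (by linarith) (by linarith)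
  have hSU : ⋃ n, S n = Ioo a b := by
    ext t
    simp only [mem_iUnion, S, mem_Ioc, mem_Ioo]
    constructor
    · rintro ⟨n, h1, h2⟩
      have := hε n
      constructor <;> linarith
    · rintro ⟨h1, h2⟩
      obtain ⟨n, hn⟩ := (hε0.eventually_lt_const (lt_min (sub_pos.2 h1) (sub_pos.2 h2))).exists
      have h3 := hn.trans_le (min_le_left _ _)
      have h4 := hn.trans_le (min_le_right _ _)
      exact ⟨n, by linarith, by linarith⟩
  let R : ℕ → ℝ := fun n => g (a + ε n) - g (b - ε n) + ∫ t in (a + ε n)..(b - ε n), B t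
  have hBsub : ∀ n, IntervalIntegrable B volume (a + ε n) (b - ε n) := fun n => by
    have h1 := hε n
    have h2 := hε2 n
    refine hB.mono_set ?_
    rw [uIcc_of_le h2.le, uIcc_of_le hab]
    exact Icc_subset_Icc (by linarith) (by linarith)
  have hn : ∀ n, 0 ≤ R n ∧ ∫⁻ t in S n, ENNReal.ofReal (P t) ≤ ENNReal.ofReal (R n) := fun n => by
    have h1 := hε n
    have h2 := hε2 n
    have hA := hac (a + ε n) (b - ε n) (by linarith) h2 (by linarith)
    have hi := (hBsub n).sub hA.intervalIntegrable_deriv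
    have hsub : S n ⊆ Ioo a b := fun t ht => ⟨by linarith [ht.1], by linarith [ht.2]⟩
    have hpt : ∀ᵐ t ∂(volume.restrict (S n)), 0 ≤ P t ∧ P t ≤ B t - deriv g t := by
      filter_upwards [ae_restrict_of_ae_restrict_of_subset hsub h] with t ht
      obtain ⟨h3, g', h4, h5⟩ := ht
      rw [h4.deriv]
      exact ⟨h3, by linarith⟩
    have e : R n = ∫ t in S n, (B t - deriv g t) := by
      rw [← intervalIntegral.integral_of_le h2.le,
        intervalIntegral.integral_sub (hBsub n) hA.intervalIntegrable_deriv,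
        hA.integral_deriv_eq_sub]
      ring
    have hi' : IntegrableOn (fun t => B t - deriv g t) (S n) :=
      (intervalIntegrable_iff_integrableOn_Ioc_of_le h2.le).1 hi
    rw [e]
    refine ⟨integral_nonneg_of_ae (hpt.mono fun t ht => ht.1.trans ht.2), ?_⟩
    rw [ofReal_integral_eq_lintegral_ofReal hi' (hpt.mono fun t ht => ht.1.trans ht.2)]
    exact lintegral_mono_ae (hpt.mono fun t ht => ENNReal.ofReal_le_ofReal ht.2)
  have hR : Tendsto R atTop (𝓝 (g a - g b + ∫ t in a..b, B t)) := by
    have ta : Tendsto (fun n => a + ε n) atTop (𝓝[Icc a b] a) := by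
      refine tendsto_nhdsWithin_iff.2 ⟨by simpa using hε0.const_add a, Eventually.of_forall
        fun n => ⟨by linarith [hε n], by linarith [hε n, hε2 n]⟩⟩
    have tb : Tendsto (fun n => b - ε n) atTop (𝓝[Icc a b] b) := by
      refine tendsto_nhdsWithin_iff.2 ⟨by simpa using hε0.const_sub b, Eventually.of_forall
        fun n => ⟨by linarith [hε n, hε2 n], by linarith [hε n]⟩⟩
    have hprim : ContinuousOn (fun x => ∫ t in a..x, B t) (Icc a b) := by
      have := intervalIntegral.continuousOn_primitive_interval'
        hB (left_mem_uIcc (a := a) (b := b))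
      rwa [uIcc_of_le hab] at this
    have h1 := (hgc a (left_mem_Icc.2 hab)).tendsto.comp ta
    have h2 := (hgc b (right_mem_Icc.2 hab)).tendsto.comp tb
    have h3 := (hprim a (left_mem_Icc.2 hab)).tendsto.comp ta
    have h4 := (hprim b (right_mem_Icc.2 hab)).tendsto.comp tb
    have h5 := (h1.sub h2).add (h4.sub h3)
    simp only [intervalIntegral.integral_same, sub_zero] at h5
    refine h5.congr fun n => ?_
    simp only [Function.comp_apply, R]
    have hm : ∀ x ∈ Icc a b, IntervalIntegrable B volume a x := fun x hx => by
      refine hB.mono_set ?_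
      rw [uIcc_of_le hab, uIcc_of_le hx.1]
      exact Icc_subset_Icc_right hx.2
    rw [intervalIntegral.integral_interval_sub_left
      (hm _ ⟨by linarith [hε n, hε2 n], by linarith [hε n]⟩)
      (hm _ ⟨by linarith [hε n], by linarith [hε n, hε2 n]⟩)]
  refine ⟨ge_of_tendsto' hR fun n => (hn n).1, ?_⟩
  rw [← hSU, setLIntegral_iUnion_of_directed _ hSmono.directed_le]
  refine iSup_le fun n => ?_
  refine ge_of_tendsto ((ENNReal.continuous_ofReal.tendsto _).comp hR) ?_
  filter_upwards [eventually_ge_atTop n] with m hm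
  exact (lintegral_mono_set (hSmono hm)).trans (hn m).2

section Evolution

variable {H : Type*} [NormedAddCommGroup H] [InnerProductSpace ℝ H]

/-- `u` solves the evolution variational inequality driven by the quadratic energy `q` on the set
`K`. The inequality is written with `2 b(u, u - φ) = q(u) - q(φ) + q(u - φ)`, where `b` is the
bilinear form of `q`, so that it makes sense for an arbitrary function `q`. -/
structure IsEVISolution (K : Set H) (q : H → ℝ) (T : ℝ) (f u : ℝ → H) : Prop where
  continuousOn : ContinuousOn u (Icc 0 T)
  absolutelyContinuous : ∀ a b, 0 < a → a < b → b < T → AbsolutelyContinuousOnInterval u a b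
  inequality : ∀ᵐ t ∂(volume.restrict (Ioo 0 T)), u t ∈ K ∧ ∃ u' : H, HasDerivAt u u' t ∧
    ∀ φ ∈ K, 2 * inner ℝ (u' - f t) (u t - φ) + q (u t) - q φ + q (u t - φ) ≤ 0

/-- A nonnegative function that is convex on the convex set `K` and coercive on differences of
elements of `K`. -/
structure IsEnergy (K : Set H) (q : H → ℝ) (c : ℝ) : Prop where
  pos : 0 < c
  nonneg : ∀ x, 0 ≤ q x
  coercive : ∀ x ∈ K, ∀ y ∈ K, c * ‖x - y‖ ^ 2 ≤ q (x - y)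
  symm : ∀ x, q (-x) = q x
  convex : ∀ x ∈ K, ∀ y ∈ K, ∀ θ ∈ Icc (0 : ℝ) 1, (1 - θ) • x + θ • y ∈ K ∧
    q ((1 - θ) • x + θ • y) ≤ (1 - θ) * q x + θ * q y

variable {K : Set H} {q : H → ℝ} {T c : ℝ} {f u : ℝ → H}

/-- A weighted form of Young's inequality. -/
lemma two_mul_le_half_add {c κ x : ℝ} (hc : 0 < c) : 2 * κ * x ≤ c * x ^ 2 / 2 + 2 * κ ^ 2 / c := by
  have : c * x ^ 2 / 2 + 2 * κ ^ 2 / c - 2 * κ * x = (c * x - 2 * κ) ^ 2 / (2 * c) := by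
    field_simp
    ring
  have h2 : 0 ≤ (c * x - 2 * κ) ^ 2 / (2 * c) := by positivity
  linarith

/-- The differential inequality for the error on one time step, at the time `t₁ - θ τ`: test the
continuous problem with the linear interpolant and the discrete problem with the solution. -/
lemma IsEnergy.error_inequality (hq : IsEnergy K q c) {U₀ U₁ v v' F g : H} {τ κ G θ : ℝ}
    (hU₀ : U₀ ∈ K) (hU₁ : U₁ ∈ K) (hv : v ∈ K) (hθ : θ ∈ Icc (0 : ℝ) 1) (hτ : 0 < τ)
    (hG : 0 ≤ G) (hGle : q U₀ - q U₁ - 2 * τ * inner ℝ (τ⁻¹ • (U₁ - U₀) - F) (τ⁻¹ • (U₁ - U₀)) ≤ G)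
    (hE : ∀ φ ∈ K, 2 * inner ℝ (v' - g) (v - φ) + q v - q φ + q (v - φ) ≤ 0)
    (hD : ∀ φ ∈ K, 2 * inner ℝ (τ⁻¹ • (U₁ - U₀) - F) (U₁ - φ) + q U₁ - q φ + q (U₁ - φ) ≤
      2 * κ * ‖U₁ - φ‖) :
    2 * inner ℝ (v' - τ⁻¹ • (U₁ - U₀)) (v - (U₁ - (θ * τ) • τ⁻¹ • (U₁ - U₀))) + q (v - U₁) / 2 ≤
      2 * inner ℝ (g - F) (v - (U₁ - (θ * τ) • τ⁻¹ • (U₁ - U₀))) + (G + 2 * κ ^ 2 / c) := by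
  set δ := τ⁻¹ • (U₁ - U₀) with hδ
  set w := U₁ - (θ * τ) • δ with hw
  -- The interpolant is a convex combination of the iterates, hence an admissible test function.
  have hwc : w = (1 - θ) • U₁ + θ • U₀ := by
    rw [hw, hδ, smul_smul, mul_assoc, mul_inv_cancel₀ hτ.ne', mul_one]
    module
  obtain ⟨hwK, hwq⟩ := hq.convex U₁ hU₁ U₀ hU₀ θ hθ
  rw [← hwc] at hwK hwq
  have h1 := hE w hwK
  have h2 := hD v hv
  have h3 : inner ℝ (δ - F) (U₁ - v) = inner ℝ (δ - F) (w - v) + θ * τ * inner ℝ (δ - F) δ := by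
    rw [← real_inner_smul_right, ← inner_add_right]
    congr 1
    rw [hw]
    abel
  have h4 : inner ℝ (v' - δ) (v - w) =
      inner ℝ (v' - g) (v - w) + inner ℝ (g - F) (v - w) + inner ℝ (δ - F) (w - v) := by
    rw [← neg_sub v w, inner_neg_right]
    simp only [inner_sub_left]
    ring
  have h5 : q (U₁ - v) = q (v - U₁) := by rw [← hq.symm, neg_sub]
  have h6 := hq.coercive v hv U₁ hU₁
  have h7 := two_mul_le_half_add (κ := κ) (x := ‖U₁ - v‖) hq.pos
  rw [norm_sub_rev] at h6
  have h8 := hq.nonneg (v - w)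
  have h9 : θ * (q U₀ - q U₁ - 2 * τ * inner ℝ (δ - F) δ) ≤ G :=
    (mul_le_mul_of_nonneg_left hGle hθ.1).trans (mul_le_of_le_one_left hG hθ.2)
  rw [h5] at h2
  rw [h4]
  linarith

/-- The error estimate on one time step. -/
lemma IsEVISolution.error_step (hu : IsEVISolution K q T f u) (hq : IsEnergy K q c)
    {U₀ U₁ F : H} {t₀ t₁ t κ G : ℝ} {B : ℝ → ℝ} (h0 : 0 ≤ t₀) (h01 : t₀ < t₁) (h1 : t₁ ≤ T)
    (ht : t ∈ Icc t₀ t₁) (hU₀ : U₀ ∈ K) (hU₁ : U₁ ∈ K) (hG : 0 ≤ G)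
    (hGle : q U₀ - q U₁ - 2 * (t₁ - t₀) * inner ℝ ((t₁ - t₀)⁻¹ • (U₁ - U₀) - F)
      ((t₁ - t₀)⁻¹ • (U₁ - U₀)) ≤ G)
    (hD : ∀ φ ∈ K, 2 * inner ℝ ((t₁ - t₀)⁻¹ • (U₁ - U₀) - F) (U₁ - φ) + q U₁ - q φ +
      q (U₁ - φ) ≤ 2 * κ * ‖U₁ - φ‖) {e : ℝ → H}
    (he : ∀ t, e t = u t - (U₁ - (t₁ - t) • (t₁ - t₀)⁻¹ • (U₁ - U₀)))
    (hB : IntervalIntegrable B volume t₀ t₁)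
    (hBf : ∀ᵐ r ∂(volume.restrict (Ioo t₀ t₁)), 2 * inner ℝ (f r - F) (e r) ≤ B r) :
    0 ≤ ‖e t₀‖ ^ 2 - ‖e t‖ ^ 2 + ((∫ r in t₀..t, B r) + (t - t₀) * (G + 2 * κ ^ 2 / c)) ∧
      ∫⁻ r in Ioo t₀ t, ENNReal.ofReal (q (u r - U₁) / 2) ≤ ENNReal.ofReal
        (‖e t₀‖ ^ 2 - ‖e t‖ ^ 2 + ((∫ r in t₀..t, B r) + (t - t₀) * (G + 2 * κ ^ 2 / c))) := by
  have hτ : 0 < t₁ - t₀ := sub_pos.2 h01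
  set δ := (t₁ - t₀)⁻¹ • (U₁ - U₀) with hδ
  have he' : e = u - fun t => U₁ - (t₁ - t) • δ := funext he
  have hld : ∀ t, HasDerivAt (fun t : ℝ => U₁ - (t₁ - t) • δ) δ t := fun t => by
    have := (((hasDerivAt_id t).const_sub t₁).smul_const δ).const_sub U₁
    simpa using this
  have hlc : ContDiff ℝ 1 fun t : ℝ => U₁ - (t₁ - t) • δ := by fun_prop
  have hec : ContinuousOn e (Icc t₀ t) := by
    rw [he']
    exact (hu.continuousOn.mono (Icc_subset_Icc h0 (ht.2.trans h1))).sub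
      hlc.continuous.continuousOn
  have hBt : IntervalIntegrable B volume t₀ t := by
    refine hB.mono_set ?_
    rw [uIcc_of_le ht.1, uIcc_of_le h01.le]
    exact Icc_subset_Icc_right ht.2
  have key := lintegral_le_of_deriv_add_le (g := fun t => ‖e t‖ ^ 2)
    (P := fun r => q (u r - U₁) / 2)
    (B := fun r => B r + (G + 2 * κ ^ 2 / c)) ht.1 (hec.norm.pow 2) ?_
    (hBt.add intervalIntegrable_const) ?_
  · rw [intervalIntegral.integral_add hBt intervalIntegrable_const,
      intervalIntegral.integral_const, smul_eq_mul] at key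
    exact key
  · intro a' b' ha hab hb
    refine AbsolutelyContinuousOnInterval.norm_sq ?_
    rw [he']
    exact (hu.absolutelyContinuous a' b' (by linarith) hab (by linarith [ht.2])).sub
      hlc.contDiffOn.absolutelyContinuousOnInterval
  · have hsub1 : Ioo t₀ t ⊆ Ioo 0 T := Ioo_subset_Ioo h0 (ht.2.trans h1)
    have hsub2 : Ioo t₀ t ⊆ Ioo t₀ t₁ := Ioo_subset_Ioo_right ht.2
    filter_upwards [ae_restrict_of_ae_restrict_of_subset hsub1 hu.inequality,
      ae_restrict_of_ae_restrict_of_subset hsub2 hBf, ae_restrict_mem measurableSet_Ioo]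
      with r hr hBr hrI
    obtain ⟨hrK, v', hv', hE⟩ := hr
    refine ⟨div_nonneg (hq.nonneg _) (by norm_num), 2 * inner ℝ (e r) (v' - δ), ?_, ?_⟩
    · rw [he']
      exact (hv'.sub (hld r)).norm_sq
    · have hθ : (t₁ - r) / (t₁ - t₀) ∈ Icc (0 : ℝ) 1 :=
        ⟨div_nonneg (by linarith [hrI.2, ht.2]) hτ.le, (div_le_one hτ).2 (by linarith [hrI.1])⟩
      have h3 := hq.error_inequality hU₀ hU₁ hrK hθ hτ hG hGle hE hD
      rw [div_mul_cancel₀ _ hτ.ne', ← hδ, ← he r] at h3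
      rw [real_inner_comm]
      linarith

end Evolution

/-! ### Error of an approximate backward Euler scheme -/

section Scheme

variable {H : Type*} [NormedAddCommGroup H] [InnerProductSpace ℝ H]

/-- The backward Euler scheme for the evolution variational inequality, with time step `τ`, discrete
forcing `F 1, …, F N` and a consistency error of size `κ`. -/
structure IsApproxScheme (K : Set H) (q : H → ℝ) (κ τ : ℝ) (N : ℕ) (F U : ℕ → H) : Prop where
  mem : ∀ k ≤ N, U k ∈ K
  inequality : ∀ k < N, ∀ φ ∈ K, 2 * inner ℝ (τ⁻¹ • (U (k + 1) - U k) - F (k + 1)) (U (k + 1) - φ) +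
    q (U (k + 1)) - q φ + q (U (k + 1) - φ) ≤ 2 * κ * ‖U (k + 1) - φ‖

/-- The linear interpolant on the time step `[k τ, (k + 1) τ]`. -/
def stepInterp (τ : ℝ) (U : ℕ → H) (k : ℕ) (t : ℝ) : H :=
  U (k + 1) - (((k : ℝ) + 1) * τ - t) • τ⁻¹ • (U (k + 1) - U k)

/-- The excess of the discrete energy balance over one time step. -/
def energyExcess (q : H → ℝ) (τ : ℝ) (F U : ℕ → H) (k : ℕ) : ℝ :=
  q (U k) - q (U (k + 1)) - 2 * τ *
    inner ℝ (τ⁻¹ • (U (k + 1) - U k) - F (k + 1)) (τ⁻¹ • (U (k + 1) - U k))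

variable {K : Set H} {q : H → ℝ} {T c κ τ : ℝ} {f u : ℝ → H} {N : ℕ} {F U : ℕ → H}

lemma continuous_stepInterp (τ : ℝ) (U : ℕ → H) (k : ℕ) : Continuous (stepInterp τ U k) := by
  unfold stepInterp; fun_prop

lemma stepInterp_left (hτ : 0 < τ) (U : ℕ → H) (k : ℕ) : stepInterp τ U k (k * τ) = U k := by
  rw [stepInterp, smul_smul, show (((k : ℝ) + 1) * τ - k * τ) * τ⁻¹ = 1 by field_simp; ring,
    one_smul, sub_sub_cancel]

lemma stepInterp_right (U : ℕ → H) (k : ℕ) :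
    stepInterp τ U k (((k : ℝ) + 1) * τ) = U (k + 1) := by
  rw [stepInterp, sub_self, zero_smul, sub_zero]

/-- The scheme dissipates energy up to the consistency error: test with the previous iterate. -/
lemma IsApproxScheme.energyExcess_nonneg (hU : IsApproxScheme K q κ τ N F U) (hq : IsEnergy K q c)
    (hτ : 0 < τ) {k : ℕ} (hk : k < N) : 0 ≤ energyExcess q τ F U k + 2 * κ ^ 2 / c := by
  have h1 := hU.inequality k hk _ (hU.mem k hk.le)
  have h2 := hq.coercive _ (hU.mem (k + 1) hk) _ (hU.mem k hk.le)
  have h3 := two_mul_le_half_add (κ := κ) (x := ‖U (k + 1) - U k‖) hq.pos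
  have h4 : 0 ≤ c * ‖U (k + 1) - U k‖ ^ 2 := by have := hq.pos; positivity
  have h5 : τ * inner ℝ (τ⁻¹ • (U (k + 1) - U k) - F (k + 1)) (τ⁻¹ • (U (k + 1) - U k)) =
      inner ℝ (τ⁻¹ • (U (k + 1) - U k) - F (k + 1)) (U (k + 1) - U k) := by
    rw [← real_inner_smul_right, smul_smul, mul_inv_cancel₀ hτ.ne', one_smul]
  rw [energyExcess, mul_assoc, h5]
  linarith

/-- The bound for the squared error that is collected until the time `m τ`; `B k` bounds the
contribution of the discretization of the forcing on the `k`-th time step. -/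
def errorSum (q : H → ℝ) (c κ τ : ℝ) (F U : ℕ → H) (B : ℕ → ℝ → ℝ) (m : ℕ) : ℝ :=
  ∑ k ∈ Finset.range m, ((∫ r in (k * τ)..(((k : ℝ) + 1) * τ), B k r) +
    τ * (energyExcess q τ F U k + 4 * κ ^ 2 / c))

/-- The error estimate within one time step of the scheme. -/
lemma IsEVISolution.error_scheme_step (hu : IsEVISolution K q T f u) (hq : IsEnergy K q c)
    (hU : IsApproxScheme K q κ τ N F U) (hτ : 0 < τ) (hT : N * τ = T) {B : ℕ → ℝ → ℝ}
    (hB : ∀ k < N, IntervalIntegrable (B k) volume (k * τ) (((k : ℝ) + 1) * τ))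
    (hBf : ∀ k < N, ∀ᵐ r ∂(volume.restrict (Ioo (k * τ) (((k : ℝ) + 1) * τ))),
      2 * inner ℝ (f r - F (k + 1)) (u r - stepInterp τ U k r) ≤ B k r) {k : ℕ} (hk : k < N)
    {t : ℝ} (ht : t ∈ Icc (k * τ) (((k : ℝ) + 1) * τ)) :
    0 ≤ ‖u (k * τ) - U k‖ ^ 2 - ‖u t - stepInterp τ U k t‖ ^ 2 +
        ((∫ r in (k * τ)..t, B k r) + (t - k * τ) * (energyExcess q τ F U k + 4 * κ ^ 2 / c)) ∧
      ∫⁻ r in Ioo (k * τ) t, ENNReal.ofReal (q (u r - U (k + 1)) / 2) ≤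
        ENNReal.ofReal (‖u (k * τ) - U k‖ ^ 2 - ‖u t - stepInterp τ U k t‖ ^ 2 +
          ((∫ r in (k * τ)..t, B k r) +
            (t - k * τ) * (energyExcess q τ F U k + 4 * κ ^ 2 / c))) := by
  have e1 : ((k : ℝ) + 1) * τ - k * τ = τ := by ring
  have hkN : ((k : ℝ) + 1) * τ ≤ T := by
    rw [← hT]
    gcongr
    exact_mod_cast hk
  have e2 : energyExcess q τ F U k + 4 * κ ^ 2 / c =
      energyExcess q τ F U k + 2 * κ ^ 2 / c + 2 * κ ^ 2 / c := by ring
  have h := hu.error_step hq (U₀ := U k) (U₁ := U (k + 1)) (F := F (k + 1)) (t₀ := k * τ)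
    (t₁ := ((k : ℝ) + 1) * τ) (κ := κ) (e := fun t => u t - stepInterp τ U k t) (by positivity)
    (by linarith) hkN ht (hU.mem k hk.le) (hU.mem (k + 1) hk)
    (hU.energyExcess_nonneg hq hτ hk) (by
      rw [e1]
      have := hq.pos
      have h2 : 0 ≤ 2 * κ ^ 2 / c := by positivity
      rw [energyExcess]
      linarith) (by rw [e1]; exact hU.inequality k hk) (fun t => by rw [e1, stepInterp])
    (hB k hk) (hBf k hk)
  rw [stepInterp_left hτ] at h
  rw [e2]
  exact h

/-- The error estimate at the nodes, by summation over the time steps. -/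
lemma IsEVISolution.error_scheme_node (hu : IsEVISolution K q T f u) (hq : IsEnergy K q c)
    (hU : IsApproxScheme K q κ τ N F U) (hτ : 0 < τ) (hT : N * τ = T) (hu0 : u 0 = U 0)
    {B : ℕ → ℝ → ℝ} (hB : ∀ k < N, IntervalIntegrable (B k) volume (k * τ) (((k : ℝ) + 1) * τ))
    (hBf : ∀ k < N, ∀ᵐ r ∂(volume.restrict (Ioo (k * τ) (((k : ℝ) + 1) * τ))),
      2 * inner ℝ (f r - F (k + 1)) (u r - stepInterp τ U k r) ≤ B k r) {m : ℕ} (hm : m ≤ N) :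
    0 ≤ errorSum q c κ τ F U B m - ‖u (m * τ) - U m‖ ^ 2 ∧
      ∑ k ∈ Finset.range m, ∫⁻ r in Ioo (k * τ) (((k : ℝ) + 1) * τ),
        ENNReal.ofReal (q (u r - U (k + 1)) / 2) ≤
        ENNReal.ofReal (errorSum q c κ τ F U B m - ‖u (m * τ) - U m‖ ^ 2) := by
  induction m with
  | zero => simp [errorSum, hu0]
  | succ m ih =>
    obtain ⟨i1, i2⟩ := ih (by omega)
    have hmτ : (m : ℝ) * τ ≤ ((m : ℝ) + 1) * τ := by nlinarith
    obtain ⟨j1, j2⟩ := hu.error_scheme_step hq hU hτ hT hB hBf (k := m) (by omega)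
      (right_mem_Icc.2 hmτ)
    rw [stepInterp_right, show ((m : ℝ) + 1) * τ - m * τ = τ by ring] at j1 j2
    have e : errorSum q c κ τ F U B (m + 1) - ‖u (((m : ℝ) + 1) * τ) - U (m + 1)‖ ^ 2 =
        (errorSum q c κ τ F U B m - ‖u (m * τ) - U m‖ ^ 2) +
        (‖u (m * τ) - U m‖ ^ 2 - ‖u (((m : ℝ) + 1) * τ) - U (m + 1)‖ ^ 2 +
          ((∫ r in (m * τ)..(((m : ℝ) + 1) * τ), B m r) +
            τ * (energyExcess q τ F U m + 4 * κ ^ 2 / c))) := by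
      rw [errorSum, errorSum, Finset.sum_range_succ]
      ring
    push_cast
    rw [e, Finset.sum_range_succ, ENNReal.ofReal_add i1 j1]
    exact ⟨add_nonneg i1 j1, add_le_add i2 j2⟩

/-- The error of the piecewise linear interpolant attains its maximum. -/
lemma exists_isMax_error (hu : ContinuousOn u (Icc 0 T)) (hτ : 0 < τ) (hT : N * τ = T)
    (hN : 0 < N) (U : ℕ → H) : ∃ m < N, ∃ t ∈ Icc (m * τ) (((m : ℝ) + 1) * τ),
      ∀ k < N, ∀ r ∈ Icc (k * τ) (((k : ℝ) + 1) * τ),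
        ‖u r - stepInterp τ U k r‖ ≤ ‖u t - stepInterp τ U m t‖ := by
  have h1 : ∀ k : ℕ, ∃ t, k < N → t ∈ Icc (k * τ) (((k : ℝ) + 1) * τ) ∧
      ∀ r ∈ Icc (k * τ) (((k : ℝ) + 1) * τ),
        ‖u r - stepInterp τ U k r‖ ≤ ‖u t - stepInterp τ U k t‖ := fun k => by
    by_cases hk : k < N
    · have hkN : ((k : ℝ) + 1) * τ ≤ T := by
        rw [← hT]
        gcongr
        exact_mod_cast hk
      have hc : ContinuousOn (fun r => ‖u r - stepInterp τ U k r‖)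
          (Icc (k * τ) (((k : ℝ) + 1) * τ)) :=
        ((hu.mono (Icc_subset_Icc (by positivity) hkN)).sub
          (continuous_stepInterp τ U k).continuousOn).norm
      obtain ⟨t, ht, hmax⟩ := isCompact_Icc.exists_isMaxOn
        (nonempty_Icc.2 (by nlinarith : (k : ℝ) * τ ≤ ((k : ℝ) + 1) * τ)) hc
      exact ⟨t, fun _ => ⟨ht, fun r hr => hmax hr⟩⟩
    · exact ⟨0, fun h => absurd h hk⟩
  choose t ht using h1
  obtain ⟨m, hm, hmax⟩ := Finset.exists_max_image (Finset.range N)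
    (fun k => ‖u (t k) - stepInterp τ U k (t k)‖) ⟨0, by simpa using hN⟩
  have hmN := Finset.mem_range.1 hm
  exact ⟨m, hmN, t m, (ht m hmN).1, fun k hk r hr =>
    ((ht k hk).2 r hr).trans (hmax k (Finset.mem_range.2 hk))⟩

/-- The energy excess, for data of bounded variation: it telescopes up to the variation of the
forcing. Here `δ₀` plays the role of the time derivative at the initial value. -/
lemma IsApproxScheme.sum_energyExcess_le (hU : IsApproxScheme K q κ τ N F U) (hq : IsEnergy K q c)
    (hτ : 0 < τ) (hκ : 0 ≤ κ) (hT : N * τ = T) {b : ℕ → ℝ}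
    (hb : ∀ k < N, ‖F (k + 1) - F k‖ ≤ b k) {δ₀ : H}
    (h0 : ∀ φ ∈ K, 2 * inner ℝ (δ₀ - F 0) (U 0 - φ) + q (U 0) - q φ + q (U 0 - φ) ≤ 0) :
    ∑ k ∈ Finset.range N, τ * energyExcess q τ F U k ≤
      5 * (τ * (‖δ₀‖ + ∑ k ∈ Finset.range N, b k)) ^ 2 + (2 * T ^ 2 + 2 * T / c) * κ ^ 2 := by
  have hc := hq.pos
  let δ : ℕ → H := fun k => Nat.casesOn k δ₀ fun k => τ⁻¹ • (U (k + 1) - U k)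
  have hδ : ∀ k, δ (k + 1) = τ⁻¹ • (U (k + 1) - U k) := fun k => rfl
  have hδU : ∀ k, U (k + 1) - U k = τ • δ (k + 1) := fun k => by
    rw [hδ, smul_smul, mul_inv_cancel₀ hτ.ne', one_smul]
  have hin : ∀ k ≤ N, ∀ φ ∈ K, 2 * inner ℝ (δ k - F k) (U k - φ) + q (U k) - q φ + q (U k - φ) ≤
      2 * κ * ‖U k - φ‖ := fun k hk φ hφ => by
    cases k with
    | zero => exact (h0 φ hφ).trans (by positivity)
    | succ k => exact hU.inequality k hk φ hφ
  have hb0 : ∀ k < N, 0 ≤ b k := fun k hk => (norm_nonneg _).trans (hb k hk)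
  -- the inequality at step `k`, tested with the next iterate
  have hprev : ∀ k < N, -(2 * τ) * inner ℝ (δ k - F k) (δ (k + 1)) + q (U k) - q (U (k + 1)) +
      c * (τ * ‖δ (k + 1)‖) ^ 2 ≤ 2 * κ * (τ * ‖δ (k + 1)‖) := fun k hk => by
    have h1 := hin k hk.le _ (hU.mem (k + 1) hk)
    have h2 := hq.coercive _ (hU.mem k hk.le) _ (hU.mem (k + 1) hk)
    have e : U k - U (k + 1) = -(τ • δ (k + 1)) := by rw [← hδU, neg_sub]
    rw [e, norm_neg, norm_smul, Real.norm_of_nonneg hτ.le] at h1 h2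
    rw [inner_neg_right, real_inner_smul_right] at h1
    linarith
  -- the inequality at step `k + 1`, tested with the previous iterate
  have hnext : ∀ k < N, 2 * τ * inner ℝ (δ (k + 1) - F (k + 1)) (δ (k + 1)) + q (U (k + 1)) -
      q (U k) + c * (τ * ‖δ (k + 1)‖) ^ 2 ≤ 2 * κ * (τ * ‖δ (k + 1)‖) := fun k hk => by
    have h1 := hin (k + 1) hk _ (hU.mem k hk.le)
    have h2 := hq.coercive _ (hU.mem (k + 1) hk) _ (hU.mem k hk.le)
    rw [hδU, norm_smul, Real.norm_of_nonneg hτ.le] at h1 h2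
    rw [real_inner_smul_right] at h1
    linarith
  have hinner : ∀ k < N, inner ℝ (δ k - F k) (δ (k + 1)) - inner ℝ (δ (k + 1) - F (k + 1))
      (δ (k + 1)) ≤ inner ℝ (δ k) (δ (k + 1)) - ‖δ (k + 1)‖ ^ 2 + b k * ‖δ (k + 1)‖ :=
    fun k hk => by
      have h1 := (real_inner_le_norm (F (k + 1) - F k) (δ (k + 1))).trans
        (mul_le_mul_of_nonneg_right (hb k hk) (norm_nonneg _))
      simp only [inner_sub_left, real_inner_self_eq_norm_sq] at h1 ⊢
      linarith
  -- The two inequalities together bound the growth of the discrete time derivative.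
  have hgrow : ∀ k < N, ‖δ (k + 1)‖ ≤ ‖δ k‖ + b k + 2 * κ := fun k hk => by
    have h1 := hprev k hk
    have h2 := hnext k hk
    have h3 := hinner k hk
    have h4 := real_inner_le_norm (δ k) (δ (k + 1))
    rcases eq_or_ne (δ (k + 1)) 0 with h | h
    · rw [h, norm_zero]
      have := hb0 k hk
      positivity
    · have hp : 0 < ‖δ (k + 1)‖ := norm_pos_iff.2 h
      have h5 : 0 ≤ c * (τ * ‖δ (k + 1)‖) ^ 2 := by positivity
      have h6 : τ * (‖δ (k + 1)‖ * ‖δ (k + 1)‖) ≤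
          τ * ((‖δ k‖ + b k + 2 * κ) * ‖δ (k + 1)‖) := by
        have h7 := mul_le_mul_of_nonneg_left (h3.trans (by linarith :
          _ ≤ ‖δ k‖ * ‖δ (k + 1)‖ - ‖δ (k + 1)‖ ^ 2 + b k * ‖δ (k + 1)‖)) hτ.le
        nlinarith
      exact le_of_mul_le_mul_right (le_of_mul_le_mul_left h6 hτ) hp
  set b' := ∑ k ∈ Finset.range N, b k with hb'
  have hpart : ∀ k ≤ N, ∑ j ∈ Finset.range k, b j ≤ b' := fun k hk =>
    Finset.sum_le_sum_of_subset_of_nonneg (by simpa using hk)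
      fun j hj _ => hb0 j (Finset.mem_range.1 hj)
  have hδn : ∀ k ≤ N, ‖δ k‖ ≤ ‖δ₀‖ + ∑ j ∈ Finset.range k, b j + 2 * κ * k := fun k => by
    induction k with
    | zero => intro _; simp [δ]
    | succ k ih =>
      intro hk
      have h1 := hgrow k hk
      have h2 := ih (by omega)
      rw [Finset.sum_range_succ]
      push_cast
      linarith
  set A := τ * (‖δ₀‖ + b') with hA
  have hT0 : 0 ≤ T := by rw [← hT]; positivity
  have hδA : ∀ k ≤ N, τ * ‖δ k‖ ≤ A + 2 * T * κ := fun k hk => by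
    have h1 := (hδn k hk).trans (add_le_add_left (add_le_add_right (hpart k hk) _) _)
    have h2 : (k : ℝ) * τ ≤ T := by
      rw [← hT]
      gcongr
    calc τ * ‖δ k‖ ≤ τ * (‖δ₀‖ + b' + 2 * κ * k) := by gcongr
      _ = A + 2 * (k * τ) * κ := by rw [hA]; ring
      _ ≤ _ := by gcongr
  have hex : ∀ k < N, τ * energyExcess q τ F U k ≤ τ ^ 2 * (‖δ k‖ ^ 2 - ‖δ (k + 1)‖ ^ 2) +
      2 * τ * b k * (A + 2 * T * κ) + τ * (2 * κ ^ 2 / c) := fun k hk => by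
    have h1 := hprev k hk
    have h3 := hinner k hk
    have h4 := real_inner_le_norm (δ k) (δ (k + 1))
    have h5 := two_mul_le_half_add (κ := κ) (x := τ * ‖δ (k + 1)‖) hc
    have h6 : 0 ≤ c * (τ * ‖δ (k + 1)‖) ^ 2 := by positivity
    have h7 := mul_le_mul_of_nonneg_left (hδA (k + 1) hk) (hb0 k hk)
    have h8 : 2 * inner ℝ (δ k) (δ (k + 1)) ≤ ‖δ k‖ ^ 2 + ‖δ (k + 1)‖ ^ 2 := by
      nlinarith [sq_nonneg (‖δ k‖ - ‖δ (k + 1)‖)]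
    have h9 : energyExcess q τ F U k ≤ τ * (‖δ k‖ ^ 2 - ‖δ (k + 1)‖ ^ 2) +
        2 * (b k * (τ * ‖δ (k + 1)‖)) + 2 * κ ^ 2 / c := by
      rw [energyExcess, ← hδ]
      have h10 : τ * (2 * inner ℝ (δ k - F k) (δ (k + 1)) - 2 * inner ℝ (δ (k + 1) - F (k + 1))
          (δ (k + 1))) ≤ τ * (‖δ k‖ ^ 2 - ‖δ (k + 1)‖ ^ 2 + 2 * (b k * ‖δ (k + 1)‖)) := by
        gcongr
        linarith
      linarith
    calc τ * energyExcess q τ F U k ≤ τ * (τ * (‖δ k‖ ^ 2 - ‖δ (k + 1)‖ ^ 2) +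
        2 * (b k * (A + 2 * T * κ)) + 2 * κ ^ 2 / c) := by gcongr; linarith
      _ = _ := by ring
  refine (Finset.sum_le_sum fun k hk => hex k (Finset.mem_range.1 hk)).trans ?_
  rw [Finset.sum_add_distrib, Finset.sum_add_distrib, ← Finset.mul_sum, Finset.sum_range_sub',
    ← Finset.sum_mul, ← Finset.mul_sum, ← hb', Finset.sum_const, Finset.card_range, nsmul_eq_mul,
    ← mul_assoc (N : ℝ), hT]
  have hb'0 : 0 ≤ b' := Finset.sum_nonneg fun k hk => hb0 k (Finset.mem_range.1 hk)
  have h1 : τ * ‖δ₀‖ ≤ A := by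
    rw [hA]; gcongr; linarith
  have h2 : τ * b' ≤ A := by
    rw [hA]; gcongr; linarith [norm_nonneg δ₀]
  have hA0 : 0 ≤ A := by positivity
  have h3 : τ ^ 2 * (‖δ 0‖ ^ 2 - ‖δ N‖ ^ 2) ≤ A ^ 2 := by
    have : (τ * ‖δ₀‖) ^ 2 ≤ A ^ 2 := by gcongr
    have h4 : 0 ≤ τ ^ 2 * ‖δ N‖ ^ 2 := by positivity
    have h5 : ‖δ 0‖ = ‖δ₀‖ := rfl
    rw [h5]
    linarith [mul_pow τ ‖δ₀‖ 2]
  have h4 : 2 * τ * b' * (A + 2 * T * κ) ≤ 2 * A * (A + 2 * T * κ) := by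
    have : τ * b' * (A + 2 * T * κ) ≤ A * (A + 2 * T * κ) := by gcongr
    linarith
  have h5 : 4 * T * A * κ ≤ 2 * A ^ 2 + 2 * T ^ 2 * κ ^ 2 := by nlinarith [sq_nonneg (A - T * κ)]
  have h6 : T * (2 * κ ^ 2 / c) = 2 * T / c * κ ^ 2 := by ring
  rw [h6]
  nlinarith

end Scheme

/-! ### The error for forcing terms of bounded variation -/

section BoundedVariation

variable {H : Type*} [NormedAddCommGroup H] [InnerProductSpace ℝ H]
  {K : Set H} {q : H → ℝ} {T c κ τ : ℝ} {f u : ℝ → H} {N : ℕ} {F U : ℕ → H}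

/-- First order convergence, if the forcing varies by at most `b k` on the `k`-th time step. -/
theorem IsEVISolution.error_of_variation (hu : IsEVISolution K q T f u) (hq : IsEnergy K q c)
    (hU : IsApproxScheme K q κ τ N F U) (hτ : 0 < τ) (hκ : 0 ≤ κ) (hT : N * τ = T) (hN : 0 < N)
    (hu0 : u 0 = U 0) {b : ℕ → ℝ} (hb : ∀ k < N, ‖F (k + 1) - F k‖ ≤ b k)
    (hfb : ∀ k < N, ∀ r ∈ Ioo (k * τ) (((k : ℝ) + 1) * τ), ‖f r - F (k + 1)‖ ≤ b k) {δ₀ : H}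
    (h0 : ∀ φ ∈ K, 2 * inner ℝ (δ₀ - F 0) (U 0 - φ) + q (U 0) - q φ + q (U 0 - φ) ≤ 0) {D : ℝ}
    (hD : D = 2 * (5 + √(2 * T ^ 2 + 6 * T / c)) *
      (τ * (‖δ₀‖ + ∑ k ∈ Finset.range N, b k) + κ)) :
    (∀ k < N, ∀ t ∈ Icc (k * τ) (((k : ℝ) + 1) * τ), ‖u t - stepInterp τ U k t‖ ≤ D) ∧
      ∑ k ∈ Finset.range N, ∫⁻ r in Ioo (k * τ) (((k : ℝ) + 1) * τ),
        ENNReal.ofReal (q (u r - U (k + 1)) / 2) ≤ ENNReal.ofReal (D ^ 2) := by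
  have hc := hq.pos
  have hT0 : 0 ≤ T := by rw [← hT]; positivity
  have hb0 : ∀ k < N, 0 ≤ b k := fun k hk => (norm_nonneg _).trans (hb k hk)
  have hb'0 : 0 ≤ ∑ k ∈ Finset.range N, b k :=
    Finset.sum_nonneg fun k hk => hb0 k (Finset.mem_range.1 hk)
  obtain ⟨m, hm, t, ht, hmax⟩ := exists_isMax_error hu.continuousOn hτ hT hN U
  -- The forcing enters linearly in the maximal error `M`, so `M` satisfies a quadratic inequality.
  set M := ‖u t - stepInterp τ U m t‖ with hM
  have hM0 : 0 ≤ M := norm_nonneg _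
  let B : ℕ → ℝ → ℝ := fun k _ => 2 * (b k * M)
  have hB : ∀ k < N, IntervalIntegrable (B k) volume (k * τ) (((k : ℝ) + 1) * τ) :=
    fun k _ => intervalIntegrable_const
  have hBf : ∀ k < N, ∀ᵐ r ∂(volume.restrict (Ioo (k * τ) (((k : ℝ) + 1) * τ))),
      2 * inner ℝ (f r - F (k + 1)) (u r - stepInterp τ U k r) ≤ B k r := fun k hk => by
    refine (ae_restrict_mem measurableSet_Ioo).mono fun r hr => ?_
    refine mul_le_mul_of_nonneg_left ((real_inner_le_norm _ _).trans ?_) zero_le_two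
    exact mul_le_mul (hfb k hk r hr) (hmax k hk r (Ioo_subset_Icc_self hr)) (norm_nonneg _)
      (hb0 k hk)
  set A := τ * (‖δ₀‖ + ∑ k ∈ Finset.range N, b k) with hA
  have hA0 : 0 ≤ A := by positivity
  set R := 2 * T ^ 2 + 6 * T / c with hR
  have hR0 : 0 ≤ R := by positivity
  have hG : ∀ k < N, 0 ≤ energyExcess q τ F U k + 4 * κ ^ 2 / c := fun k hk => by
    have := hU.energyExcess_nonneg hq hτ hk
    have h2 : 0 ≤ 2 * κ ^ 2 / c := by positivity
    have e : 4 * κ ^ 2 / c = 2 * κ ^ 2 / c + 2 * κ ^ 2 / c := by ring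
    linarith
  have hterm : ∀ k : ℕ, ∫ r in (k * τ)..(((k : ℝ) + 1) * τ), B k r =
      2 * M * (τ * b k) := fun k => by
    rw [intervalIntegral.integral_const, smul_eq_mul]
    ring
  have hX : errorSum q c κ τ F U B N ≤ 2 * A * M + (5 * A ^ 2 + R * κ ^ 2) := by
    have h1 := hU.sum_energyExcess_le hq hτ hκ hT hb h0
    have h2 : errorSum q c κ τ F U B N = 2 * (τ * ∑ k ∈ Finset.range N, b k) * M +
        ∑ k ∈ Finset.range N, τ * energyExcess q τ F U k + T * (4 * κ ^ 2 / c) := by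
      simp only [errorSum, hterm, mul_add]
      rw [Finset.sum_add_distrib, Finset.sum_add_distrib, Finset.sum_const, Finset.card_range,
        nsmul_eq_mul, ← mul_assoc (N : ℝ), hT, ← Finset.mul_sum, ← Finset.mul_sum]
      ring
    have h3 : τ * ∑ k ∈ Finset.range N, b k ≤ A := by
      rw [hA]; gcongr; linarith [norm_nonneg δ₀]
    have h4 : 2 * (τ * ∑ k ∈ Finset.range N, b k) * M ≤ 2 * A * M := by gcongr
    have h5 : R * κ ^ 2 = (2 * T ^ 2 + 2 * T / c) * κ ^ 2 + T * (4 * κ ^ 2 / c) := by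
      rw [hR]; ring
    rw [h2, h5]
    linarith
  have hM2 : M ^ 2 ≤ errorSum q c κ τ F U B N := by
    have h1 := (hu.error_scheme_node hq hU hτ hT hu0 hB hBf hm.le).1
    have h2 := (hu.error_scheme_step hq hU hτ hT hB hBf hm ht).1
    have h3 : (∫ r in (m * τ)..t, B m r) + (t - m * τ) * (energyExcess q τ F U m + 4 * κ ^ 2 / c) ≤
        (∫ r in (m * τ)..(((m : ℝ) + 1) * τ), B m r) +
          τ * (energyExcess q τ F U m + 4 * κ ^ 2 / c) := by
      rw [hterm, intervalIntegral.integral_const, smul_eq_mul]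
      have h4 : t - m * τ ≤ τ := by linarith [ht.2]
      have h5 := hG m hm
      have h6 : 0 ≤ b m * M := mul_nonneg (hb0 m hm) hM0
      have h7 := mul_le_mul_of_nonneg_right h4 h5
      have h8 := mul_le_mul_of_nonneg_right h4 h6
      linarith
    have h4 : errorSum q c κ τ F U B (m + 1) ≤ errorSum q c κ τ F U B N := by
      refine Finset.sum_le_sum_of_subset_of_nonneg (by simpa using hm) fun k hk _ => ?_
      have hk := Finset.mem_range.1 hk
      rw [hterm]
      have := hG k hk
      have := hb0 k hk
      positivity
    rw [errorSum, Finset.sum_range_succ, ← errorSum] at h4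
    linarith
  have hX0 : 0 ≤ 5 * A ^ 2 + R * κ ^ 2 := by positivity
  have hML := le_add_sqrt_of_sq_le hA0 hX0 (hM2.trans hX)
  have hsq : √(5 * A ^ 2 + R * κ ^ 2) ≤ 3 * A + √R * κ := by
    refine Real.sqrt_le_iff.2 ⟨by positivity, ?_⟩
    have : 0 ≤ A * (√R * κ) := by positivity
    nlinarith [Real.sq_sqrt hR0]
  have hr : 0 ≤ √R := Real.sqrt_nonneg R
  have hMD' : M ≤ (5 + √R) * (A + κ) := by
    have h1 := mul_nonneg hr hA0
    linarith
  have hAκ : 0 ≤ A + κ := by positivity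
  have hMD : M ≤ D := by
    rw [hD]
    have := mul_nonneg (by positivity : 0 ≤ 5 + √R) hAκ
    linarith
  refine ⟨fun k hk r hr => (hmax k hk r hr).trans hMD, ?_⟩
  refine (hu.error_scheme_node hq hU hτ hT hu0 hB hBf le_rfl).2.trans
    (ENNReal.ofReal_le_ofReal ?_)
  have h1 : 0 ≤ ‖u (N * τ) - U N‖ ^ 2 := by positivity
  have h2 : 2 * A * M ≤ A ^ 2 + M ^ 2 := by nlinarith [sq_nonneg (A - M)]
  have h3 : M ^ 2 ≤ ((5 + √R) * (A + κ)) ^ 2 := by gcongr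
  have h4 : R * κ ^ 2 ≤ R * (A + κ) ^ 2 := by gcongr; linarith
  have h5 : A ^ 2 ≤ (A + κ) ^ 2 := by gcongr; linarith
  have h6 : D ^ 2 = 4 * ((5 + √R) * (A + κ)) ^ 2 := by rw [hD]; ring
  have h7 : ((5 + √R) * (A + κ)) ^ 2 = (25 + 10 * √R + R) * (A + κ) ^ 2 := by
    rw [mul_pow, add_sq, Real.sq_sqrt hR0]; ring
  have h8 : 0 ≤ √R * (A + κ) ^ 2 := by positivity
  have h9 : 0 ≤ R * (A + κ) ^ 2 := by positivity
  rw [h7] at h3 h6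
  nlinarith

end BoundedVariation

/-! ### The error for square integrable forcing terms -/

lemma sq_integral_le {g : ℝ → ℝ} {a b : ℝ} (hab : a < b) (h1 : IntervalIntegrable g volume a b)
    (h2 : IntervalIntegrable (fun t => g t ^ 2) volume a b) :
    (∫ t in a..b, g t) ^ 2 ≤ (b - a) * ∫ t in a..b, g t ^ 2 := by
  have hba : 0 < b - a := sub_pos.2 hab
  set m := (b - a)⁻¹ * ∫ t in a..b, g t with hm
  have hI : ∫ t in a..b, g t = (b - a) * m := by rw [hm, mul_inv_cancel_left₀ hba.ne']
  have h3 : 0 ≤ ∫ t in a..b, (g t - m) ^ 2 :=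
    intervalIntegral.integral_nonneg hab.le fun t _ => sq_nonneg _
  have e : ∀ t, (g t - m) ^ 2 = g t ^ 2 - 2 * m * g t + m ^ 2 := fun t => by ring
  simp only [e] at h3
  rw [intervalIntegral.integral_add (h2.sub (h1.const_mul _)) intervalIntegrable_const,
    intervalIntegral.integral_sub h2 (h1.const_mul _), intervalIntegral.integral_const_mul,
    intervalIntegral.integral_const, smul_eq_mul, hI] at h3
  rw [hI]
  nlinarith

section SquareIntegrable

variable {H : Type*} [NormedAddCommGroup H] [InnerProductSpace ℝ H]
  {K : Set H} {q : H → ℝ} {T c κ τ : ℝ} {f u : ℝ → H} {N : ℕ} {F U : ℕ → H}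

lemma step_mem_Icc (hτ : 0 < τ) (hT : N * τ = T) {k : ℕ} (hk : k < N) :
    0 ≤ (k : ℝ) * τ ∧ (k : ℝ) * τ < ((k : ℝ) + 1) * τ ∧ ((k : ℝ) + 1) * τ ≤ T := by
  refine ⟨by positivity, by linarith, ?_⟩
  rw [← hT]
  gcongr
  exact_mod_cast hk

lemma intervalIntegrable_of_memLp {X : Type*} [NormedAddCommGroup X] {g : ℝ → X} {a b : ℝ}
    (hg : MemLp g 2 (volume.restrict (Ioo 0 T))) (ha : 0 ≤ a) (hab : a ≤ b) (hb : b ≤ T) :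
    IntervalIntegrable g volume a b := by
  have h1 : IntegrableOn g (Ioo 0 T) := hg.integrable (by norm_num)
  rw [intervalIntegrable_iff_integrableOn_Ioc_of_le hab, integrableOn_Ioc_iff_integrableOn_Ioo]
  exact h1.mono_set (Ioo_subset_Ioo ha hb)

lemma intervalIntegrable_norm_sq_of_memLp {X : Type*} [NormedAddCommGroup X] {g : ℝ → X} {a b : ℝ}
    (hg : MemLp g 2 (volume.restrict (Ioo 0 T))) (ha : 0 ≤ a) (hab : a ≤ b) (hb : b ≤ T) :
    IntervalIntegrable (fun t => ‖g t‖ ^ 2) volume a b := by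
  have h1 : IntegrableOn (fun t => ‖g t‖ ^ 2) (Ioo 0 T) := hg.integrable_norm_pow (p := 2) (by simp)
  rw [intervalIntegrable_iff_integrableOn_Ioc_of_le hab, integrableOn_Ioc_iff_integrableOn_Ioo]
  exact h1.mono_set (Ioo_subset_Ioo ha hb)

lemma sq_integral_norm_le_of_memLp {X : Type*} [NormedAddCommGroup X] {g : ℝ → X} {a b : ℝ}
    (hg : MemLp g 2 (volume.restrict (Ioo 0 T))) (ha : 0 ≤ a) (hab : a < b) (hb : b ≤ T) :
    (∫ t in a..b, ‖g t‖) ^ 2 ≤ (b - a) * ∫ t in a..b, ‖g t‖ ^ 2 :=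
  sq_integral_le hab (intervalIntegrable_of_memLp hg ha hab.le hb).norm
    (intervalIntegrable_norm_sq_of_memLp hg ha hab.le hb)

lemma sum_integral_steps (hτ : 0 < τ) (hT : N * τ = T) {g : ℝ → ℝ}
    (hg : ∀ a b, 0 ≤ a → a ≤ b → b ≤ T → IntervalIntegrable g volume a b) :
    ∑ k ∈ Finset.range N, ∫ t in (k * τ)..(((k : ℝ) + 1) * τ), g t = ∫ t in (0)..T, g t := by
  have h := intervalIntegral.sum_integral_adjacent_intervals (f := g) (μ := volume)
    (a := fun k : ℕ => (k : ℝ) * τ) (n := N) fun k hk => by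
      obtain ⟨h1, h2, h3⟩ := step_mem_Icc hτ hT hk
      push_cast
      exact hg _ _ h1 h2.le h3
  push_cast at h
  rw [h, zero_mul, hT]

/-- The energy estimate for one step of the scheme. -/
lemma IsApproxScheme.mul_norm_sq_le (hU : IsApproxScheme K q κ τ N F U) (hq : IsEnergy K q c)
    (hτ : 0 < τ) {k : ℕ} (hk : k < N) :
    τ * ‖τ⁻¹ • (U (k + 1) - U k)‖ ^ 2 ≤
      τ * ‖F (k + 1)‖ ^ 2 + (q (U k) - q (U (k + 1))) + 2 * κ ^ 2 / c := by
  have h1 := hU.energyExcess_nonneg hq hτ hk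
  rw [energyExcess, inner_sub_left, real_inner_self_eq_norm_sq] at h1
  set δ := τ⁻¹ • (U (k + 1) - U k)
  have h2 : 2 * inner ℝ (F (k + 1)) δ ≤ ‖F (k + 1)‖ ^ 2 + ‖δ‖ ^ 2 := by
    have := real_inner_le_norm (F (k + 1)) δ
    nlinarith [sq_nonneg (‖F (k + 1)‖ - ‖δ‖)]
  have h3 := mul_le_mul_of_nonneg_left h2 hτ.le
  linarith

lemma energyExcess_le (hτ : 0 < τ) (k : ℕ) :
    energyExcess q τ F U k ≤ q (U k) - q (U (k + 1)) + τ * ‖F (k + 1)‖ ^ 2 := by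
  rw [energyExcess, inner_sub_left, real_inner_self_eq_norm_sq]
  set δ := τ⁻¹ • (U (k + 1) - U k)
  have h2 : 2 * inner ℝ (F (k + 1)) δ - 2 * ‖δ‖ ^ 2 ≤ ‖F (k + 1)‖ ^ 2 := by
    have := real_inner_le_norm (F (k + 1)) δ
    nlinarith [sq_nonneg (‖F (k + 1)‖ - ‖δ‖), sq_nonneg ‖δ‖]
  have h3 := mul_le_mul_of_nonneg_left h2 hτ.le
  linarith

lemma norm_stepInterp_sub_le (hτ : 0 < τ) {k : ℕ} {t : ℝ}
    (ht : t ∈ Icc (k * τ) (((k : ℝ) + 1) * τ)) :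
    ‖stepInterp τ U k t - U k‖ ≤ τ * ‖τ⁻¹ • (U (k + 1) - U k)‖ := by
  have e : stepInterp τ U k t - U k = (t - k * τ) • τ⁻¹ • (U (k + 1) - U k) := by
    have h2 : U (k + 1) - U k = τ • τ⁻¹ • (U (k + 1) - U k) := by
      rw [smul_smul, mul_inv_cancel₀ hτ.ne', one_smul]
    have h1 : stepInterp τ U k t - U k =
        (U (k + 1) - U k) - (((k : ℝ) + 1) * τ - t) • τ⁻¹ • (U (k + 1) - U k) := by
      rw [stepInterp]; abel
    rw [h1]
    nth_rewrite 1 [h2]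
    rw [← sub_smul]
    congr 1
    ring
  rw [e, norm_smul, Real.norm_of_nonneg (by linarith [ht.1])]
  gcongr
  linarith [ht.2]

variable [CompleteSpace H]

/-- On each time step the forcing is tested only with the oscillation of the error, since the
discrete forcing is its mean value. -/
lemma integral_inner_sub_average_le (hf : MemLp f 2 (volume.restrict (Ioo 0 T))) {a b W : ℝ}
    (ha : 0 ≤ a) (hab : a < b) (hb : b ≤ T) {F : H} (hF : F = (b - a)⁻¹ • ∫ t in a..b, f t)
    {e : ℝ → H} (he : ContinuousOn e (Icc a b)) (hW : ∀ t ∈ Icc a b, ‖e t - e a‖ ≤ W) :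
    IntervalIntegrable (fun t => 2 * inner ℝ (f t - F) (e t)) volume a b ∧
      ∫ t in a..b, 2 * inner ℝ (f t - F) (e t) ≤ 4 * W * ∫ t in a..b, ‖f t‖ := by
  have hba : 0 < b - a := sub_pos.2 hab
  have hfi := intervalIntegrable_of_memLp hf ha hab.le hb
  have hfF : IntervalIntegrable (fun t => f t - F) volume a b := hfi.sub intervalIntegrable_const
  have hgen : ∀ g : ℝ → H, ContinuousOn g (Icc a b) →
      IntervalIntegrable (fun t => inner ℝ (f t - F) (g t)) volume a b := fun g hg => by
    obtain ⟨M, hM⟩ := isCompact_Icc.exists_bound_of_continuousOn hg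
    rw [intervalIntegrable_iff_integrableOn_Ioc_of_le hab.le] at hfF ⊢
    refine Integrable.mono' (hfF.norm.mul_const M) ?_ ?_
    · exact hfF.aestronglyMeasurable.inner
        ((hg.mono Ioc_subset_Icc_self).aestronglyMeasurable measurableSet_Ioc)
    · refine (ae_restrict_mem measurableSet_Ioc).mono fun t ht => ?_
      refine (norm_inner_le_norm _ _).trans ?_
      exact mul_le_mul_of_nonneg_left (hM t (Ioc_subset_Icc_self ht)) (norm_nonneg _)
  have hW0 : 0 ≤ W := (norm_nonneg _).trans (hW a (left_mem_Icc.2 hab.le))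
  refine ⟨(hgen e he).const_mul 2, ?_⟩
  have hmean : ∫ t in a..b, (f t - F) = 0 := by
    rw [intervalIntegral.integral_sub hfi intervalIntegrable_const, intervalIntegral.integral_const,
      hF, smul_inv_smul₀ hba.ne', sub_self]
  have h0 : ∫ t in a..b, inner ℝ (f t - F) (e a) = 0 := by
    have := (innerSL ℝ (e a)).intervalIntegral_comp_comm hfF
    rw [hmean, map_zero] at this
    rw [← this]
    exact intervalIntegral.integral_congr fun t _ => real_inner_comm _ _
  have hec : ContinuousOn (fun t => e t - e a) (Icc a b) := he.sub continuousOn_const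
  have h1 : ∫ t in a..b, 2 * inner ℝ (f t - F) (e t) =
      2 * ∫ t in a..b, inner ℝ (f t - F) (e t - e a) := by
    simp only [inner_sub_right]
    rw [intervalIntegral.integral_const_mul, intervalIntegral.integral_sub (hgen e he)
      (hgen _ continuousOn_const), h0, sub_zero]
  have h2 : ∫ t in a..b, inner ℝ (f t - F) (e t - e a) ≤ ∫ t in a..b, (‖f t‖ + ‖F‖) * W := by
    refine intervalIntegral.integral_mono_on hab.le (hgen _ hec)
      ((hfi.norm.add intervalIntegrable_const).mul_const W) fun t ht => ?_
    exact (real_inner_le_norm _ _).trans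
      (mul_le_mul (norm_sub_le _ _) (hW t ht) (norm_nonneg _) (by positivity))
  have hFn : (b - a) * ‖F‖ ≤ ∫ t in a..b, ‖f t‖ := by
    rw [hF, norm_smul, norm_inv, Real.norm_of_nonneg hba.le, mul_inv_cancel_left₀ hba.ne']
    exact intervalIntegral.norm_integral_le_integral_norm hab.le
  rw [intervalIntegral.integral_mul_const, intervalIntegral.integral_add hfi.norm
    intervalIntegrable_const, intervalIntegral.integral_const, smul_eq_mul] at h2
  have h3 := mul_le_mul_of_nonneg_right hFn hW0
  rw [h1]
  linarith

/-- Half order convergence, if the modulus of continuity of the solution is controlled by a square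
integrable function `p`. -/
theorem IsEVISolution.error_of_average (hu : IsEVISolution K q T f u) (hq : IsEnergy K q c)
    (hU : IsApproxScheme K q κ τ N F U) (hτ : 0 < τ) (hT : N * τ = T)
    (hu0 : u 0 = U 0) (hf : MemLp f 2 (volume.restrict (Ioo 0 T)))
    (hF : ∀ k < N, F (k + 1) = τ⁻¹ • ∫ t in (k * τ)..(((k : ℝ) + 1) * τ), f t) {p : ℝ → H}
    (hp : MemLp p 2 (volume.restrict (Ioo 0 T)))
    (hpu : ∀ a b, 0 ≤ a → a ≤ b → b ≤ T → ‖u b - u a‖ ≤ ∫ t in a..b, ‖p t‖) {X : ℝ}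
    (hX : X = τ * (4 * (∫ t in (0)..T, ‖p t‖ ^ 2) + 7 * (∫ t in (0)..T, ‖f t‖ ^ 2) +
      5 * q (U 0)) + 12 * T * κ ^ 2 / c) :
    (∀ k < N, ∀ t ∈ Icc (k * τ) (((k : ℝ) + 1) * τ), ‖u t - stepInterp τ U k t‖ ≤ 2 * √X) ∧
      ∑ k ∈ Finset.range N, ∫⁻ r in Ioo (k * τ) (((k : ℝ) + 1) * τ),
        ENNReal.ofReal (q (u r - U (k + 1)) / 2) ≤ ENNReal.ofReal X := by
  have hc := hq.pos
  have hT0 : 0 ≤ T := by rw [← hT]; positivity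
  let δ : ℕ → H := fun k => τ⁻¹ • (U (k + 1) - U k)
  let Pk : ℕ → ℝ := fun k => ∫ t in (k * τ)..(((k : ℝ) + 1) * τ), ‖p t‖ ^ 2
  let Fk : ℕ → ℝ := fun k => ∫ t in (k * τ)..(((k : ℝ) + 1) * τ), ‖f t‖ ^ 2
  have hPsum : ∑ k ∈ Finset.range N, Pk k = ∫ t in (0)..T, ‖p t‖ ^ 2 :=
    sum_integral_steps hτ hT fun a b => intervalIntegrable_norm_sq_of_memLp hp
  have hFsum : ∑ k ∈ Finset.range N, Fk k = ∫ t in (0)..T, ‖f t‖ ^ 2 :=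
    sum_integral_steps hτ hT fun a b => intervalIntegrable_norm_sq_of_memLp hf
  have hPk0 : ∀ k, 0 ≤ Pk k := fun k => intervalIntegral.integral_nonneg (by nlinarith)
    fun t _ => by positivity
  have hFk0 : ∀ k, 0 ≤ Fk k := fun k => intervalIntegral.integral_nonneg (by nlinarith)
    fun t _ => by positivity
  -- a bound for the oscillation of the error on the `k`-th time step
  let W : ℕ → ℝ := fun k => (∫ t in (k * τ)..(((k : ℝ) + 1) * τ), ‖p t‖) + τ * ‖δ k‖
  have hstep : ∀ k : ℕ, ((k : ℝ) + 1) * τ - k * τ = τ := fun k => by ring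
  have hosc : ∀ k < N, ∀ t ∈ Icc (k * τ) (((k : ℝ) + 1) * τ),
      ‖(u t - stepInterp τ U k t) - (u (k * τ) - U k)‖ ≤ W k := fun k hk t ht => by
    obtain ⟨a1, a2, a3⟩ := step_mem_Icc hτ hT hk
    have h1 := hpu _ _ a1 ht.1 (ht.2.trans a3)
    have h2 : ∫ t in (k * τ)..t, ‖p t‖ ≤ ∫ t in (k * τ)..(((k : ℝ) + 1) * τ), ‖p t‖ :=
      intervalIntegral.integral_mono_interval le_rfl ht.1 ht.2
        (ae_of_all _ fun t => norm_nonneg _) (intervalIntegrable_of_memLp hp a1 a2.le a3).norm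
    have h3 := norm_stepInterp_sub_le (U := U) hτ ht
    have e : (u t - stepInterp τ U k t) - (u (k * τ) - U k) =
        (u t - u (k * τ)) - (stepInterp τ U k t - U k) := by abel
    rw [e]
    exact (norm_sub_le _ _).trans (add_le_add (h1.trans h2) h3)
  let B : ℕ → ℝ → ℝ := fun k r => 2 * inner ℝ (f r - F (k + 1)) (u r - stepInterp τ U k r)
  have hBW : ∀ k < N, IntervalIntegrable (B k) volume (k * τ) (((k : ℝ) + 1) * τ) ∧
      ∫ r in (k * τ)..(((k : ℝ) + 1) * τ), B k r ≤
        4 * W k * ∫ t in (k * τ)..(((k : ℝ) + 1) * τ), ‖f t‖ := fun k hk => by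
    obtain ⟨a1, a2, a3⟩ := step_mem_Icc hτ hT hk
    refine integral_inner_sub_average_le hf a1 a2 a3 (by rw [hstep, hF k hk])
      (e := fun r => u r - stepInterp τ U k r) ?_ fun t ht => ?_
    · exact (hu.continuousOn.mono (Icc_subset_Icc a1 a3)).sub
        (continuous_stepInterp τ U k).continuousOn
    · rw [stepInterp_left hτ]
      exact hosc k hk t ht
  have hB : ∀ k < N, IntervalIntegrable (B k) volume (k * τ) (((k : ℝ) + 1) * τ) :=
    fun k hk => (hBW k hk).1
  have hBf : ∀ k < N, ∀ᵐ r ∂(volume.restrict (Ioo (k * τ) (((k : ℝ) + 1) * τ))),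
      2 * inner ℝ (f r - F (k + 1)) (u r - stepInterp τ U k r) ≤ B k r :=
    fun k _ => ae_of_all _ fun r => le_rfl
  have hfn : ∀ k < N, (∫ t in (k * τ)..(((k : ℝ) + 1) * τ), ‖f t‖) ^ 2 ≤ τ * Fk k := fun k hk => by
    obtain ⟨a1, a2, a3⟩ := step_mem_Icc hτ hT hk
    have := sq_integral_norm_le_of_memLp hf a1 a2 a3
    rwa [hstep] at this
  have hpn : ∀ k < N, (∫ t in (k * τ)..(((k : ℝ) + 1) * τ), ‖p t‖) ^ 2 ≤ τ * Pk k := fun k hk => by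
    obtain ⟨a1, a2, a3⟩ := step_mem_Icc hτ hT hk
    have := sq_integral_norm_le_of_memLp hp a1 a2 a3
    rwa [hstep] at this
  have hFn : ∀ k < N, τ * ‖F (k + 1)‖ ^ 2 ≤ Fk k := fun k hk => by
    obtain ⟨a1, a2, a3⟩ := step_mem_Icc hτ hT hk
    have h1 : τ * ‖F (k + 1)‖ ≤ ∫ t in (k * τ)..(((k : ℝ) + 1) * τ), ‖f t‖ := by
      rw [hF k hk, norm_smul, norm_inv, Real.norm_of_nonneg hτ.le, mul_inv_cancel_left₀ hτ.ne']
      exact intervalIntegral.norm_integral_le_integral_norm a2.le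
    have h2 : (τ * ‖F (k + 1)‖) ^ 2 ≤ τ * Fk k :=
      (pow_le_pow_left₀ (by positivity) h1 2).trans (hfn k hk)
    exact le_of_mul_le_mul_left (by linarith [mul_pow τ ‖F (k + 1)‖ 2]) hτ
  have hδn : ∀ k < N, τ * ‖δ k‖ ^ 2 ≤ Fk k + (q (U k) - q (U (k + 1))) + 2 * κ ^ 2 / c :=
    fun k hk => (hU.mul_norm_sq_le hq hτ hk).trans (by linarith [hFn k hk])
  have hW2 : ∀ k < N, (W k) ^ 2 ≤ 2 * τ * Pk k + 2 * τ * (τ * ‖δ k‖ ^ 2) := fun k hk => by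
    have h1 := hpn k hk
    have h2 : (W k) ^ 2 ≤ 2 * (∫ t in (k * τ)..(((k : ℝ) + 1) * τ), ‖p t‖) ^ 2 +
        2 * (τ * ‖δ k‖) ^ 2 := by
      simp only [W]
      nlinarith [sq_nonneg ((∫ t in (k * τ)..(((k : ℝ) + 1) * τ), ‖p t‖) - τ * ‖δ k‖)]
    linarith [mul_pow τ ‖δ k‖ 2]
  let Z : ℕ → ℝ := fun k => τ * (4 * Pk k + 7 * Fk k + 5 * (q (U k) - q (U (k + 1)))) +
    τ * (12 * κ ^ 2 / c)
  have hZW : ∀ k < N, (W k) ^ 2 ≤ Z k ∧ (∫ r in (k * τ)..(((k : ℝ) + 1) * τ), B k r) +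
      τ * (energyExcess q τ F U k + 4 * κ ^ 2 / c) ≤ Z k := fun k hk => by
    have h1 := hW2 k hk
    have h2 := mul_le_mul_of_nonneg_left (hδn k hk) hτ.le
    have h3 := mul_le_mul_of_nonneg_left (hFn k hk) hτ.le
    have h4 := (hBW k hk).2
    have h5 := hfn k hk
    have h6 := mul_le_mul_of_nonneg_left (energyExcess_le (q := q) (F := F) (U := U) hτ k) hτ.le
    have h7 : 4 * W k * (∫ t in (k * τ)..(((k : ℝ) + 1) * τ), ‖f t‖) ≤ 2 * (W k) ^ 2 +
        2 * (∫ t in (k * τ)..(((k : ℝ) + 1) * τ), ‖f t‖) ^ 2 := by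
      nlinarith [sq_nonneg (W k - ∫ t in (k * τ)..(((k : ℝ) + 1) * τ), ‖f t‖)]
    have h8 : 0 ≤ τ * ‖δ k‖ ^ 2 := by positivity
    have h9 : 0 ≤ τ * (Fk k + (q (U k) - q (U (k + 1))) + 2 * κ ^ 2 / c) :=
      mul_nonneg hτ.le (h8.trans (hδn k hk))
    have h10 : 0 ≤ τ * Fk k := mul_nonneg hτ.le (hFk0 k)
    have h11 : 0 ≤ τ * Pk k := mul_nonneg hτ.le (hPk0 k)
    have h12 : 0 ≤ τ * (κ ^ 2 / c) := by positivity
    have e : Z k = 4 * (τ * Pk k) + 7 * (τ * Fk k) + 5 * (τ * (q (U k) - q (U (k + 1)))) +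
      12 * (τ * (κ ^ 2 / c)) := by simp only [Z]; ring
    have e1 : τ * (Fk k + (q (U k) - q (U (k + 1))) + 2 * κ ^ 2 / c) = τ * Fk k +
      τ * (q (U k) - q (U (k + 1))) + 2 * (τ * (κ ^ 2 / c)) := by ring
    have e2 : τ * (energyExcess q τ F U k + 4 * κ ^ 2 / c) = τ * energyExcess q τ F U k +
      4 * (τ * (κ ^ 2 / c)) := by ring
    have e3 : τ * (q (U k) - q (U (k + 1)) + τ * ‖F (k + 1)‖ ^ 2) =
      τ * (q (U k) - q (U (k + 1))) + τ * (τ * ‖F (k + 1)‖ ^ 2) := by ring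
    rw [e1] at h2 h9
    rw [e3] at h6
    rw [e, e2]
    constructor <;> linarith
  have hZ0 : ∀ k < N, 0 ≤ Z k := fun k hk => (sq_nonneg _).trans (hZW k hk).1
  have hZsum : ∑ k ∈ Finset.range N, Z k ≤ X := by
    have e : ∑ k ∈ Finset.range N, Z k = τ * (4 * (∫ t in (0)..T, ‖p t‖ ^ 2) +
        7 * (∫ t in (0)..T, ‖f t‖ ^ 2) + 5 * (q (U 0) - q (U N))) + 12 * T * κ ^ 2 / c := by
      simp only [Z]
      rw [Finset.sum_add_distrib, ← Finset.mul_sum, Finset.sum_add_distrib, Finset.sum_add_distrib,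
        ← Finset.mul_sum, ← Finset.mul_sum, ← Finset.mul_sum, hPsum, hFsum,
        Finset.sum_range_sub' (fun k => q (U k)), Finset.sum_const, Finset.card_range,
        nsmul_eq_mul, ← mul_assoc (N : ℝ), hT]
      ring
    rw [e, hX]
    have := mul_nonneg hτ.le (hq.nonneg (U N))
    linarith
  have hX0 : 0 ≤ X := (Finset.sum_nonneg fun k hk => hZ0 k (Finset.mem_range.1 hk)).trans hZsum
  have hES : ∀ m ≤ N, errorSum q c κ τ F U B m ≤ X := fun m hm => by
    refine le_trans ?_ hZsum
    refine (Finset.sum_le_sum fun k hk => (hZW k ((Finset.mem_range.1 hk).trans_le hm)).2).trans ?_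
    exact Finset.sum_le_sum_of_subset_of_nonneg (by simpa using hm)
      fun k hk _ => hZ0 k (Finset.mem_range.1 hk)
  constructor
  · intro k hk t ht
    have h1 := (hu.error_scheme_node hq hU hτ hT hu0 hB hBf hk.le).1
    have h2 : ‖u (k * τ) - U k‖ ≤ √X := Real.le_sqrt_of_sq_le (by linarith [hES k hk.le])
    have h3 : W k ≤ √X := Real.le_sqrt_of_sq_le ((hZW k hk).1.trans
      ((Finset.single_le_sum (fun k hk => hZ0 k (Finset.mem_range.1 hk))
        (Finset.mem_range.2 hk)).trans hZsum))
    have h4 := hosc k hk t ht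
    have h5 := norm_add_le (u (k * τ) - U k)
      ((u t - stepInterp τ U k t) - (u (k * τ) - U k))
    rw [add_sub_cancel] at h5
    linarith
  · refine (hu.error_scheme_node hq hU hτ hT hu0 hB hBf le_rfl).2.trans
      (ENNReal.ofReal_le_ofReal ?_)
    have := hES N le_rfl
    have h1 : 0 ≤ ‖u (N * τ) - U N‖ ^ 2 := by positivity
    linarith

end SquareIntegrable

/-! ### Regularity in time -/

/-- Tonelli's theorem for averages over moving intervals, upper bound. -/
lemma lintegral_average_le {g : ℝ → ℝ≥0∞} (hg : Measurable g) {T h σ : ℝ} (hσh : σ ≤ h) :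
    ∫⁻ r in Ioo 0 (T - h), ∫⁻ x in Ioo 0 σ, g (r + x) ≤
      ENNReal.ofReal σ * ∫⁻ t in Ioo 0 T, g t := by
  rw [lintegral_lintegral_swap (by fun_prop)]
  have h1 : ∀ x ∈ Ioo 0 σ, ∫⁻ r in Ioo 0 (T - h), g (r + x) ≤ ∫⁻ t in Ioo 0 T, g t := fun x hx => by
    have e := (measurePreserving_add_right volume x).setLIntegral_comp_preimage_emb
      (measurableEmbedding_addRight x) g (Ioo x (T - h + x))
    rw [preimage_add_const_Ioo, sub_self, add_sub_cancel_right] at e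
    rw [e]
    exact lintegral_mono_set (Ioo_subset_Ioo hx.1.le (by linarith [hx.2]))
  refine (setLIntegral_mono' measurableSet_Ioo h1).trans ?_
  rw [setLIntegral_const, Real.volume_Ioo, sub_zero, mul_comm]

/-- Tonelli's theorem for averages over moving intervals, lower bound. -/
lemma le_lintegral_average {g : ℝ → ℝ≥0∞} (hg : Measurable g) {T h σ : ℝ} (hσh : σ ≤ h) :
    ENNReal.ofReal σ * ∫⁻ t in Ioo 0 (T - h), g t ≤ ENNReal.ofReal σ * (∫⁻ t in Ioc 0 h, g t) +
      ∫⁻ r in Ioo 0 (T - h), ∫⁻ x in Ioo 0 σ, g (r + x) := by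
  rw [lintegral_lintegral_swap (by fun_prop)]
  have h1 : ∀ x ∈ Ioo 0 σ, ∫⁻ t in Ioo h (T - h), g t ≤ ∫⁻ r in Ioo 0 (T - h), g (r + x) :=
    fun x hx => by
      have e := (measurePreserving_add_right volume x).setLIntegral_comp_preimage_emb
        (measurableEmbedding_addRight x) g (Ioo x (T - h + x))
      rw [preimage_add_const_Ioo, sub_self, add_sub_cancel_right] at e
      rw [e]
      exact lintegral_mono_set (Ioo_subset_Ioo (by linarith [hx.2]) (by linarith [hx.1]))
  have h2 := setLIntegral_mono' (μ := volume) measurableSet_Ioo h1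
  rw [setLIntegral_const, Real.volume_Ioo, sub_zero, mul_comm] at h2
  have h3 : ∫⁻ t in Ioo 0 (T - h), g t ≤ (∫⁻ t in Ioc 0 h, g t) + ∫⁻ t in Ioo h (T - h), g t := by
    refine (lintegral_mono_set ?_).trans (lintegral_union_le _ _ _)
    intro t ht
    rcases le_or_gt t h with h4 | h4
    · exact Or.inl ⟨ht.1, h4⟩
    · exact Or.inr ⟨h4, ht.2⟩
  calc _ ≤ ENNReal.ofReal σ * ((∫⁻ t in Ioc 0 h, g t) + ∫⁻ t in Ioo h (T - h), g t) := by gcongr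
    _ ≤ _ := by rw [mul_add]; gcongr

lemma enorm_sq_eq_ofReal {X : Type*} [NormedAddCommGroup X] (x : X) :
    ‖x‖ₑ ^ 2 = ENNReal.ofReal (‖x‖ ^ 2) := by
  rw [ENNReal.ofReal_pow (norm_nonneg _), ofReal_norm]

section Regularity

variable {H : Type*} [NormedAddCommGroup H] [InnerProductSpace ℝ H]
  {K : Set H} {q : H → ℝ} {T : ℝ} {f u : ℝ → H}

lemma ofReal_integral_norm_sq {X : Type*} [NormedAddCommGroup X] {g : ℝ → X} {a b : ℝ}
    (hab : a ≤ b) (hg : IntervalIntegrable (fun t => ‖g t‖ ^ 2) volume a b) :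
    ENNReal.ofReal (∫ t in a..b, ‖g t‖ ^ 2) = ∫⁻ t in Ioo a b, ‖g t‖ₑ ^ 2 := by
  rw [intervalIntegral.integral_of_le hab, integral_Ioc_eq_integral_Ioo,
    ofReal_integral_eq_lintegral_ofReal]
  · refine lintegral_congr fun t => ?_
    rw [ENNReal.ofReal_pow (norm_nonneg _), ofReal_norm]
  · rwa [intervalIntegrable_iff_integrableOn_Ioc_of_le hab,
      integrableOn_Ioc_iff_integrableOn_Ioo] at hg
  · exact ae_of_all _ fun t => by positivity

/-- The energy estimate from testing with a fixed element of `K`. -/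
lemma IsEVISolution.energy_estimate (hu : IsEVISolution K q T f u) (hq0 : ∀ x, 0 ≤ q x)
    (hf : MemLp f 2 (volume.restrict (Ioo 0 T))) {φ : H} (hφ : φ ∈ K) {a b η : ℝ} (ha : 0 ≤ a)
    (hab : a ≤ b) (hb : b ≤ T) (hη : 0 < η) :
    ‖u b - φ‖ₑ ^ 2 + ∫⁻ t in Ioo a b, ENNReal.ofReal (q (u t)) ≤
      ‖u a - φ‖ₑ ^ 2 + (ENNReal.ofReal (b - a) * ENNReal.ofReal (q φ) +
        ENNReal.ofReal η * (∫⁻ t in Ioo a b, ‖f t‖ₑ ^ 2) +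
        ENNReal.ofReal η⁻¹ * ∫⁻ t in Ioo a b, ‖u t - φ‖ₑ ^ 2) := by
  have huc : ContinuousOn (fun t => u t - φ) (Icc a b) :=
    (hu.continuousOn.mono (Icc_subset_Icc ha hb)).sub continuousOn_const
  have i1 := intervalIntegrable_norm_sq_of_memLp hf ha hab hb
  have i2 : IntervalIntegrable (fun t => ‖u t - φ‖ ^ 2) volume a b := by
    refine ContinuousOn.intervalIntegrable ?_
    rw [uIcc_of_le hab]
    exact huc.norm.pow 2
  have i3 : IntervalIntegrable (fun t => q φ + η * ‖f t‖ ^ 2) volume a b :=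
    intervalIntegrable_const.add (i1.const_mul η)
  have key := lintegral_le_of_deriv_add_le (g := fun t => ‖u t - φ‖ ^ 2) (P := fun t => q (u t))
    (B := fun t => q φ + η * ‖f t‖ ^ 2 + η⁻¹ * ‖u t - φ‖ ^ 2) hab (huc.norm.pow 2) ?_
    (i3.add (i2.const_mul _)) ?_
  · rw [intervalIntegral.integral_add i3 (i2.const_mul _),
      intervalIntegral.integral_add intervalIntegrable_const (i1.const_mul η),
      intervalIntegral.integral_const, intervalIntegral.integral_const_mul,
      intervalIntegral.integral_const_mul, smul_eq_mul] at key
    obtain ⟨k1, k2⟩ := key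
    have p1 : 0 ≤ ∫ t in a..b, ‖f t‖ ^ 2 :=
      intervalIntegral.integral_nonneg hab fun t _ => by positivity
    have p2 : 0 ≤ ∫ t in a..b, ‖u t - φ‖ ^ 2 :=
      intervalIntegral.integral_nonneg hab fun t _ => by positivity
    have p3 : 0 ≤ (b - a) * q φ := mul_nonneg (by linarith) (hq0 φ)
    refine (add_le_add_right k2 _).trans (le_of_eq ?_)
    rw [enorm_sq_eq_ofReal, ← ENNReal.ofReal_add (by positivity) k1, enorm_sq_eq_ofReal,
      ← ofReal_integral_norm_sq hab i1,
      ← ofReal_integral_norm_sq hab i2, ← ENNReal.ofReal_mul (by linarith),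
      ← ENNReal.ofReal_mul hη.le, ← ENNReal.ofReal_mul (by positivity),
      ← ENNReal.ofReal_add p3 (by positivity), ← ENNReal.ofReal_add (by positivity) (by positivity),
      ← ENNReal.ofReal_add (by positivity) (by positivity)]
    congr 1
    ring
  · intro a' b' ha' hab' hb'
    refine AbsolutelyContinuousOnInterval.norm_sq ?_
    exact (hu.absolutelyContinuous a' b' (by linarith) hab' (by linarith)).sub
      (contDiff_const.contDiffOn.absolutelyContinuousOnInterval)
  · filter_upwards [ae_restrict_of_ae_restrict_of_subset (Ioo_subset_Ioo ha hb) hu.inequality]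
      with t ht
    obtain ⟨-, u', hu', hE⟩ := ht
    refine ⟨hq0 _, 2 * inner ℝ (u t - φ) u', (hu'.sub_const φ).norm_sq, ?_⟩
    have h1 := hE φ hφ
    have h2 := hq0 (u t - φ)
    have h3 : 2 * inner ℝ (f t) (u t - φ) ≤ η * ‖f t‖ ^ 2 + η⁻¹ * ‖u t - φ‖ ^ 2 := by
      have h4 := real_inner_le_norm (f t) (u t - φ)
      have h5 : η * ‖f t‖ ^ 2 + η⁻¹ * ‖u t - φ‖ ^ 2 - 2 * (‖f t‖ * ‖u t - φ‖) =
          (η * ‖f t‖ - ‖u t - φ‖) ^ 2 / η := by field_simp; ring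
      have h6 : 0 ≤ (η * ‖f t‖ - ‖u t - φ‖) ^ 2 / η := by positivity
      linarith
    rw [inner_sub_left] at h1
    rw [real_inner_comm]
    linarith

/-- The mean energy stays bounded near the initial time. -/
lemma IsEVISolution.lintegral_energy_le (hu : IsEVISolution K q T f u) (hq0 : ∀ x, 0 ≤ q x)
    (hf : MemLp f 2 (volume.restrict (Ioo 0 T))) (hu0 : u 0 ∈ K) {σ Φ : ℝ} (hσ : 0 < σ)
    (hσT : σ ≤ T) (hΦ : 0 ≤ Φ) (hfΦ : ∫⁻ t in Ioo 0 T, ‖f t‖ₑ ^ 2 ≤ ENNReal.ofReal Φ) :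
    ∫⁻ t in Ioo 0 σ, ENNReal.ofReal (q (u t)) ≤ ENNReal.ofReal (σ * (2 * q (u 0) + 4 * Φ)) := by
  have huc : ContinuousOn (fun t => ‖u t - u 0‖) (Icc 0 σ) :=
    ((hu.continuousOn.mono (Icc_subset_Icc_right hσT)).sub continuousOn_const).norm
  obtain ⟨m, hm, hmax⟩ := isCompact_Icc.exists_isMaxOn (nonempty_Icc.2 hσ.le) huc
  set M := ‖u m - u 0‖ with hM
  have hM0 : 0 ≤ M := norm_nonneg _
  have hq00 := hq0 (u 0)
  have key : ∀ b ∈ Icc 0 σ, ‖u b - u 0‖ₑ ^ 2 + ∫⁻ t in Ioo 0 b, ENNReal.ofReal (q (u t)) ≤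
      ENNReal.ofReal (σ * q (u 0) + 2 * σ * Φ + M ^ 2 / 2) := fun b hb => by
    have h1 := hu.energy_estimate hq0 hf hu0 le_rfl hb.1 (hb.2.trans hσT)
      (by positivity : 0 < 2 * σ)
    refine h1.trans ?_
    rw [sub_self, enorm_zero, zero_pow two_ne_zero, zero_add, sub_zero]
    have h2 : ∫⁻ t in Ioo 0 b, ‖f t‖ₑ ^ 2 ≤ ENNReal.ofReal Φ :=
      (lintegral_mono_set (Ioo_subset_Ioo_right (hb.2.trans hσT))).trans hfΦ
    have h3 : ∫⁻ t in Ioo 0 b, ‖u t - u 0‖ₑ ^ 2 ≤ ENNReal.ofReal (M ^ 2) * ENNReal.ofReal σ := by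
      calc _ ≤ ∫⁻ t in Ioo 0 b, ENNReal.ofReal (M ^ 2) := by
            refine setLIntegral_mono' measurableSet_Ioo fun t ht => ?_
            rw [enorm_sq_eq_ofReal]
            refine ENNReal.ofReal_le_ofReal (pow_le_pow_left₀ (norm_nonneg _) ?_ 2)
            exact hmax ⟨ht.1.le, ht.2.le.trans hb.2⟩
        _ = ENNReal.ofReal (M ^ 2) * ENNReal.ofReal b := by
            rw [setLIntegral_const, Real.volume_Ioo, sub_zero]
        _ ≤ _ := by gcongr; exact hb.2
    have h4 : ENNReal.ofReal b ≤ ENNReal.ofReal σ := ENNReal.ofReal_le_ofReal hb.2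
    calc _ ≤ ENNReal.ofReal σ * ENNReal.ofReal (q (u 0)) +
          ENNReal.ofReal (2 * σ) * ENNReal.ofReal Φ +
          ENNReal.ofReal (2 * σ)⁻¹ * (ENNReal.ofReal (M ^ 2) * ENNReal.ofReal σ) := by gcongr
      _ = _ := by
          rw [← ENNReal.ofReal_mul hσ.le, ← ENNReal.ofReal_mul (by positivity),
            ← ENNReal.ofReal_mul (by positivity), ← ENNReal.ofReal_mul (by positivity),
            ← ENNReal.ofReal_add (by positivity) (by positivity),
            ← ENNReal.ofReal_add (by positivity) (by positivity)]
          congr 1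
          field_simp
  have hM2 : M ^ 2 ≤ σ * q (u 0) + 2 * σ * Φ + M ^ 2 / 2 := by
    have h1 := le_self_add.trans (key m hm)
    rwa [enorm_sq_eq_ofReal, ENNReal.ofReal_le_ofReal_iff (by positivity)] at h1
  refine (le_add_self.trans (key σ (right_mem_Icc.2 hσ.le))).trans (ENNReal.ofReal_le_ofReal ?_)
  linarith

/-- The `L²` modulus of continuity of the solution: test the variational inequality at the times
`t > r` with `u(r)` and integrate with respect to `r`. -/
lemma IsEVISolution.translation_le (hu : IsEVISolution K q T f u) (hq0 : ∀ x, 0 ≤ q x)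
    (hqm : ∀ v : ℝ → H, Continuous v → Measurable fun t => q (v t))
    (hf : MemLp f 2 (volume.restrict (Ioo 0 T))) (hu0 : u 0 ∈ K) {Φ : ℝ}
    (hΦ : 0 ≤ Φ) (hfΦ : ∫⁻ t in Ioo 0 T, ‖f t‖ₑ ^ 2 ≤ ENNReal.ofReal Φ) {h : ℝ} (hh : 0 < h)
    (hhT : h < T) :
    ∫⁻ r in Ioo 0 (T - h), ‖u (r + h) - u r‖ₑ ^ 2 ≤
      ENNReal.ofReal (h ^ 2 * (4 * q (u 0) + 12 * Φ)) := by
  have hT : 0 < T := hh.trans hhT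
  have hq00 := hq0 (u 0)
  -- a continuous extension of `u`
  set v : ℝ → H := IccExtend hT.le ((Icc 0 T).domRestrict u) with hv
  have hvc : Continuous v := (continuousOn_iff_continuous_domRestrict.1 hu.continuousOn).Icc_extend'
  have hvu : ∀ t ∈ Icc 0 T, v t = u t := fun t ht => by rw [hv, IccExtend_of_mem _ _ ht]; rfl
  let Q : ℝ → ℝ≥0∞ := fun t => ENNReal.ofReal (q (v t))
  have hQ : Measurable Q := (hqm v hvc).ennreal_ofReal
  obtain ⟨g, hg, hgf⟩ : AEMeasurable (fun t => ‖f t‖ₑ ^ 2) (volume.restrict (Ioo 0 T)) :=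
    hf.1.enorm.pow_const 2
  let A : ℝ → ℝ → ℝ≥0∞ := fun r x => ‖v (r + x) - v r‖ₑ ^ 2
  have hA : Measurable (Function.uncurry A) := by
    have : Continuous fun p : ℝ × ℝ => v (p.1 + p.2) - v p.1 := by fun_prop
    exact (this.enorm.measurable).pow_const 2
  let a : ℝ → ℝ≥0∞ := fun x => ∫⁻ r in Ioo 0 (T - h), A r x
  have hshift : ∀ (F : ℝ → ℝ≥0∞) (r σ : ℝ),
      ∫⁻ t in Ioo r (r + σ), F t = ∫⁻ x in Ioo 0 σ, F (r + x) := fun F r σ => by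
    have e := (measurePreserving_add_left volume r).setLIntegral_comp_preimage_emb
      (measurableEmbedding_addLeft r) F (Ioo r (r + σ))
    rw [preimage_const_add_Ioo, sub_self, add_sub_cancel_left] at e
    exact e.symm
  have hpt : ∀ σ ∈ Ioc 0 h, ∀ᵐ r ∂(volume.restrict (Ioo 0 (T - h))),
      A r σ + ∫⁻ x in Ioo 0 σ, Q (r + x) ≤ ENNReal.ofReal σ * Q r +
        ENNReal.ofReal (2 * h) * (∫⁻ x in Ioo 0 h, g (r + x)) +
        ENNReal.ofReal (2 * h)⁻¹ * ∫⁻ x in Ioo 0 h, A r x := fun σ hσ => by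
    filter_upwards [ae_restrict_of_ae_restrict_of_subset (Ioo_subset_Ioo_right (by linarith))
      hu.inequality, ae_restrict_mem measurableSet_Ioo] with r hr hrI
    have m1 : ∀ t ∈ Ioo r (r + h), t ∈ Icc 0 T := fun t ht =>
      ⟨by linarith [hrI.1, ht.1], by linarith [hrI.2, ht.2]⟩
    have m2 : Ioo r (r + σ) ⊆ Ioo r (r + h) := Ioo_subset_Ioo_right (by linarith [hσ.2])
    have mr : r ∈ Icc 0 T := ⟨hrI.1.le, by linarith [hrI.2]⟩
    have mσ : r + σ ∈ Icc 0 T := ⟨by linarith [hrI.1, hσ.1], by linarith [hrI.2, hσ.2]⟩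
    have h1 := hu.energy_estimate hq0 hf hr.1 hrI.1.le (by linarith [hσ.1] : r ≤ r + σ) mσ.2
      (by positivity : 0 < 2 * h)
    rw [sub_self, enorm_zero, zero_pow two_ne_zero, zero_add, add_sub_cancel_left] at h1
    have e1 : A r σ = ‖u (r + σ) - u r‖ₑ ^ 2 := by simp only [A]; rw [hvu _ mσ, hvu _ mr]
    have e2 : ∫⁻ x in Ioo 0 σ, Q (r + x) = ∫⁻ t in Ioo r (r + σ), ENNReal.ofReal (q (u t)) := by
      rw [← hshift]
      refine setLIntegral_congr_fun measurableSet_Ioo fun t ht => ?_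
      simp only [Q]
      rw [hvu _ (m1 t (m2 ht))]
    have e3 : ∫⁻ t in Ioo r (r + σ), ‖f t‖ₑ ^ 2 ≤ ∫⁻ x in Ioo 0 h, g (r + x) := by
      rw [← hshift]
      refine (lintegral_mono_set m2).trans (le_of_eq ?_)
      exact lintegral_congr_ae (ae_restrict_of_ae_restrict_of_subset
        (Ioo_subset_Ioo hrI.1.le (by linarith [hrI.2])) hgf)
    have e4 : ∫⁻ t in Ioo r (r + σ), ‖u t - u r‖ₑ ^ 2 ≤ ∫⁻ x in Ioo 0 h, A r x := by
      have := hshift (fun t => ‖v t - v r‖ₑ ^ 2) r h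
      simp only [A]
      rw [← this]
      refine (lintegral_mono_set m2).trans (le_of_eq ?_)
      refine setLIntegral_congr_fun measurableSet_Ioo fun t ht => ?_
      rw [hvu _ (m1 t ht), hvu _ mr]
    have e5 : Q r = ENNReal.ofReal (q (u r)) := by simp only [Q]; rw [hvu _ mr]
    rw [e1, e2, e5]
    refine h1.trans ?_
    gcongr
  have hQfin : ∀ S ⊆ Ioo 0 T, ∫⁻ t in S, Q t ≠ ∞ := fun S hS => by
    have h1 := hu.lintegral_energy_le hq0 hf hu0 hT le_rfl hΦ hfΦ
    refine ne_top_of_le_ne_top ENNReal.ofReal_ne_top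
      ((lintegral_mono_set hS).trans (le_trans ?_ h1))
    refine le_of_eq (setLIntegral_congr_fun measurableSet_Ioo fun t ht => ?_)
    simp only [Q]
    rw [hvu t (Ioo_subset_Icc_self ht)]
  have hQ0 : ∫⁻ t in Ioc 0 h, Q t ≤ ENNReal.ofReal (h * (2 * q (u 0) + 4 * Φ)) := by
    refine le_trans (le_of_eq ?_) (hu.lintegral_energy_le hq0 hf hu0 hh hhT.le hΦ hfΦ)
    rw [setLIntegral_congr Ioo_ae_eq_Ioc.symm]
    refine setLIntegral_congr_fun measurableSet_Ioo fun t ht => ?_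
    simp only [Q]
    rw [hvu t ⟨ht.1.le, by linarith [ht.2]⟩]
  have hgΦ : ∫⁻ t in Ioo 0 T, g t ≤ ENNReal.ofReal Φ := by
    rw [← lintegral_congr_ae hgf]
    exact hfΦ
  -- integration over `r`; the energy terms cancel up to a contribution of the first interval
  have hint : ∀ σ ∈ Ioc 0 h, a σ ≤ ENNReal.ofReal (h ^ 2 * (2 * q (u 0) + 6 * Φ)) +
      ENNReal.ofReal (2 * h)⁻¹ * ∫⁻ x in Ioo 0 h, a x := fun σ hσ => by
    set J := ∫⁻ r in Ioo 0 (T - h), ∫⁻ x in Ioo 0 σ, Q (r + x) with hJ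
    have mA : Measurable fun r => A r σ := hA.of_uncurry_right
    have mg : Measurable fun r => ∫⁻ x in Ioo 0 h, g (r + x) :=
      Measurable.lintegral_prod_right' (f := fun p : ℝ × ℝ => g (p.1 + p.2)) (by fun_prop)
    have mAA : Measurable fun r => ∫⁻ x in Ioo 0 h, A r x := hA.lintegral_prod_right
    have hswap : ∫⁻ r in Ioo 0 (T - h), ∫⁻ x in Ioo 0 h, A r x = ∫⁻ x in Ioo 0 h, a x :=
      lintegral_lintegral_swap hA.aemeasurable
    have h1 := lintegral_mono_ae (hpt σ hσ)
    rw [lintegral_add_left mA, lintegral_add_right _ (mAA.const_mul _),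
      lintegral_add_right _ (mg.const_mul _), lintegral_const_mul _ hQ,
      lintegral_const_mul _ mg, lintegral_const_mul _ mAA,
      hswap] at h1
    have h2 := le_lintegral_average hQ (T := T) hσ.2
    have h3 := lintegral_average_le hg (T := T) (le_refl h)
    have hJfin : J ≠ ∞ := by
      refine ne_top_of_le_ne_top ?_ (lintegral_average_le hQ (T := T) hσ.2)
      exact ENNReal.mul_ne_top ENNReal.ofReal_ne_top (hQfin _ Subset.rfl)
    have h4 : a σ + J ≤ (ENNReal.ofReal (h ^ 2 * (2 * q (u 0) + 6 * Φ)) +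
        ENNReal.ofReal (2 * h)⁻¹ * ∫⁻ x in Ioo 0 h, a x) + J := by
      refine h1.trans ?_
      calc _ ≤ (ENNReal.ofReal h * ENNReal.ofReal (h * (2 * q (u 0) + 4 * Φ)) + J) +
            ENNReal.ofReal (2 * h) * (ENNReal.ofReal h * ENNReal.ofReal Φ) +
            ENNReal.ofReal (2 * h)⁻¹ * ∫⁻ x in Ioo 0 h, a x := by
            gcongr ?_ + ENNReal.ofReal (2 * h) * ?_ + _
            · refine h2.trans ?_
              gcongr
              exact hσ.2
            · refine h3.trans ?_
              gcongr
        _ = _ := by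
            have e : ENNReal.ofReal (h ^ 2 * (2 * q (u 0) + 6 * Φ)) =
                ENNReal.ofReal h * ENNReal.ofReal (h * (2 * q (u 0) + 4 * Φ)) +
                ENNReal.ofReal (2 * h) * (ENNReal.ofReal h * ENNReal.ofReal Φ) := by
              rw [← ENNReal.ofReal_mul hh.le, ← ENNReal.ofReal_mul hh.le,
                ← ENNReal.ofReal_mul (by positivity),
                ← ENNReal.ofReal_add (by positivity) (by positivity)]
              congr 1
              ring
            rw [e]
            ring
    exact (ENNReal.add_le_add_iff_right hJfin).1 h4
  -- The supremum `s` over the shifts is finite, so that half of it can be absorbed.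
  set s := ⨆ σ ∈ Ioc 0 h, a σ with hs
  have hsfin : s ≠ ∞ := by
    obtain ⟨M, hM⟩ := (isCompact_Icc (a := (0 : ℝ)) (b := T)).exists_bound_of_continuousOn
      hvc.continuousOn
    have hle : s ≤ ENNReal.ofReal ((2 * M) ^ 2) * volume (Ioo 0 (T - h)) := by
      refine iSup₂_le fun σ hσ => ?_
      rw [← setLIntegral_const]
      refine setLIntegral_mono' measurableSet_Ioo fun r hr => ?_
      simp only [A]
      rw [enorm_sq_eq_ofReal]
      refine ENNReal.ofReal_le_ofReal (pow_le_pow_left₀ (norm_nonneg _) ?_ 2)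
      have h1 := hM (r + σ) ⟨by linarith [hr.1, hσ.1], by linarith [hr.2, hσ.2]⟩
      have h2 := hM r ⟨hr.1.le, by linarith [hr.2]⟩
      exact (norm_sub_le _ _).trans (by linarith)
    refine ne_top_of_le_ne_top ?_ hle
    rw [Real.volume_Ioo]
    exact ENNReal.mul_ne_top ENNReal.ofReal_ne_top ENNReal.ofReal_ne_top
  have hsle : s ≤ ENNReal.ofReal (h ^ 2 * (2 * q (u 0) + 6 * Φ)) + ENNReal.ofReal (1 / 2) * s := by
    refine iSup₂_le fun σ hσ => (hint σ hσ).trans (add_le_add le_rfl ?_)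
    have h1 : ∫⁻ x in Ioo 0 h, a x ≤ s * ENNReal.ofReal h := by
      have : ∫⁻ x in Ioo 0 h, a x ≤ ∫⁻ x in Ioo 0 h, s :=
        setLIntegral_mono' measurableSet_Ioo fun x hx =>
          le_iSup₂ (f := fun σ (_ : σ ∈ Ioc 0 h) => a σ) x ⟨hx.1, hx.2.le⟩
      rwa [setLIntegral_const, Real.volume_Ioo, sub_zero] at this
    calc _ ≤ ENNReal.ofReal (2 * h)⁻¹ * (s * ENNReal.ofReal h) := by gcongr
      _ = (ENNReal.ofReal (2 * h)⁻¹ * ENNReal.ofReal h) * s := by ring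
      _ = _ := by
          rw [← ENNReal.ofReal_mul (by positivity)]
          congr 2
          field_simp
  have hah : ∫⁻ r in Ioo 0 (T - h), ‖u (r + h) - u r‖ₑ ^ 2 = a h := by
    refine setLIntegral_congr_fun measurableSet_Ioo fun r hr => ?_
    simp only [A]
    rw [hvu _ ⟨by linarith [hr.1], by linarith [hr.2]⟩, hvu _ ⟨hr.1.le, by linarith [hr.2]⟩]
  rw [hah]
  refine (le_iSup₂ (f := fun σ (_ : σ ∈ Ioc 0 h) => a σ) h ⟨hh, le_rfl⟩).trans ?_
  rw [← hs, ← ENNReal.ofReal_toReal hsfin] at *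
  rw [← ENNReal.ofReal_mul (by norm_num), ← ENNReal.ofReal_add (by positivity) (by positivity),
    ENNReal.ofReal_le_ofReal_iff (by positivity)] at hsle
  refine ENNReal.ofReal_le_ofReal ?_
  linarith

end Regularity

section DerivRegularity

lemma AbsolutelyContinuousOnInterval.const_inner {X : Type*} [NormedAddCommGroup X]
    [InnerProductSpace ℝ X] {v : ℝ → X} {a b : ℝ} (hv : AbsolutelyContinuousOnInterval v a b)
    (w : X) : AbsolutelyContinuousOnInterval (fun t => inner ℝ w (v t)) a b := by
  have h1 : Tendsto (fun e : ℕ × (ℕ → ℝ × ℝ) => ‖w‖ *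
      ∑ i ∈ Finset.range e.1, dist (v (e.2 i).1) (v (e.2 i).2))
      (AbsolutelyContinuousOnInterval.totalLengthFilter ⊓
        𝓟 (AbsolutelyContinuousOnInterval.disjWithin a b)) (𝓝 (‖w‖ * 0)) :=
    Tendsto.const_mul ‖w‖ hv
  rw [mul_zero] at h1
  refine squeeze_zero (fun t => Finset.sum_nonneg fun i _ => dist_nonneg) (fun t => ?_) h1
  rw [Finset.mul_sum]
  refine Finset.sum_le_sum fun i _ => ?_
  rw [dist_eq_norm, dist_eq_norm, ← inner_sub_right]
  exact norm_inner_le_norm _ _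

variable {H : Type*} [NormedAddCommGroup H] [InnerProductSpace ℝ H]
  {K : Set H} {q : H → ℝ} {T : ℝ} {f u : ℝ → H}

/-- The time derivative is square integrable, by Fatou's lemma. -/
lemma IsEVISolution.lintegral_deriv_sq_le (hu : IsEVISolution K q T f u) (hq0 : ∀ x, 0 ≤ q x)
    (hqm : ∀ v : ℝ → H, Continuous v → Measurable fun t => q (v t))
    (hf : MemLp f 2 (volume.restrict (Ioo 0 T))) (hu0 : u 0 ∈ K) {Φ : ℝ}
    (hΦ : 0 ≤ Φ) (hfΦ : ∫⁻ t in Ioo 0 T, ‖f t‖ₑ ^ 2 ≤ ENNReal.ofReal Φ) (hT : 0 < T) :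
    ∫⁻ t in Ioo 0 T, ‖deriv u t‖ₑ ^ 2 ≤ ENNReal.ofReal (4 * q (u 0) + 12 * Φ) := by
  have hq00 := hq0 (u 0)
  let h : ℕ → ℝ := fun n => T / ((n : ℝ) + 2)
  have hh : ∀ n, 0 < h n := fun n => by positivity
  have hhT : ∀ n, h n < T := fun n => by
    have : (0 : ℝ) ≤ n := by positivity
    exact (div_lt_self hT (by linarith))
  have hh0 : Tendsto h atTop (𝓝 0) :=
    tendsto_const_nhds.div_atTop (tendsto_atTop_add_const_right _ _ tendsto_natCast_atTop_atTop)
  set v : ℝ → H := IccExtend hT.le ((Icc 0 T).domRestrict u) with hv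
  have hvc : Continuous v :=
    (continuousOn_iff_continuous_domRestrict.1 hu.continuousOn).Icc_extend'
  have hvu : ∀ t ∈ Icc 0 T, v t = u t := fun t ht => by rw [hv, IccExtend_of_mem _ _ ht]; rfl
  let F : ℕ → ℝ → ℝ≥0∞ := fun n =>
    (Ioo 0 (T - h n)).indicator fun r => ‖(h n)⁻¹ • (v (r + h n) - v r)‖ₑ ^ 2
  have hF : ∀ n, Measurable (F n) := fun n => by
    have : Continuous fun r => (h n)⁻¹ • (v (r + h n) - v r) := by fun_prop
    exact (this.enorm.measurable.pow_const 2).indicator measurableSet_Ioo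
  have hFle : ∀ n, ∫⁻ t in Ioo 0 T, F n t ≤ ENNReal.ofReal (4 * q (u 0) + 12 * Φ) := fun n => by
    have h1 := hu.translation_le hq0 hqm hf hu0 hΦ hfΦ (hh n) (hhT n)
    have hsub : Ioo 0 (T - h n) ⊆ Ioo 0 T := Ioo_subset_Ioo_right (by linarith [hh n])
    rw [lintegral_indicator measurableSet_Ioo, Measure.restrict_restrict measurableSet_Ioo,
      inter_eq_left.2 hsub]
    have e : ∫⁻ r in Ioo 0 (T - h n), ‖(h n)⁻¹ • (v (r + h n) - v r)‖ₑ ^ 2 =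
        ENNReal.ofReal ((h n)⁻¹ ^ 2) * ∫⁻ r in Ioo 0 (T - h n), ‖u (r + h n) - u r‖ₑ ^ 2 := by
      rw [← lintegral_const_mul' _ _ ENNReal.ofReal_ne_top]
      refine setLIntegral_congr_fun measurableSet_Ioo fun r hr => ?_
      have hh' := hh n
      rw [hvu _ ⟨by linarith [hr.1], by linarith [hr.2]⟩, hvu _ ⟨hr.1.le, by linarith [hr.2]⟩,
        enorm_sq_eq_ofReal, enorm_sq_eq_ofReal, ← ENNReal.ofReal_mul (by positivity), norm_smul,
        mul_pow, Real.norm_of_nonneg (by positivity)]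
    rw [e]
    calc _ ≤ ENNReal.ofReal ((h n)⁻¹ ^ 2) *
          ENNReal.ofReal ((h n) ^ 2 * (4 * q (u 0) + 12 * Φ)) := by gcongr
      _ = _ := by
          have := (hh n).ne'
          rw [← ENNReal.ofReal_mul (by positivity)]
          congr 1
          field_simp
  have hlim : ∀ᵐ t ∂(volume.restrict (Ioo 0 T)),
      liminf (fun n => F n t) atTop = ‖deriv u t‖ₑ ^ 2 := by
    filter_upwards [hu.inequality, ae_restrict_mem measurableSet_Ioo] with t ht htI
    obtain ⟨-, u', hu', -⟩ := ht
    refine Tendsto.liminf_eq ?_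
    have h1 : Tendsto (fun n => (h n)⁻¹ • (u (t + h n) - u t)) atTop (𝓝 (deriv u t)) := by
      rw [hu'.deriv]
      refine (hasDerivAt_iff_tendsto_slope_zero.1 hu').comp
        (tendsto_nhdsWithin_iff.2 ⟨hh0, Eventually.of_forall fun n => (hh n).ne'⟩)
    have h2 := (ENNReal.continuous_pow 2).tendsto _ |>.comp (h1.enorm)
    refine h2.congr' ?_
    filter_upwards [hh0.eventually_lt_const (sub_pos.2 htI.2)] with n hn
    have hm : t ∈ Ioo 0 (T - h n) := ⟨htI.1, by linarith⟩
    simp only [F, Function.comp_apply]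
    rw [indicator_of_mem hm, hvu _ ⟨by linarith [htI.1, hh n], by linarith⟩,
      hvu _ (Ioo_subset_Icc_self htI)]
  rw [← lintegral_congr_ae hlim]
  refine (lintegral_liminf_le hF).trans ?_
  exact liminf_le_of_frequently_le' (Frequently.of_forall hFle)

/-- The fundamental theorem of calculus for the solution, by duality from scalar functions. -/
lemma IsEVISolution.norm_sub_le_integral_deriv (hu : IsEVISolution K q T f u)
    (hm : MemLp (deriv u) 2 (volume.restrict (Ioo 0 T))) {a b : ℝ} (ha : 0 ≤ a) (hab : a ≤ b)
    (hb : b ≤ T) : ‖u b - u a‖ ≤ ∫ t in a..b, ‖deriv u t‖ := by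
  set w := u b - u a with hw
  have hi := (intervalIntegrable_of_memLp hm ha hab hb).norm.const_mul ‖w‖
  have key := (lintegral_le_of_deriv_add_le (g := fun t => inner ℝ w (u t)) (P := fun _ => 0)
    (B := fun t => ‖w‖ * ‖deriv u t‖) hab
    (continuousOn_const.inner (hu.continuousOn.mono (Icc_subset_Icc ha hb))) ?_ hi ?_).1
  · rw [intervalIntegral.integral_const_mul, ← inner_sub_right, ← neg_sub (u b), ← hw,
      inner_neg_right, real_inner_self_eq_norm_sq] at key
    rcases eq_or_ne w 0 with h | h
    · rw [h, norm_zero]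
      exact intervalIntegral.integral_nonneg hab fun t _ => norm_nonneg _
    · have := norm_pos_iff.2 h
      exact le_of_mul_le_mul_left (by linarith [sq ‖w‖]) this
  · intro a' b' ha' hab' hb'
    exact AbsolutelyContinuousOnInterval.const_inner
      (hu.absolutelyContinuous a' b' (by linarith) hab' (by linarith)) w
  · filter_upwards [ae_restrict_of_ae_restrict_of_subset (Ioo_subset_Ioo ha hb) hu.inequality]
      with t ht
    obtain ⟨-, u', hu', -⟩ := ht
    refine ⟨le_rfl, inner ℝ w u', ?_, ?_⟩
    · simpa using (hasDerivAt_const t w).inner ℝ hu'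
    · rw [hu'.deriv, add_zero]
      exact real_inner_le_norm _ _

variable [CompleteSpace H]

/-- The energy bound for the time derivative. -/
lemma IsEVISolution.memLp_deriv (hu : IsEVISolution K q T f u) (hq0 : ∀ x, 0 ≤ q x)
    (hqm : ∀ v : ℝ → H, Continuous v → Measurable fun t => q (v t))
    (hf : MemLp f 2 (volume.restrict (Ioo 0 T))) (hu0 : u 0 ∈ K) (hT : 0 < T) {Φ : ℝ}
    (hΦ : Φ = ∫ t in (0)..T, ‖f t‖ ^ 2) :
    MemLp (deriv u) 2 (volume.restrict (Ioo 0 T)) ∧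
      ∫ t in (0)..T, ‖deriv u t‖ ^ 2 ≤ 4 * q (u 0) + 12 * Φ := by
  have hq00 := hq0 (u 0)
  have hΦ0 : 0 ≤ Φ := by
    rw [hΦ]
    exact intervalIntegral.integral_nonneg hT.le fun t _ => by positivity
  have h1 := hu.lintegral_deriv_sq_le hq0 hqm hf hu0 hΦ0 (by
    rw [hΦ, ofReal_integral_norm_sq hT.le
      (intervalIntegrable_norm_sq_of_memLp hf le_rfl hT.le le_rfl)]) hT
  have hm : MemLp (deriv u) 2 (volume.restrict (Ioo 0 T)) := by
    refine ⟨(stronglyMeasurable_deriv u).aestronglyMeasurable, ?_⟩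
    rw [eLpNorm_lt_top_iff_lintegral_rpow_enorm_lt_top two_ne_zero ENNReal.ofNat_ne_top]
    simp only [ENNReal.toReal_ofNat, ENNReal.rpow_ofNat]
    exact h1.trans_lt ENNReal.ofReal_lt_top
  refine ⟨hm, ?_⟩
  have hi : IntervalIntegrable (fun t => ‖deriv u t‖ ^ 2) volume 0 T :=
    intervalIntegrable_norm_sq_of_memLp (g := deriv u) hm (le_refl 0) hT.le (le_refl T)
  rw [← ofReal_integral_norm_sq (g := deriv u) hT.le hi] at h1
  exact (ENNReal.ofReal_le_ofReal_iff (by positivity)).1 h1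

/-- Half order convergence for square integrable forcing terms. -/
theorem IsEVISolution.error_of_memLp {c κ τ : ℝ} {N : ℕ} {F U : ℕ → H}
    (hu : IsEVISolution K q T f u) (hq : IsEnergy K q c)
    (hqm : ∀ v : ℝ → H, Continuous v → Measurable fun t => q (v t))
    (hU : IsApproxScheme K q κ τ N F U) (hτ : 0 < τ) (hT : N * τ = T) (hT0 : 0 < T)
    (hu0 : u 0 = U 0) (hf : MemLp f 2 (volume.restrict (Ioo 0 T)))
    (hF : ∀ k < N, F (k + 1) = τ⁻¹ • ∫ t in (k * τ)..(((k : ℝ) + 1) * τ), f t) {X : ℝ}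
    (hX : X = τ * (55 * (∫ t in (0)..T, ‖f t‖ ^ 2) + 21 * q (U 0)) + 12 * T * κ ^ 2 / c) :
    (∀ k < N, ∀ t ∈ Icc (k * τ) (((k : ℝ) + 1) * τ), ‖u t - stepInterp τ U k t‖ ≤ 2 * √X) ∧
      ∑ k ∈ Finset.range N, ∫⁻ r in Ioo (k * τ) (((k : ℝ) + 1) * τ),
        ENNReal.ofReal (q (u r - U (k + 1)) / 2) ≤ ENNReal.ofReal X := by
  obtain ⟨h1, h2⟩ := hu.memLp_deriv hq.nonneg hqm hf (by rw [hu0]; exact hU.mem 0 (Nat.zero_le _))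
    hT0 rfl
  obtain ⟨h3, h4⟩ := hu.error_of_average hq hU hτ hT hu0 hf hF h1
    (fun a b => hu.norm_sub_le_integral_deriv h1) rfl
  set Y := τ * (4 * (∫ t in (0)..T, ‖deriv u t‖ ^ 2) + 7 * (∫ t in (0)..T, ‖f t‖ ^ 2) +
    5 * q (U 0)) + 12 * T * κ ^ 2 / c with hY
  have hYX : Y ≤ X := by
    rw [hX, hY]
    rw [hu0] at h2
    gcongr ?_ + _
    refine mul_le_mul_of_nonneg_left ?_ hτ.le
    linarith
  exact ⟨fun k hk t ht => (h3 k hk t ht).trans (by gcongr), h4.trans (by gcongr)⟩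

end DerivRegularity

/-! ### The fractional obstacle problem as an evolution variational inequality -/

section Instantiation

variable {d : ℕ} {Ω : Set (E d)} {c s τ T Y : ℝ} {ψ u₀ : L2 Ω} {f u : ℝ → L2 Ω} {N : ℕ}
  {F U : ℕ → L2 Ω} {V : ℕ → CylSpace Ω (1 - 2 * s) Y}

/-- The quadratic form `⟨(-Δ)^s w, w⟩`. -/
def fracEnergy (Ω : Set (E d)) (s : ℝ) (w : L2 Ω) : ℝ := fracPairing Ω s w w

/-- Outside `ℍ^s(Ω)` both sides are zero. -/
lemma fracEnergy_eq_toReal (hc : IsEigenvalueBound Ω c) (w : L2 Ω) :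
    fracEnergy Ω s w = (hNormSq Ω s w).toReal := by
  by_cases hw : w ∈ hSpace Ω s
  · rw [hNormSq_eq hc hw, ENNReal.toReal_ofReal (fracPairing_self_nonneg hc s w), fracEnergy]
  · have h1 : hNormSq Ω s w = ∞ := not_lt_top_iff.1 hw
    rw [h1, ENNReal.toReal_top, fracEnergy, fracPairing_self,
      tsum_eq_zero_of_not_summable fun h => hw ((mem_hSpace_iff hc).2 h)]

/-- The form is measurable along curves, since the `ℍ^s` norm is lower semicontinuous on `L²(Ω)`. -/
lemma measurable_fracEnergy_comp (hc : IsEigenvalueBound Ω c) (v : ℝ → L2 Ω) (hv : Continuous v) :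
    Measurable fun t => fracEnergy Ω s (v t) := by
  simp only [fracEnergy_eq_toReal hc]
  exact ((lowerSemicontinuous_hNormSq Ω s).comp hv).measurable.ennreal_toReal

lemma two_mul_fracPairing_sub (hc : IsEigenvalueBound Ω c) {w z : L2 Ω} (hw : w ∈ hSpace Ω s)
    (hz : z ∈ hSpace Ω s) : 2 * fracPairing Ω s w (w - z) =
      fracEnergy Ω s w - fracEnergy Ω s z + fracEnergy Ω s (w - z) := by
  simp only [fracEnergy]
  rw [fracPairing_sub_self hc hw hz, fracPairing_sub_right hc hw hw hz]
  ring

lemma admissible_convex (hc : IsEigenvalueBound Ω c) {w z : L2 Ω} (hw : w ∈ admissible Ω s ψ)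
    (hz : z ∈ admissible Ω s ψ) {θ : ℝ} (hθ : θ ∈ Icc (0 : ℝ) 1) :
    (1 - θ) • w + θ • z ∈ admissible Ω s ψ := by
  refine ⟨hSpace_add hc (hSpace_smul hc _ hw.1) (hSpace_smul hc _ hz.1), ?_⟩
  filter_upwards [hw.2, hz.2, Lp.coeFn_add ((1 - θ) • w) (θ • z), Lp.coeFn_smul (1 - θ) w,
    Lp.coeFn_smul θ z] with x h1 h2 h3 h4 h5
  rw [h3, Pi.add_apply, h4, h5, Pi.smul_apply, Pi.smul_apply, smul_eq_mul, smul_eq_mul]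
  nlinarith [hθ.1, hθ.2]

lemma isEnergy_fracEnergy (hΩo : IsOpen Ω) (hΩ : Bornology.IsBounded Ω)
    (hc : IsEigenvalueBound Ω c) (hs : 0 ≤ s) (ψ : L2 Ω) :
    IsEnergy (admissible Ω s ψ) (fracEnergy Ω s) (c ^ s) where
  pos := Real.rpow_pos_of_pos hc.1 s
  nonneg := fracPairing_self_nonneg hc s
  coercive x hx y hy := le_fracPairing_self hΩo hΩ hc hs (hSpace_sub hc hx.1 hy.1)
  symm x := by simp [fracEnergy, fracPairing_self]
  convex x hx y hy θ hθ := by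
    refine ⟨admissible_convex hc hx hy hθ, ?_⟩
    have hxy := hSpace_sub hc hx.1 hy.1
    have e : (1 - θ) • x + θ • y = x - θ • (x - y) := by module
    have h1 := fracPairing_self_nonneg hc s (x - y)
    have h2 : fracPairing Ω s y y = fracPairing Ω s (x - y) (x - y) - fracPairing Ω s x x +
        2 * fracPairing Ω s x y := by
      rw [fracPairing_sub_self hc hx.1 hy.1]
      ring
    simp only [fracEnergy]
    rw [e, fracPairing_sub_self hc hx.1 (hSpace_smul hc θ hxy), fracPairing_smul_right,
      fracPairing_smul_right, fracPairing_comm s (θ • _), fracPairing_smul_right,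
      fracPairing_sub_right hc hx.1 hx.1 hy.1, h2]
    nlinarith [mul_nonneg (mul_nonneg hθ.1 (sub_nonneg.2 hθ.2)) h1]

lemma IsStrongSolution.isEVISolution (hc : IsEigenvalueBound Ω c)
    (hu : IsStrongSolution Ω s T ψ u₀ f u) :
    IsEVISolution (admissible Ω s ψ) (fracEnergy Ω s) T f u where
  continuousOn := hu.1
  absolutelyContinuous := hu.2.1
  inequality := by
    filter_upwards [hu.2.2.2] with t ht
    obtain ⟨h1, u', h2, h3⟩ := ht
    refine ⟨h1, u', h2, fun φ hφ => ?_⟩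
    have := h3 φ hφ
    have e := two_mul_fracPairing_sub hc h1.1 hφ.1
    rw [inner_sub_left]
    linarith

lemma IsSemidiscreteSolution.tr_mem_admissible (hc : IsEigenvalueBound Ω c)
    (hs : s ∈ Ioo (0 : ℝ) 1) (hY : 1 ≤ Y) (hV : IsSemidiscreteSolution Ω s Y ψ u₀ F N τ V) {k : ℕ}
    (hk : k ≤ N) : tr (V k) ∈ admissible Ω s ψ :=
  ⟨(trace_energy_le hc hs (by linarith) (hV.1 k hk).1).1, (hV.1 k hk).2⟩

lemma IsSemidiscreteSolution.isApproxScheme (hc : IsEigenvalueBound Ω c) (hs : s ∈ Ioo (0 : ℝ) 1)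
    {K : ℝ} (hK : 0 ≤ K) (hext : HasExtension Ω s c K) (hY : 1 ≤ Y)
    (hV : IsSemidiscreteSolution Ω s Y ψ u₀ F N τ V) {M : ℝ}
    (hM : ∀ k ≤ N, ‖tr (V k)‖ ≤ M) :
    IsApproxScheme (admissible Ω s ψ) (fracEnergy Ω s) (K * Real.exp (-(√c * Y / 2)) * M) τ N F
      (fun k => tr (V k)) where
  mem k hk := hV.tr_mem_admissible hc hs hY hk
  inequality k hk φ hφ := by
    have h1 := hV.inequality hc hs hK hext hY hk hφ
    have h2 := two_mul_fracPairing_sub hc (hV.tr_mem_admissible hc hs hY hk).1 hφ.1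
    have h3 : K * Real.exp (-(√c * Y / 2)) * ‖tr (V (k + 1))‖ * ‖tr (V (k + 1)) - φ‖ ≤
        K * Real.exp (-(√c * Y / 2)) * M * ‖tr (V (k + 1)) - φ‖ := by
      gcongr
      exact hM _ hk
    linarith

/-- The first eigenvalue is itself a bound. (The existence of an eigenvalue is not needed:
`sInf ∅ = 0` is below any positive bound.) -/
lemma exists_bound_ge_firstEigenvalue (hd : 1 ≤ d) (hΩo : IsOpen Ω) (hΩ : Bornology.IsBounded Ω) :
    ∃ c, IsEigenvalueBound Ω c ∧ firstEigenvalue Ω ≤ c := by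
  obtain ⟨c, hc, h⟩ := exists_eigenvalue_lower_bound hd hΩo hΩ
  by_cases hne : {mu : ℝ | eigenspace Ω mu ≠ ⊥}.Nonempty
  · refine ⟨firstEigenvalue Ω, ⟨hc.trans_le (le_csInf hne h), fun mu hmu => ?_⟩, le_rfl⟩
    exact csInf_le ⟨c, h⟩ hmu
  · refine ⟨c, ⟨hc, h⟩, ?_⟩
    rw [firstEigenvalue, not_nonempty_iff_eq_empty.1 hne, Real.sInf_empty]
    exact hc.le

lemma IsConvexPolyhedralDomain.isOpen (hΩ : IsConvexPolyhedralDomain Ω) : IsOpen Ω := by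
  obtain ⟨-, -, N, a, b, -, rfl⟩ := hΩ
  simp only [ofPred_forall]
  exact isOpen_iInter_of_finite fun i => isOpen_lt (by fun_prop) continuous_const

/-! ### The interpolants -/

lemma stepIndex_eq (hτ : 0 < τ) {k : ℕ} {t : ℝ} (h1 : k * τ < t) (h2 : t ≤ ((k : ℝ) + 1) * τ) :
    stepIndex τ t = k := by
  have h : ⌈t / τ⌉₊ = k + 1 := by
    rw [Nat.ceil_eq_iff (Nat.succ_ne_zero k)]
    refine ⟨?_, ?_⟩
    · rw [Nat.succ_sub_one, lt_div_iff₀ hτ]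
      exact h1
    · rw [div_le_iff₀ hτ]
      push_cast
      exact h2
  rw [stepIndex, h, Nat.add_sub_cancel]

lemma linInterp_eq (hτ : 0 < τ) {k : ℕ} {t : ℝ} (h1 : k * τ < t)
    (h2 : t ≤ ((k : ℝ) + 1) * τ) : linInterp τ U t = stepInterp τ U k t := by
  rw [linInterp, stepIndex_eq hτ h1 h2, stepInterp]
  have e1 : (t - k * τ) / τ = 1 - (((k : ℝ) + 1) * τ - t) * τ⁻¹ := by
    field_simp
    ring
  rw [e1, div_eq_mul_inv]
  module

lemma exists_step (hτ : 0 < τ) (hT : N * τ = T) {t : ℝ} (ht : t ∈ Ioo 0 T) :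
    ∃ k < N, t ∈ Ioc (k * τ) (((k : ℝ) + 1) * τ) := by
  have h0 : 0 < t / τ := div_pos ht.1 hτ
  obtain ⟨k, hk⟩ := Nat.exists_eq_succ_of_ne_zero (Nat.ceil_pos.2 h0).ne'
  have h1 := (Nat.ceil_eq_iff (Nat.succ_ne_zero k)).1 hk
  rw [Nat.succ_sub_one, lt_div_iff₀ hτ, div_le_iff₀ hτ] at h1
  push_cast at h1
  refine ⟨k, ?_, h1⟩
  have : (k : ℝ) < N := by
    by_contra! h
    nlinarith [ht.2]
  exact_mod_cast this

lemma lintegral_le_sum_steps (hτ : 0 < τ) (hT : N * τ = T) (g : ℝ → ℝ≥0∞) :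
    ∫⁻ t in Ioo 0 T, g t ≤
      ∑ k ∈ Finset.range N, ∫⁻ t in Ioo (k * τ) (((k : ℝ) + 1) * τ), g t := by
  have hsub : Ioo 0 T ⊆ ⋃ k : Fin N, Ioc ((k : ℕ) * τ) ((((k : ℕ) : ℝ) + 1) * τ) := fun t ht => by
    obtain ⟨k, hk, h⟩ := exists_step hτ hT ht
    exact mem_iUnion.2 ⟨⟨k, hk⟩, h⟩
  refine (lintegral_mono_set hsub).trans ((lintegral_iUnion_le _ _).trans ?_)
  rw [tsum_fintype, Finset.sum_range]
  simp only [restrict_Ioo_eq_restrict_Ioc, le_refl]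

/-- The error functional in terms of bounds on the single time steps. -/
lemma timeError_le (hc : IsEigenvalueBound Ω c) (hτ : 0 < τ) (hT : N * τ = T)
    (hu : ∀ᵐ t ∂(volume.restrict (Ioo 0 T)), u t ∈ hSpace Ω s) (hU : ∀ k ≤ N, U k ∈ hSpace Ω s)
    {D X : ℝ} (hD : 0 ≤ D) (hX : 0 ≤ X)
    (h1 : ∀ k < N, ∀ t ∈ Icc (k * τ) (((k : ℝ) + 1) * τ), ‖u t - stepInterp τ U k t‖ ≤ D)
    (h2 : ∑ k ∈ Finset.range N, ∫⁻ r in Ioo (k * τ) (((k : ℝ) + 1) * τ),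
      ENNReal.ofReal (fracEnergy Ω s (u r - U (k + 1)) / 2) ≤ ENNReal.ofReal X) :
    timeError Ω s T τ u U ≤ ENNReal.ofReal (D + √(2 * X)) := by
  rw [timeError, ENNReal.ofReal_add hD (Real.sqrt_nonneg _)]
  refine add_le_add ?_ ?_
  · rw [eLpNorm_exponent_top]
    refine eLpNormEssSup_le_of_ae_bound ?_
    filter_upwards [ae_restrict_mem measurableSet_Ioo] with t ht
    obtain ⟨k, hk, h⟩ := exists_step hτ hT ht
    rw [linInterp_eq hτ h.1 h.2]
    exact h1 k hk t (Ioc_subset_Icc_self h)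
  · have key : ∫⁻ t in Ioo 0 T, hNormSq Ω s (u t - constInterp τ U t) ≤
        ENNReal.ofReal (2 * X) := by
      refine (lintegral_le_sum_steps hτ hT _).trans ?_
      rw [ENNReal.ofReal_mul zero_le_two]
      refine le_trans ?_ (mul_le_mul_right h2 _)
      rw [Finset.mul_sum]
      refine Finset.sum_le_sum fun k hk => ?_
      have hk' := Finset.mem_range.1 hk
      rw [← lintegral_const_mul' _ _ ENNReal.ofReal_ne_top]
      refine lintegral_mono_ae ?_
      have hsub : Ioo (k * τ) (((k : ℝ) + 1) * τ) ⊆ Ioo 0 T := by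
        have : (k : ℝ) + 1 ≤ N := by exact_mod_cast hk'
        refine Ioo_subset_Ioo (by positivity) ?_
        rw [← hT]
        gcongr
      filter_upwards [ae_restrict_of_ae_restrict_of_subset hsub hu,
        ae_restrict_mem measurableSet_Ioo] with t ht htI
      rw [constInterp, stepIndex_eq hτ htI.1 htI.2.le,
        hNormSq_eq hc (hSpace_sub hc ht (hU _ hk')), ← ENNReal.ofReal_mul zero_le_two, fracEnergy,
        mul_div_cancel₀ _ two_ne_zero]
    rw [Real.sqrt_eq_rpow, ← ENNReal.ofReal_rpow_of_nonneg (by positivity) (by norm_num)]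
    gcongr

end Instantiation

/-! ### Right limits of functions of bounded variation -/

/-- The variation function of `h`, made right continuous, controls `h` and its right limits. -/
lemma exists_rightLim_bound {X : Type*} [NormedAddCommGroup X] [CompleteSpace X] {h : ℝ → X}
    (hh : BoundedVariationOn h univ) :
    ∃ W : ℝ → ℝ, (∀ x y, x < y → ‖h.rightLim y - h.rightLim x‖ ≤ W y - W x) ∧
      (∀ x r y, x < r → r ≤ y → ‖h r - h.rightLim y‖ ≤ W y - W x) ∧
      ∀ x y, x ≤ y → W y - W x ≤ (eVariationOn h univ).toReal := by
  have hl := hh.locallyBoundedVariationOn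
  let V : ℝ → ℝ := variationOnFromTo h univ 0
  have hsub : ∀ x y, x ≤ y → V y - V x = (eVariationOn h (univ ∩ Icc x y)).toReal :=
    fun x y hxy => by
      rw [← variationOnFromTo.eq_of_le h univ hxy]
      exact variationOnFromTo.sub_right hl (mem_univ 0) (mem_univ y) (mem_univ x)
  have hV : Monotone V := fun x y hxy => by
    rw [← sub_nonneg, hsub x y hxy]
    exact ENNReal.toReal_nonneg
  have hVh : ∀ x y, x ≤ y → ‖h x - h y‖ ≤ V y - V x := fun x y hxy => by
    rw [hsub x y hxy, ← dist_eq_norm]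
    exact (hh.mono (subset_univ _)).dist_le ⟨mem_univ _, left_mem_Icc.2 hxy⟩
      ⟨mem_univ _, right_mem_Icc.2 hxy⟩
  have h1 : ∀ x y, x ≤ y → ‖h x - h.rightLim y‖ ≤ V.rightLim y - V x := fun x y hxy => by
    refine le_of_tendsto_of_tendsto ((tendsto_const_nhds.sub (hh.tendsto_rightLim y)).norm)
      ((hV.tendsto_rightLim y).sub tendsto_const_nhds) ?_
    filter_upwards [self_mem_nhdsWithin] with z hz
    exact hVh x z (hxy.trans (le_of_lt hz))
  refine ⟨V.rightLim, fun x y hxy => ?_, fun x r y hxr hry => ?_, fun x y hxy => ?_⟩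
  · rw [norm_sub_rev]
    refine le_of_tendsto_of_tendsto (((hh.tendsto_rightLim x).sub tendsto_const_nhds).norm)
      (tendsto_const_nhds.sub (hV.tendsto_rightLim x)) ?_
    filter_upwards [Ioo_mem_nhdsGT hxy] with z hz
    exact h1 z y hz.2.le
  · exact (h1 r y hry).trans (sub_le_sub_left (hV.rightLim_le hxr) _)
  · have e1 := hV.rightLim_le (lt_add_one y)
    have e2 := hV.le_rightLim (le_refl x)
    refine (sub_le_sub e1 e2).trans ?_
    rw [hsub x (y + 1) (by linarith)]
    exact ENNReal.toReal_mono hh (eVariationOn.mono h (subset_univ _))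

section Forcing

variable {d : ℕ} {Ω : Set (E d)} {τ T : ℝ} {f : ℝ → L2 Ω} {N : ℕ}

/-- On each time step the forcing and its nodal values differ by at most `b k`, and the `b k` add up
to at most the variation of the forcing. -/
lemma exists_nodalForcing_bound (hf : BoundedVariationOn f (Icc 0 T)) (hτ : 0 < τ)
    (hT : N * τ = T) : ∃ b : ℕ → ℝ,
      (∀ k < N, ‖nodalForcing T τ f (k + 1) - nodalForcing T τ f k‖ ≤ b k) ∧
      (∀ k < N, ∀ r ∈ Ioo (k * τ) (((k : ℝ) + 1) * τ), ‖f r - nodalForcing T τ f (k + 1)‖ ≤ b k) ∧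
      ∑ k ∈ Finset.range N, b k ≤ (eVariationOn f (Icc 0 T)).toReal := by
  have hT0 : 0 ≤ T := by rw [← hT]; positivity
  -- `f`, continued by constants to both sides
  let h : ℝ → L2 Ω := fun r => f (max 0 (min r T))
  have hm : Monotone fun r : ℝ => max 0 (min r T) := fun x y hxy =>
    max_le_max le_rfl (min_le_min hxy le_rfl)
  have hle : eVariationOn h univ ≤ eVariationOn f (Icc 0 T) :=
    eVariationOn.comp_le_of_monotoneOn f _ (hm.monotoneOn univ)
      fun r _ => ⟨le_max_left _ _, max_le hT0 (min_le_right _ _)⟩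
  have hh : BoundedVariationOn h univ := ne_top_of_le_ne_top hf hle
  have hlim : ∀ k : ℕ, nodalForcing T τ f k = h.rightLim (k * τ) := fun k => by
    refine rightLim_eq_of_tendsto ?_
    refine (hh.tendsto_rightLim _).congr' ?_
    filter_upwards [self_mem_nhdsWithin] with r hr
    have : 0 ≤ min r T := le_min ((by positivity : (0 : ℝ) ≤ k * τ).trans (le_of_lt hr)) hT0
    simp only [h, max_eq_right this]
  obtain ⟨W, h1, h2, h3⟩ := exists_rightLim_bound hh
  refine ⟨fun k => W (((k : ℝ) + 1) * τ) - W (k * τ), fun k hk => ?_, fun k hk r hr => ?_, ?_⟩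
  · rw [hlim, hlim]
    push_cast
    exact h1 _ _ (by linarith)
  · obtain ⟨k1, k2, k3⟩ := step_mem_Icc hτ hT hk
    have e : f r = h r := by
      simp only [h]
      rw [min_eq_left (by linarith [hr.2]), max_eq_right (by linarith [hr.1])]
    rw [hlim, e]
    push_cast
    exact h2 _ _ _ hr.1 hr.2.le
  · have e : ∑ k ∈ Finset.range N, (W (((k : ℝ) + 1) * τ) - W (k * τ)) = W T - W 0 := by
      have := Finset.sum_range_sub (fun k : ℕ => W (k * τ)) N
      push_cast at this
      rw [this, hT, zero_mul]
    rw [e]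
    exact (h3 0 T hT0).trans (ENNReal.toReal_mono hf hle)

lemma sum_lintegral_steps_le (hτ : 0 < τ) (hT : N * τ = T) (g : ℝ → ℝ≥0∞) :
    ∑ k ∈ Finset.range N, ∫⁻ t in Ioo (k * τ) (((k : ℝ) + 1) * τ), g t ≤ ∫⁻ t in Ioo 0 T, g t := by
  have hd : Pairwise (Function.onFun Disjoint
      fun k : ℕ => Ioo ((k : ℝ) * τ) (((k : ℝ) + 1) * τ)) := by
    have hm : Monotone fun k : ℕ => (k : ℝ) * τ := fun i j hij => by
      have : (i : ℝ) ≤ j := by exact_mod_cast hij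
      simp only
      gcongr
    have := hm.pairwise_disjoint_on_Ioo_succ
    simpa using this
  rw [← lintegral_biUnion_finset (fun i _ j _ hij => hd hij) fun k _ => measurableSet_Ioo]
  refine lintegral_mono_set (iUnion₂_subset fun k hk => ?_)
  obtain ⟨k1, k2, k3⟩ := step_mem_Icc hτ hT (Finset.mem_range.1 hk)
  exact Ioo_subset_Ioo k1 k3

/-- A discrete Cauchy-Schwarz inequality in which `f` need not be measurable. -/
lemma sum_le_sqrt_of_lintegral (hτ : 0 < τ) (hT : N * τ = T) {x : ℕ → ℝ}
    (hx : ∀ k < N, ENNReal.ofReal (τ * x k ^ 2) ≤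
      ∫⁻ t in Ioo (k * τ) (((k : ℝ) + 1) * τ), ‖f t‖ₑ ^ 2) {Φ : ℝ} (hΦ0 : 0 ≤ Φ)
    (hΦ : ∫⁻ t in Ioo 0 T, ‖f t‖ₑ ^ 2 ≤ ENNReal.ofReal Φ) :
    ∑ k ∈ Finset.range N, τ * x k ≤ √T * √Φ := by
  have hT0 : 0 ≤ T := by rw [← hT]; positivity
  have h1 : ∑ k ∈ Finset.range N, τ * x k ^ 2 ≤ Φ := by
    rw [← ENNReal.ofReal_le_ofReal_iff hΦ0, ENNReal.ofReal_sum_of_nonneg fun k _ => by positivity]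
    exact (Finset.sum_le_sum fun k hk => hx k (Finset.mem_range.1 hk)).trans
      ((sum_lintegral_steps_le hτ hT _).trans hΦ)
  have h2 := sq_sum_le_card_mul_sum_sq (s := Finset.range N) (f := x)
  rw [Finset.card_range] at h2
  rw [← Real.sqrt_mul hT0]
  refine Real.le_sqrt_of_sq_le ?_
  rw [← Finset.mul_sum] at h1 ⊢
  calc (τ * ∑ k ∈ Finset.range N, x k) ^ 2 = τ ^ 2 * (∑ k ∈ Finset.range N, x k) ^ 2 := by ring
    _ ≤ τ ^ 2 * (N * ∑ k ∈ Finset.range N, x k ^ 2) := by gcongr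
    _ = T * (τ * ∑ k ∈ Finset.range N, x k ^ 2) := by rw [← hT]; ring
    _ ≤ T * Φ := by gcongr

/-- The nodal values are bounded by the `L²` norm of the forcing and its variation: up to `b k` the
value `‖F (k + 1)‖` is below `‖f‖` on the whole time step. -/
lemma sum_nodalForcing_le (hτ : 0 < τ) (hT : N * τ = T) {F : ℕ → L2 Ω} {b : ℕ → ℝ}
    (hb : ∀ k < N, ∀ r ∈ Ioo (k * τ) (((k : ℝ) + 1) * τ), ‖f r - F (k + 1)‖ ≤ b k)
    {Φ : ℝ} (hΦ0 : 0 ≤ Φ) (hΦ : ∫⁻ t in Ioo 0 T, ‖f t‖ₑ ^ 2 ≤ ENNReal.ofReal Φ) :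
    ∑ k ∈ Finset.range N, τ * ‖F (k + 1)‖ ≤ √T * √Φ + τ * ∑ k ∈ Finset.range N, b k := by
  have h1 := sum_le_sqrt_of_lintegral (x := fun k => max (‖F (k + 1)‖ - b k) 0) hτ hT
    (fun k hk => ?_) hΦ0 hΦ
  · rw [Finset.mul_sum, ← sub_le_iff_le_add, ← Finset.sum_sub_distrib]
    refine (Finset.sum_le_sum fun k _ => ?_).trans h1
    rw [← mul_sub]
    gcongr
    exact le_max_left _ _
  · have hvol : volume (Ioo (k * τ) (((k : ℝ) + 1) * τ)) = ENNReal.ofReal τ := by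
      rw [Real.volume_Ioo]
      congr 1
      ring
    rw [mul_comm, ENNReal.ofReal_mul (by positivity), ← hvol, ← setLIntegral_const]
    refine setLIntegral_mono' measurableSet_Ioo fun t ht => ?_
    rw [enorm_sq_eq_ofReal]
    gcongr
    refine max_le ?_ (norm_nonneg _)
    have h2 := hb k hk t ht
    have h3 := norm_sub_norm_le (F (k + 1)) (f t)
    rw [norm_sub_rev] at h3
    linarith

lemma sum_average_le (hτ : 0 < τ) (hT : N * τ = T) (hf : MemLp f 2 (volume.restrict (Ioo 0 T)))
    {F : ℕ → L2 Ω}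
    (hF : ∀ k < N, F (k + 1) = τ⁻¹ • ∫ t in (k * τ)..(((k : ℝ) + 1) * τ), f t)
    {Φ : ℝ} (hΦ0 : 0 ≤ Φ) (hΦ : ∫⁻ t in Ioo 0 T, ‖f t‖ₑ ^ 2 ≤ ENNReal.ofReal Φ) :
    ∑ k ∈ Finset.range N, τ * ‖F (k + 1)‖ ≤ √T * √Φ := by
  refine sum_le_sqrt_of_lintegral hτ hT (fun k hk => ?_) hΦ0 hΦ
  obtain ⟨k1, k2, k3⟩ := step_mem_Icc hτ hT hk
  rw [← ofReal_integral_norm_sq k2.le (intervalIntegrable_norm_sq_of_memLp hf k1 k2.le k3)]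
  refine ENNReal.ofReal_le_ofReal ?_
  have h1 := sq_integral_norm_le_of_memLp hf k1 k2 k3
  have h2 := intervalIntegral.norm_integral_le_integral_norm (f := f) (μ := volume) k2.le
  have h3 : ((k : ℝ) + 1) * τ - k * τ = τ := by ring
  rw [h3] at h1
  rw [hF k hk, norm_smul, mul_pow, Real.norm_of_nonneg (by positivity), inv_pow, sq τ, mul_inv,
    ← mul_assoc, ← mul_assoc, mul_inv_cancel₀ hτ.ne', one_mul, inv_mul_le_iff₀ hτ]
  exact (pow_le_pow_left₀ (norm_nonneg _) h2 2).trans h1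

lemma eLpNorm_two_sq {X : Type*} [NormedAddCommGroup X] (g : ℝ → X) (μ : Measure ℝ) :
    eLpNorm g 2 μ ^ 2 = ∫⁻ t, ‖g t‖ₑ ^ 2 ∂μ := by
  rw [eLpNorm_eq_lintegral_rpow_enorm_toReal two_ne_zero ENNReal.ofNat_ne_top,
    ← ENNReal.rpow_natCast,
    ← ENNReal.rpow_mul]
  simp

end Forcing

/-! ### Error bounds for the truncated scheme -/

section Norms

variable {d : ℕ} {Ω : Set (E d)} {c s T : ℝ} {ψ u₀ : L2 Ω} {f : ℝ → L2 Ω} {Φ : ℝ}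

lemma hNorm_eq (hc : IsEigenvalueBound Ω c) {w : L2 Ω} (hw : w ∈ hSpace Ω s) :
    hNorm Ω s w = ENNReal.ofReal √(fracEnergy Ω s w) := by
  have h := fracPairing_self_nonneg hc s w
  rw [hNorm, hNormSq_eq hc hw, ENNReal.ofReal_rpow_of_nonneg h (by norm_num), Real.sqrt_eq_rpow,
    fracEnergy]

lemma eLpNorm_two_eq (hΦ0 : 0 ≤ Φ) (hΦ : ∫⁻ t in Ioo 0 T, ‖f t‖ₑ ^ 2 = ENNReal.ofReal Φ) :
    eLpNorm f 2 (volume.restrict (Ioo 0 T)) = ENNReal.ofReal √Φ := by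
  have h := eLpNorm_two_sq f (volume.restrict (Ioo 0 T))
  rw [hΦ, ← Real.sq_sqrt hΦ0, ENNReal.ofReal_pow (Real.sqrt_nonneg _)] at h
  exact (ENNReal.pow_right_strictMono two_ne_zero).injective h

lemma dataNorm_eq (hc : IsEigenvalueBound Ω c) (hψ : ψ ∈ hSpace Ω s) (hΦ0 : 0 ≤ Φ)
    (hΦ : ∫⁻ t in Ioo 0 T, ‖f t‖ₑ ^ 2 = ENNReal.ofReal Φ) :
    dataNorm Ω s T ψ u₀ f = ENNReal.ofReal √(‖u₀‖ ^ 2 + Φ + fracEnergy Ω s ψ) := by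
  have h := fracPairing_self_nonneg hc s ψ
  rw [dataNorm, eLpNorm_two_sq, hΦ, hNormSq_eq hc hψ, enorm_sq_eq_ofReal,
    ← ENNReal.ofReal_add (by positivity) hΦ0, ← ENNReal.ofReal_add (by positivity) h,
    ENNReal.ofReal_rpow_of_nonneg (by positivity) (by norm_num), Real.sqrt_eq_rpow, fracEnergy]

end Norms

section ErrorBounds

variable {d : ℕ} {Ω : Set (E d)} {c s τ T Y K : ℝ} {ψ u₀ : L2 Ω} {f u : ℝ → L2 Ω} {N : ℕ}
  {F : ℕ → L2 Ω} {V : ℕ → CylSpace Ω (1 - 2 * s) Y}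

/-- The factor of the data in the stability bound for the scheme; `m` is the coercivity constant
of the form. -/
def stabilityConst (T m K : ℝ) : ℝ := 1 + 2 * √T + (2 * √m⁻¹ + √(T * (1 + K / m)))

lemma stabilityConst_nonneg (T m K : ℝ) : 0 ≤ stabilityConst T m K := by
  unfold stabilityConst
  positivity

lemma IsSemidiscreteSolution.norm_le_data (hΩo : IsOpen Ω) (hΩ : Bornology.IsBounded Ω)
    (hc : IsEigenvalueBound Ω c) (hs : s ∈ Ioo (0 : ℝ) 1) (hK : 0 ≤ K)
    (hext : HasExtension Ω s c K) (hY : 1 ≤ Y) (hψ : ψ ∈ hSpace Ω s) (hτ : 0 < τ)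
    (hT : N * τ = T) (hV : IsSemidiscreteSolution Ω s Y ψ u₀ F N τ V) {Φ S : ℝ} (hΦ : 0 ≤ Φ)
    (hS : ∑ j ∈ Finset.range N, τ * ‖F (j + 1)‖ ≤ √T * √Φ + S) {k : ℕ} (hk : k ≤ N) :
    ‖tr (V k)‖ ≤
      stabilityConst T (c ^ s) K * √(‖u₀‖ ^ 2 + Φ + fracEnergy Ω s ψ) + 2 * S := by
  have h := hV.norm_le hΩo hΩ hc hs hK hext hY hψ hτ hk
  have hq : 0 ≤ fracEnergy Ω s ψ := fracPairing_self_nonneg hc s ψ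
  have h1 : ‖u₀‖ ≤ √(‖u₀‖ ^ 2 + Φ + fracEnergy Ω s ψ) := Real.le_sqrt_of_sq_le (by linarith)
  have h2 : √Φ ≤ √(‖u₀‖ ^ 2 + Φ + fracEnergy Ω s ψ) :=
    Real.sqrt_le_sqrt (by nlinarith [sq_nonneg ‖u₀‖])
  have h3 : √(fracEnergy Ω s ψ) ≤ √(‖u₀‖ ^ 2 + Φ + fracEnergy Ω s ψ) :=
    Real.sqrt_le_sqrt (by nlinarith [sq_nonneg ‖u₀‖])
  rw [hT] at h
  set R := √(‖u₀‖ ^ 2 + Φ + fracEnergy Ω s ψ)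
  have h4 := mul_le_mul_of_nonneg_left h2 (Real.sqrt_nonneg T)
  have h5 : (2 * √(c ^ s)⁻¹ + √(T * (1 + K / c ^ s))) * √(fracPairing Ω s ψ ψ) ≤
      (2 * √(c ^ s)⁻¹ + √(T * (1 + K / c ^ s))) * R := mul_le_mul_of_nonneg_left h3 (by positivity)
  unfold stabilityConst
  linarith

/-- The error bound for averaged forcing terms. The consistency error of the scheme is bounded by
means of its stability, which produces the term with the data norm. -/
theorem timeError_le_of_average (hΩo : IsOpen Ω) (hΩ : Bornology.IsBounded Ω)
    (hc : IsEigenvalueBound Ω c) (hs : s ∈ Ioo (0 : ℝ) 1) (hK : 0 ≤ K)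
    (hext : HasExtension Ω s c K) (hY : 1 ≤ Y) (hψ : ψ ∈ hSpace Ω s) (hu₀ : u₀ ∈ hSpace Ω s)
    (hτ : 0 < τ) (hT : N * τ = T) (hT0 : 0 < T) (hu : IsStrongSolution Ω s T ψ u₀ f u)
    (hf : MemLp f 2 (volume.restrict (Ioo 0 T)))
    (hV : IsSemidiscreteSolution Ω s Y ψ u₀ (averageForcing τ f) N τ V) {ε : ℝ}
    (hε : Real.exp (-(√c * Y / 2)) ≤ ε) :
    timeError Ω s T τ u (fun k => tr (V k)) ≤
      ENNReal.ofReal (32 + 4 * √(12 * T / c ^ s) * (K * stabilityConst T (c ^ s) K)) *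
        (ENNReal.ofReal (τ ^ (1 / 2 : ℝ)) *
            (hNorm Ω s u₀ + eLpNorm f 2 (volume.restrict (Ioo 0 T))) +
          ENNReal.ofReal ε * dataNorm Ω s T ψ u₀ f) := by
  have hcs : 0 < c ^ s := Real.rpow_pos_of_pos hc.1 s
  set Φ := ∫ t in (0)..T, ‖f t‖ ^ 2 with hΦdef
  have hΦ0 : 0 ≤ Φ := intervalIntegral.integral_nonneg hT0.le fun t _ => by positivity
  have hΦ : ∫⁻ t in Ioo 0 T, ‖f t‖ₑ ^ 2 = ENNReal.ofReal Φ :=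
    (ofReal_integral_norm_sq hT0.le
      (intervalIntegrable_norm_sq_of_memLp hf le_rfl hT0.le le_rfl)).symm
  have hF : ∀ k < N, averageForcing τ f (k + 1) =
      τ⁻¹ • ∫ t in (k * τ)..(((k : ℝ) + 1) * τ), f t := fun k _ => by
    rw [averageForcing]
    push_cast
    rw [add_sub_cancel_right]
  have hε0 : 0 ≤ ε := (Real.exp_pos _).le.trans hε
  set q0 := fracEnergy Ω s u₀ with hq0
  have hq00 : 0 ≤ q0 := fracPairing_self_nonneg hc s u₀
  set A := stabilityConst T (c ^ s) K with hA
  have hA0 : 0 ≤ A := stabilityConst_nonneg _ _ _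
  set R := √(‖u₀‖ ^ 2 + Φ + fracEnergy Ω s ψ) with hR
  have hR0 : 0 ≤ R := Real.sqrt_nonneg _
  have hM : ∀ k ≤ N, ‖tr (V k)‖ ≤ A * R := fun k hk => by
    have := hV.norm_le_data hΩo hΩ hc hs hK hext hY hψ hτ hT (S := 0) hΦ0
      (by rw [add_zero]; exact sum_average_le hτ hT hf hF hΦ0 hΦ.le) hk
    linarith
  set κ := K * Real.exp (-(√c * Y / 2)) * (A * R) with hκ
  have hκ0 : 0 ≤ κ := by positivity
  have hκle : κ ≤ K * A * (ε * R) := by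
    rw [hκ]
    calc _ ≤ K * ε * (A * R) := by gcongr
      _ = _ := by ring
  have hsch := hV.isApproxScheme hc hs hK hext hY hM
  have hevi := hu.isEVISolution hc
  have h0 : u 0 = tr (V 0) := by rw [hu.2.2.1, hV.2.1]
  obtain ⟨h1, h2⟩ := hevi.error_of_memLp (isEnergy_fracEnergy hΩo hΩ hc hs.1.le ψ)
    (measurable_fracEnergy_comp hc) hsch hτ hT hT0 h0 hf hF rfl
  simp only [hV.2.1] at h1 h2
  rw [← hΦdef, ← hq0, ← hκ] at h1 h2
  set X := τ * (55 * Φ + 21 * q0) + 12 * T * κ ^ 2 / c ^ s with hX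
  have hX0 : 0 ≤ X := by positivity
  have hXle : √X ≤ √τ * (8 * (√q0 + √Φ)) + √(12 * T / c ^ s) * κ := by
    refine Real.sqrt_le_iff.2 ⟨by positivity, ?_⟩
    have e1 := Real.sq_sqrt hτ.le
    have e2 := Real.sq_sqrt hq00
    have e3 := Real.sq_sqrt hΦ0
    have e4 := Real.sq_sqrt (show 0 ≤ 12 * T / c ^ s by positivity)
    have e5 : X = √τ ^ 2 * (55 * √Φ ^ 2 + 21 * √q0 ^ 2) + √(12 * T / c ^ s) ^ 2 * κ ^ 2 := by
      rw [e1, e2, e3, e4, hX]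
      ring
    rw [e5, add_sq]
    have e6 : √τ ^ 2 * (55 * √Φ ^ 2 + 21 * √q0 ^ 2) ≤ (√τ * (8 * (√q0 + √Φ))) ^ 2 := by
      rw [mul_pow]
      gcongr
      nlinarith [Real.sqrt_nonneg q0, Real.sqrt_nonneg Φ,
        mul_nonneg (Real.sqrt_nonneg q0) (Real.sqrt_nonneg Φ)]
    have e7 : 0 ≤ 2 * (√τ * (8 * (√q0 + √Φ))) * (√(12 * T / c ^ s) * κ) := by positivity
    rw [mul_pow √(12 * T / c ^ s)]
    linarith
  have hmem : ∀ᵐ t ∂(volume.restrict (Ioo 0 T)), u t ∈ hSpace Ω s :=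
    hu.2.2.2.mono fun t ht => ht.1.1
  refine (timeError_le hc hτ hT hmem
    (fun k hk => (hV.tr_mem_admissible hc hs hY hk).1) (by positivity) hX0 h1 h2).trans ?_
  rw [hNorm_eq hc hu₀, eLpNorm_two_eq hΦ0 hΦ, dataNorm_eq hc hψ hΦ0 hΦ, ← hR, ← hq0,
    ← Real.sqrt_eq_rpow, ← ENNReal.ofReal_add (by positivity) (by positivity),
    ← ENNReal.ofReal_mul (by positivity), ← ENNReal.ofReal_mul (by positivity),
    ← ENNReal.ofReal_add (by positivity) (by positivity), ← ENNReal.ofReal_mul (by positivity)]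
  refine ENNReal.ofReal_le_ofReal ?_
  have h3 : √(2 * X) ≤ 2 * √X := by
    rw [Real.sqrt_mul zero_le_two]
    gcongr
    exact Real.sqrt_le_iff.2 ⟨by norm_num, by norm_num⟩
  have h4 : √(12 * T / c ^ s) * κ ≤ √(12 * T / c ^ s) * (K * A * (ε * R)) := by gcongr
  have h5 : 0 ≤ √(12 * T / c ^ s) * (K * A) * (√τ * (√q0 + √Φ)) := by positivity
  have h6 : 0 ≤ ε * R := by positivity
  calc 2 * √X + √(2 * X) ≤ 4 * √X := by linarith
    _ ≤ 4 * (√τ * (8 * (√q0 + √Φ)) + √(12 * T / c ^ s) * (K * A * (ε * R))) := by linarith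
    _ ≤ (32 + 4 * √(12 * T / c ^ s) * (K * A)) * (√τ * (√q0 + √Φ) + ε * R) := by linarith

/-- The error bound for forcing terms of bounded variation. The initial value enters through the
initial time derivative `f_+(0) - (-Δ)^s u₀` of the problem without obstacle. -/
theorem timeError_le_of_boundedVariation (hΩo : IsOpen Ω) (hΩ : Bornology.IsBounded Ω)
    (hc : IsEigenvalueBound Ω c) (hs : s ∈ Ioo (0 : ℝ) 1) (hK : 0 ≤ K)
    (hext : HasExtension Ω s c K) (hY : 1 ≤ Y) (hψ : ψ ∈ hSpace Ω s)
    (hu₀ : u₀ ∈ hSpace Ω (2 * s)) (hN : 0 < N)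
    (hτ : 0 < τ) (hT : N * τ = T) (hT0 : 0 < T) (hu : IsStrongSolution Ω s T ψ u₀ f u)
    (hf : BoundedVariationOn f (Icc 0 T))
    (hV : IsSemidiscreteSolution Ω s Y ψ u₀ (nodalForcing T τ f) N τ V) {ε : ℝ}
    (hε : Real.exp (-(√c * Y / 2)) ≤ ε) :
    timeError Ω s T τ u (fun k => tr (V k)) ≤
      ENNReal.ofReal (6 * (5 + √(2 * T ^ 2 + 6 * T / c ^ s)) *
        (1 + 2 * K + K * stabilityConst T (c ^ s) K)) *
        (ENNReal.ofReal τ * (‖rightLimit T f 0 - fracLaplacian Ω s u₀‖ₑ +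
            eVariationOn f (Icc 0 T)) +
          ENNReal.ofReal ε * dataNorm Ω s T ψ u₀ f) := by
  have hcs : 0 < c ^ s := Real.rpow_pos_of_pos hc.1 s
  have hε0 : 0 < ε := (Real.exp_pos _).trans_le hε
  set G := 2 * (5 + √(2 * T ^ 2 + 6 * T / c ^ s)) with hG
  have hG0 : 0 < G := by positivity
  set A := stabilityConst T (c ^ s) K with hA
  have hA0 : 0 ≤ A := stabilityConst_nonneg _ _ _
  have eC : 6 * (5 + √(2 * T ^ 2 + 6 * T / c ^ s)) * (1 + 2 * K + K * A) =
    3 * G * (1 + 2 * K + K * A) := by rw [hG]; ring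
  rw [eC]
  -- If `f` is not square integrable, the right-hand side is infinite.
  by_cases htop : ∫⁻ t in Ioo 0 T, ‖f t‖ₑ ^ 2 = ∞
  · have hd : dataNorm Ω s T ψ u₀ f = ∞ := by
      rw [dataNorm, eLpNorm_two_sq, htop, add_top, top_add,
        ENNReal.top_rpow_of_pos (by norm_num)]
    rw [hd, ENNReal.mul_top (ENNReal.ofReal_pos.2 hε0).ne', add_top,
      ENNReal.mul_top (ENNReal.ofReal_pos.2 (by positivity)).ne']
    exact le_top
  set Φ := (∫⁻ t in Ioo 0 T, ‖f t‖ₑ ^ 2).toReal with hΦdef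
  have hΦ0 : 0 ≤ Φ := ENNReal.toReal_nonneg
  have hΦ : ∫⁻ t in Ioo 0 T, ‖f t‖ₑ ^ 2 = ENNReal.ofReal Φ := (ENNReal.ofReal_toReal htop).symm
  obtain ⟨b, hb, hfb, hbsum⟩ := exists_nodalForcing_bound hf hτ hT
  set B := (eVariationOn f (Icc 0 T)).toReal with hB
  have hB0 : 0 ≤ B := ENNReal.toReal_nonneg
  set R := √(‖u₀‖ ^ 2 + Φ + fracEnergy Ω s ψ) with hR
  have hR0 : 0 ≤ R := Real.sqrt_nonneg _
  have hM : ∀ k ≤ N, ‖tr (V k)‖ ≤ A * R + 2 * (τ * B) := fun k hk => by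
    refine hV.norm_le_data hΩo hΩ hc hs hK hext hY hψ hτ hT hΦ0 ?_ hk
    refine (sum_nodalForcing_le hτ hT hfb hΦ0 hΦ.le).trans ?_
    gcongr
  set κ := K * Real.exp (-(√c * Y / 2)) * (A * R + 2 * (τ * B)) with hκ
  have hκ0 : 0 ≤ κ := by positivity
  -- The part of `κ` that comes from the variation carries a factor `τ`; the exponential is dropped.
  have hκle : κ ≤ K * A * (ε * R) + 2 * K * (τ * B) := by
    have h1 : Real.exp (-(√c * Y / 2)) ≤ 1 := Real.exp_le_one_iff.2 (by
      have : 0 ≤ √c * Y / 2 := by positivity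
      linarith)
    calc κ = K * Real.exp (-(√c * Y / 2)) * (A * R) +
          K * Real.exp (-(√c * Y / 2)) * (2 * (τ * B)) := by rw [hκ, mul_add]
      _ ≤ K * ε * (A * R) + K * 1 * (2 * (τ * B)) := by gcongr
      _ = _ := by ring
  have hsch := hV.isApproxScheme hc hs hK hext hY hM
  have hevi := hu.isEVISolution hc
  have h0 : u 0 = tr (V 0) := by rw [hu.2.2.1, hV.2.1]
  set δ₀ := rightLimit T f 0 - fracLaplacian Ω s u₀ with hδ
  have hF0 : nodalForcing T τ f 0 = rightLimit T f 0 := by simp [nodalForcing]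
  obtain ⟨h1, h2⟩ := hevi.error_of_variation (isEnergy_fracEnergy hΩo hΩ hc hs.1.le ψ) hsch hτ hκ0
    hT hN h0 hb hfb (δ₀ := δ₀) (fun φ hφ => by
      have e := two_mul_fracPairing_sub hc (hSpace_two_mul_subset hc hs.1.le hu₀) hφ.1
      rw [hV.2.1, hF0, hδ, sub_sub_cancel_left, inner_neg_left, inner_fracLaplacian hc hu₀]
      linarith) rfl
  rw [← hκ, ← hG] at h1 h2
  set D := G * (τ * (‖δ₀‖ + ∑ k ∈ Finset.range N, b k) + κ) with hD
  have hb0 : 0 ≤ ∑ k ∈ Finset.range N, b k :=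
    Finset.sum_nonneg fun k hk => (norm_nonneg _).trans (hb k (Finset.mem_range.1 hk))
  have hD0 : 0 ≤ D := by positivity
  have hmem : ∀ᵐ t ∂(volume.restrict (Ioo 0 T)), u t ∈ hSpace Ω s :=
    hu.2.2.2.mono fun t ht => ht.1.1
  refine (timeError_le hc hτ hT hmem
    (fun k hk => (hV.tr_mem_admissible hc hs hY hk).1) hD0 (sq_nonneg D) h1 h2).trans ?_
  rw [dataNorm_eq hc hψ hΦ0 hΦ, ← hR, ← ofReal_norm δ₀, ← ENNReal.ofReal_toReal hf, ← hB,
    ← ENNReal.ofReal_add (by positivity) (by positivity),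
    ← ENNReal.ofReal_mul (by positivity), ← ENNReal.ofReal_mul (by positivity),
    ← ENNReal.ofReal_add (by positivity) (by positivity), ← ENNReal.ofReal_mul (by positivity)]
  refine ENNReal.ofReal_le_ofReal ?_
  have h3 : √(2 * D ^ 2) ≤ 2 * D := by
    rw [Real.sqrt_mul zero_le_two, Real.sqrt_sq hD0]
    gcongr
    exact Real.sqrt_le_iff.2 ⟨by norm_num, by norm_num⟩
  have h4 : τ * (‖δ₀‖ + ∑ k ∈ Finset.range N, b k) ≤ τ * (‖δ₀‖ + B) := by gcongr
  have h5 : 0 ≤ K * (τ * ‖δ₀‖) := by positivity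
  have h6 : 0 ≤ K * A * (τ * (‖δ₀‖ + B)) := by positivity
  have h7 : 0 ≤ (1 + 2 * K) * (ε * R) := by positivity
  calc D + √(2 * D ^ 2) ≤ 3 * D := by linarith
    _ = 3 * G * (τ * (‖δ₀‖ + ∑ k ∈ Finset.range N, b k) + κ) := by rw [hD]; ring
    _ ≤ 3 * G * ((1 + 2 * K + K * A) * (τ * (‖δ₀‖ + B) + ε * R)) := by
        gcongr
        linarith
    _ = _ := by ring

end ErrorBounds

end FracObstacle

end

theorem mainTheorem5 {d : ℕ} (hd : 1 ≤ d) (Ω : Set (FracObstacle.E d))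
    (hΩ : FracObstacle.IsConvexPolyhedralDomain Ω)
    (s : ℝ) (hs : s ∈ Set.Ioo (0 : ℝ) 1) (T : ℝ) (hT : 0 < T) :
    ∃ C : ℝ≥0,
      ∀ ψ : FracObstacle.L2 Ω, FracObstacle.IsObstacle Ω s ψ →
      ∀ u₀ ∈ FracObstacle.admissible Ω s ψ,
      ∀ f u : ℝ → FracObstacle.L2 Ω,
      ∀ Y : ℝ, 1 ≤ Y →
      ∀ (N : ℕ), 0 < N → ∀ τ : ℝ, τ = T / N →
      ∀ V : ℕ → FracObstacle.CylSpace Ω (1 - 2 * s) Y,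
        FracObstacle.IsStrongSolution Ω s T ψ u₀ f u →
        (MemLp f 2 (volume.restrict (Set.Ioo 0 T)) →
          FracObstacle.IsSemidiscreteSolution Ω s Y ψ u₀
            (FracObstacle.averageForcing τ f) N τ V →
          FracObstacle.timeError Ω s T τ u (fun k => FracObstacle.tr (V k)) ≤
            C * (ENNReal.ofReal (τ ^ (1 / 2 : ℝ)) *
                (FracObstacle.hNorm Ω s u₀ + eLpNorm f 2 (volume.restrict (Set.Ioo 0 T)))
              + ENNReal.ofReal (Real.exp (-(√(FracObstacle.firstEigenvalue Ω) * Y / 8))) *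
                FracObstacle.dataNorm Ω s T ψ u₀ f)) ∧
        (u₀ ∈ FracObstacle.hSpace Ω (2 * s) →
          BoundedVariationOn f (Set.Icc 0 T) →
          FracObstacle.IsSemidiscreteSolution Ω s Y ψ u₀
            (FracObstacle.nodalForcing T τ f) N τ V →
          FracObstacle.timeError Ω s T τ u (fun k => FracObstacle.tr (V k)) ≤
            C * (ENNReal.ofReal τ *
                (‖FracObstacle.rightLimit T f 0 - FracObstacle.fracLaplacian Ω s u₀‖ₑ
                  + eVariationOn f (Set.Icc 0 T))
              + ENNReal.ofReal (Real.exp (-(√(FracObstacle.firstEigenvalue Ω) * Y / 8))) *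
                FracObstacle.dataNorm Ω s T ψ u₀ f)) := by
  obtain ⟨c, hc, hlc⟩ := FracObstacle.exists_bound_ge_firstEigenvalue hd hΩ.isOpen hΩ.2.1
  obtain ⟨K, hK, hext⟩ := FracObstacle.exists_extension hΩ.isOpen hΩ.2.1 hc hs
  have hcs : 0 < c ^ s := Real.rpow_pos_of_pos hc.1 s
  have hA := FracObstacle.stabilityConst_nonneg T (c ^ s) K
  set C₁ := 32 + 4 * √(12 * T / c ^ s) * (K * FracObstacle.stabilityConst T (c ^ s) K)
  set C₂ := 6 * (5 + √(2 * T ^ 2 + 6 * T / c ^ s)) *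
    (1 + 2 * K + K * FracObstacle.stabilityConst T (c ^ s) K)
  have hC₁ : 0 ≤ C₁ := by positivity
  have hC₂ : 0 ≤ C₂ := by positivity
  refine ⟨(C₁ + C₂).toNNReal, fun ψ hψ u₀ hu₀ f u Y hY N hN τ hτN V hu => ?_⟩
  have hN' : (0 : ℝ) < N := by exact_mod_cast hN
  have hτ : 0 < τ := by rw [hτN]; positivity
  have hNτ : N * τ = T := by rw [hτN]; field_simp
  have hε : Real.exp (-(√c * Y / 2)) ≤
      Real.exp (-(√(FracObstacle.firstEigenvalue Ω) * Y / 8)) := by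
    have h1 : √(FracObstacle.firstEigenvalue Ω) * Y ≤ √c * Y := by gcongr
    have h2 : 0 ≤ √c * Y := by positivity
    exact Real.exp_le_exp.2 (by linarith)
  refine ⟨fun hf hV => ?_, fun hu₀' hf hV => ?_⟩
  · refine (FracObstacle.timeError_le_of_average hΩ.isOpen hΩ.2.1 hc hs hK hext hY hψ.1 hu₀.1 hτ hNτ
      hT hu hf hV hε).trans (mul_le_mul_left ?_ _)
    exact ENNReal.ofReal_le_ofReal (le_add_of_nonneg_right hC₂)
  · refine (FracObstacle.timeError_le_of_boundedVariation hΩ.isOpen hΩ.2.1 hc hs hK hext hY hψ.1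
      hu₀' hN hτ hNτ hT hu hf hV hε).trans (mul_le_mul_left ?_ _)
    exact ENNReal.ofReal_le_ofReal (le_add_of_nonneg_left hC₁)
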